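/- Let $K_0$ be a field of characteristic $0$ that is finitely generated as a field over $\mathbf{Q}$, and let $A$ be an abelian variety over $K_0$ (a proper, geometrically integral group scheme over $K_0$). Then for all but finitely many prime numbers $p$ there exist a finite field extension $K$ of $\mathbf{Q}_p$ and an embedding of fields $K_0 \hookrightarrow K$ such that the abelian variety $A_K = A\times_{\operatorname{Spec} K_0}\operatorname{Spec} K$ has good reduction at the unique place of $K$ above $p$; that is, writing $\mathcal{O}_K$ for the ring of integers of $K$ (the integral closure of $\mathbf{Z}_p$ in $K$), there is an abelian scheme $\mathcal{A}$ over $\operatorname{Spec}\mathcal{O}_K$ (a smooth proper group scheme with geometrically connected fibres) whose generic fibre $\mathcal{A}\times_{\operatorname{Spec}\mathcal{O}_K}\operatorname{Spec} K$ is isomorphic to $A_K$ as a group scheme over $K$. -/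

import Mathlib

open CategoryTheory AlgebraicGeometry

universe u

/-- Base change of group schemes along a morphism `f : T ⟶ S`: the group scheme `G ×_S T` over `T`,
with the group law induced from that of `G`. -/
noncomputable abbrev groupSchemeBaseChange {S T : Scheme.{u}} (f : T ⟶ S) (G : Grp (Over S)) :
    Grp (Over T) :=
  (Over.pullback f).mapGrp.obj G

/-- An abelian variety over a field `K`: a group scheme over `K` that is proper and geometrically
integral, that is, a proper (connected) group variety. -/
structure IsAbelianVariety {K : Type u} [Field K] (A : Grp (Over (Spec (.of K)))) : Prop where
  isProper : IsProper A.X.hom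
  geometricallyIntegral : GeometricallyIntegral A.X.hom

/-- An abelian scheme over a scheme `S`: a group scheme over `S` that is smooth and proper with
geometrically connected fibres. -/
structure IsAbelianScheme {S : Scheme.{u}} (A : Grp (Over S)) : Prop where
  smooth : Smooth A.X.hom
  isProper : IsProper A.X.hom
  geometricallyConnected : GeometricallyConnected A.X.hom

/-- The ring of integers of an extension field `K` of `ℚ_[p]`: the integral closure in `K` of the
ring of `p`-adic integers. If `K` is finite over `ℚ_[p]`, it is the valuation ring of the unique
extension to `K` of the `p`-adic absolute value. -/
noncomputable abbrev padicRingOfIntegers (p : ℕ) [Fact p.Prime] (K : Type u) [Field K]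
    [Algebra ℚ_[p] K] : Subalgebra (PadicInt.subring p) K :=
  integralClosure (PadicInt.subring p) K

/-- `K` is the field of fractions of its ring of integers. -/
instance padicRingOfIntegers_isFractionRing (p : ℕ) [Fact p.Prime] (K : Type u) [Field K]
    [Algebra ℚ_[p] K] [FiniteDimensional ℚ_[p] K] :
    IsFractionRing (padicRingOfIntegers p K) K :=
  haveI : IsFractionRing (PadicInt.subring p) ℚ_[p] :=
    inferInstanceAs (IsFractionRing ℤ_[p] ℚ_[p])
  integralClosure.isFractionRing_of_finite_extension ℚ_[p] K

/-- Let `R` be a domain with field of fractions `K` (typically a discrete valuation ring). A group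
scheme `A` over `K` has good reduction over `R` if it is isomorphic, as a group scheme over `K`,
to the generic fibre of an abelian scheme over `Spec R`. -/
def HasGoodReduction (R : Type u) [CommRing R] [IsDomain R] {K : Type u} [Field K] [Algebra R K]
    [IsFractionRing R K] (A : Grp (Over (Spec (.of K)))) : Prop :=
  ∃ 𝒜 : Grp (Over (Spec (.of R))), IsAbelianScheme 𝒜 ∧
    Nonempty (groupSchemeBaseChange (Spec.map (CommRingCat.ofHom (algebraMap R K))) 𝒜 ≅ A)

/-! The variety `A` is spread out to an abelian scheme `Y` over a finitely generated subring `B` of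
`K₀`. For almost all `p`, `B` is then mapped into the ring of integers of a finite extension of
`ℚ_[p]`, compatibly with an embedding of `K₀`. Pulling `Y` back along this map gives the abelian
scheme that is sought.

Spreading out. `Spec K₀` is the limit of the spectra of its finitely generated subrings. A smooth
model is built from affine pieces glued over larger and larger subrings (`SpecModel.exists_smooth`),
and enlarging `B` makes it separated (`SpecModel.exists_isSeparated`). Properness
(`SpecModel.exists_isProper`) is checked by valuation rings of the function field. That the relevant
ones extend the generic point is a condition which, by a compactness argument in the style of
Riemann–Zariski spaces, depends on finitely many elements of `K₀` only; these are adjoined to `B`.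
The group operations descend because the models are finitely presented. The group axioms then hold
automatically, the generic fibre being scheme-theoretically dense in every flat model
(`SpecModel.exists_grp`).

Connected fibres. In characteristic zero the map `[n]` acts on the cotangent space at the origin of
the generic fibre as the invertible scalar `n`, so it is injective on the local ring there and hence
dominant. By density and properness `[n]` is surjective on all of `Y`, also where `n` is not
invertible. Every geometric fibre is then a divisible group scheme of finite type. Its finite set of
components is killed by a suitable power map, so it is connected
(`geometricallyConnected_of_isIntegral`).

Embedding. By Noether normalization over `ℚ`, generators of `B` are integral over a polynomial ring
`ℚ[t₁, …, tₙ]` over which `K₀` is algebraic. Only finitely many primes occur in the denominators of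
the integral equations. For any other `p`, the variables are sent to algebraically independent
elements of `ℤ_[p]`, which exist because `ℤ_[p]` is uncountable (`exists_ringHom_padic`). -/

section

open Limits

/-! ### Limits along the finitely generated subrings of a ring -/

section LimitSystem

variable {R : Type u} [CommRing R]

/-- The morphism of spectra induced by an inclusion of subrings. -/
noncomputable abbrev specIncl {B B' : Subalgebra ℤ R} (h : B ≤ B') :
    Spec (.of B') ⟶ Spec (.of B) :=
  Spec.map (CommRingCat.ofHom (Subalgebra.inclusion h).toRingHom)

/-- The morphism of spectra induced by the inclusion of a subring in the whole ring. -/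
noncomputable abbrev specVal (B : Subalgebra ℤ R) : Spec (.of R) ⟶ Spec (.of B) :=
  Spec.map (CommRingCat.ofHom B.val.toRingHom)

lemma specVal_specIncl {B B' : Subalgebra ℤ R} (h : B ≤ B') :
    specVal B' ≫ specIncl h = specVal B := by
  rw [← Spec.map_comp]; rfl

lemma specIncl_specIncl {B B' B'' : Subalgebra ℤ R} (h : B ≤ B') (h' : B' ≤ B'') :
    specIncl h' ≫ specIncl h = specIncl (h.trans h') := by
  rw [← Spec.map_comp]; rfl

lemma specIncl_refl (B : Subalgebra ℤ R) : specIncl (le_refl B) = 𝟙 _ := by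
  rw [← Spec.map_id]; rfl

/-- The finitely generated subrings containing a given one. -/
abbrev FGAbove (B₀ : Subalgebra ℤ R) : Type u := {B : Subalgebra ℤ R // B.FG ∧ B₀ ≤ B}

variable (B₀ : Subalgebra ℤ R)

lemma directed_fgAbove : IsDirectedOrder (FGAbove B₀) :=
  ⟨fun B C ↦ ⟨⟨B.1 ⊔ C.1, B.2.1.sup C.2.1, B.2.2.trans le_sup_left⟩,
    (le_sup_left : B.1 ≤ B.1 ⊔ C.1), (le_sup_right : C.1 ≤ B.1 ⊔ C.1)⟩⟩

/-- The finitely generated subrings above `B₀`, as a diagram of rings. -/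
def fgAboveFunctor : FGAbove B₀ ⥤ CommRingCat.{u} where
  obj B := .of B.1
  map {_ _} h := CommRingCat.ofHom (Subalgebra.inclusion (leOfHom h)).toRingHom

/-- The cocone with vertex the whole ring. -/
def fgAboveCocone : Cocone (fgAboveFunctor B₀) where
  pt := .of R
  ι := { app B := CommRingCat.ofHom B.1.val.toRingHom }

/-- Every `x` lies in the finitely generated subring `B₀[x]`, and the transition maps are
inclusions. For a filtered diagram this can be checked on underlying sets. -/
lemma nonempty_fgAbove_isColimit (h₀ : B₀.FG) : Nonempty (IsColimit (fgAboveCocone B₀)) := by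
  have := directed_fgAbove B₀
  have : Nonempty (FGAbove B₀) := ⟨⟨B₀, h₀, le_rfl⟩⟩
  have : ReflectsFilteredColimits (forget CommRingCat.{u}) :=
    ⟨fun _ ↦ reflectsColimitsOfShape_of_reflectsIsomorphisms⟩
  refine ReflectsColimit.reflects (F := forget _) (Types.FilteredColimit.isColimitOf' _ _ ?_ ?_)
  · intro (x : R)
    exact ⟨⟨B₀ ⊔ Algebra.adjoin ℤ {x}, h₀.sup ⟨{x}, by rw [Finset.coe_singleton]⟩, le_sup_left⟩,
      ⟨x, (le_sup_right : _ ≤ B₀ ⊔ Algebra.adjoin ℤ {x}) (Algebra.subset_adjoin rfl)⟩, rfl⟩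
  · intro B x y hxy
    exact ⟨B, 𝟙 B, by
      have : x = y := Subtype.ext hxy
      rw [this]⟩

/-- The spectra of the finitely generated subrings above `B₀`. -/
noncomputable def specFunctor : (FGAbove B₀)ᵒᵖ ⥤ Over (Spec (.of B₀)) where
  obj B := Over.mk (specIncl B.unop.2.2)
  map {B C} h := Over.homMk (specIncl (leOfHom h.unop)) (specIncl_specIncl _ _)
  map_id B := by ext1; exact specIncl_refl _
  map_comp f g := by ext1; exact (specIncl_specIncl _ _).symm

/-- The spectrum of the whole ring, as a cone over the spectra of finitely generated subrings. -/
noncomputable def specCone : Cone (specFunctor B₀) where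
  pt := Over.mk (specVal B₀)
  π :=
  { app B := Over.homMk (specVal B.unop.1) (specVal_specIncl _)
    naturality B C h := by
      ext1
      refine (Category.id_comp _).trans (specVal_specIncl (leOfHom h.unop)).symm }

lemma nonempty_isLimit_specCone (h₀ : B₀.FG) : Nonempty (IsLimit (specCone B₀)) := by
  have := directed_fgAbove B₀
  have : Nonempty (FGAbove B₀) := ⟨⟨B₀, h₀, le_rfl⟩⟩
  have := IsCofiltered.isConnected (FGAbove B₀)ᵒᵖ
  obtain ⟨hc⟩ := nonempty_fgAbove_isColimit B₀ h₀
  have h : IsLimit ((Over.forget (Spec (.of B₀))).mapCone (specCone B₀)) :=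
    isLimitOfPreserves Scheme.Spec hc.op
  exact ⟨isLimitOfReflects (Over.forget _) h⟩


variable {B₀} {X W N : Scheme.{u}} {p : W ⟶ Spec (.of B₀)} {q : X ⟶ W} {f : X ⟶ Spec (.of R)}

variable (p) in
/-- The base changes of a scheme over `B₀` to the finitely generated subrings above `B₀` form a
cofiltered system whose limit is the base change to the whole ring. -/
lemma exists_baseChange_isLimit (h₀ : B₀.FG) (H : IsPullback q f p (specVal B₀)) :
    ∃ (D : (FGAbove B₀)ᵒᵖ ⥤ Scheme.{u}) (c : Cone D) (_ : IsLimit c)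
      (w : ∀ B, D.obj B ⟶ W) (s : ∀ B : (FGAbove B₀)ᵒᵖ, D.obj B ⟶ Spec (.of B.unop.1))
      (e : X ≅ c.pt),
      (∀ B, IsPullback (w B) (s B) p (specIncl B.unop.2.2)) ∧
      (∀ (B C) (g : B ⟶ C), D.map g ≫ w C = w B) ∧
      (∀ (B C) (g : B ⟶ C), D.map g ≫ s C = s B ≫ specIncl (leOfHom g.unop)) ∧
      (∀ B, e.hom ≫ c.π.app B ≫ w B = q) ∧
      (∀ B, e.hom ≫ c.π.app B ≫ s B = f ≫ specVal B.unop.1) := by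
  have := directed_fgAbove B₀
  have : Nonempty (FGAbove B₀) := ⟨⟨B₀, h₀, le_rfl⟩⟩
  have := IsCofiltered.isConnected (FGAbove B₀)ᵒᵖ
  obtain ⟨hc⟩ := nonempty_isLimit_specCone B₀ h₀
  refine ⟨specFunctor B₀ ⋙ Over.pullback p ⋙ Over.forget W,
    (Over.pullback p ⋙ Over.forget W).mapCone (specCone B₀), isLimitOfPreserves _ hc,
    fun B ↦ pullback.snd (specIncl B.unop.2.2) p, fun B ↦ pullback.fst (specIncl B.unop.2.2) p,
    H.flip.isoPullback, fun B ↦ (IsPullback.of_hasPullback _ _).flip,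
    fun B C g ↦ pullback.lift_snd _ _ _, fun B C g ↦ pullback.lift_fst _ _ _, fun B ↦ ?_,
    fun B ↦ ?_⟩
  · have h : ((Over.pullback p ⋙ Over.forget W).mapCone (specCone B₀)).π.app B ≫
      pullback.snd (specIncl B.unop.2.2) p = pullback.snd _ _ := pullback.lift_snd _ _ _
    exact (congrArg (H.flip.isoPullback.hom ≫ ·) h).trans H.flip.isoPullback_hom_snd
  · have h : ((Over.pullback p ⋙ Over.forget W).mapCone (specCone B₀)).π.app B ≫
      pullback.fst (specIncl B.unop.2.2) p = pullback.fst _ _ ≫ specVal B.unop.1 :=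
      pullback.lift_fst _ _ _
    exact (congrArg (H.flip.isoPullback.hom ≫ ·) h).trans
      (H.flip.isoPullback_hom_fst_assoc _)

lemma isAffineHom_of_isPullback_specIncl {D : (FGAbove B₀)ᵒᵖ ⥤ Scheme.{u}}
    {w : ∀ B, D.obj B ⟶ W} {s : ∀ B : (FGAbove B₀)ᵒᵖ, D.obj B ⟶ Spec (.of B.unop.1)}
    (h : ∀ B, IsPullback (w B) (s B) p (specIncl B.unop.2.2))
    (hw : ∀ (B C) (g : B ⟶ C), D.map g ≫ w C = w B)
    (hs : ∀ (B C) (g : B ⟶ C), D.map g ≫ s C = s B ≫ specIncl (leOfHom g.unop))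
    {B C : (FGAbove B₀)ᵒᵖ} (g : B ⟶ C) : IsAffineHom (D.map g) := by
  have : IsPullback (D.map g) (s B) (s C) (specIncl (leOfHom g.unop)) := by
    refine IsPullback.of_right (h₁₂ := w C) (v₁₃ := p)
      (h₂₂ := specIncl C.unop.2.2) ?_ (hs _ _ _) (h C)
    rw [specIncl_specIncl, hw]
    exact h B
  exact MorphismProperty.of_isPullback this.flip inferInstance

/-- A morphism from a limit of quasi-compact quasi-separated schemes with affine transition maps to
a scheme locally of finite presentation factors through a finite stage. -/
lemma exists_desc_of_locallyOfFinitePresentation (h₀ : B₀.FG)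
    [hqc : QuasiCompact p] [hqs : QuasiSeparated p] (H : IsPullback q f p (specVal B₀))
    (n : N ⟶ Spec (.of B₀)) [LocallyOfFinitePresentation n] (a : X ⟶ N)
    (ha : a ≫ n = f ≫ specVal B₀) :
    ∃ (B : Subalgebra ℤ R) (_ : B.FG) (h : B₀ ≤ B) (g : pullback p (specIncl h) ⟶ N),
      g ≫ n = pullback.fst _ _ ≫ p ∧
      pullback.lift q (f ≫ specVal B) (by rw [H.w, Category.assoc, specVal_specIncl]) ≫ g = a := by
  have := directed_fgAbove B₀
  have : Nonempty (FGAbove B₀) := ⟨⟨B₀, h₀, le_rfl⟩⟩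
  obtain ⟨D, c, hc, w, s, e, hp, hw, hs, hπw, hπs⟩ := exists_baseChange_isLimit p h₀ H
  have (B : (FGAbove B₀)ᵒᵖ) : CompactSpace (D.obj B) :=
    have : QuasiCompact (s B) := MorphismProperty.of_isPullback (hp B) hqc
    QuasiCompact.compactSpace_of_compactSpace (s B)
  have (B : (FGAbove B₀)ᵒᵖ) : QuasiSeparatedSpace (D.obj B) :=
    have : QuasiSeparated (s B) := MorphismProperty.of_isPullback (hp B) hqs
    quasiSeparatedSpace_of_quasiSeparated (s B)
  have {B C : (FGAbove B₀)ᵒᵖ} (g : B ⟶ C) := isAffineHom_of_isPullback_specIncl hp hw hs g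
  let t : D ⟶ (Functor.const _).obj (Spec (.of B₀)) :=
    { app B := w B ≫ p
      naturality B C g := by
        refine Eq.trans ?_ (Category.comp_id _).symm
        rw [reassoc_of% (hw B C g)] }
  obtain ⟨B, g, h₁, h₂⟩ := Scheme.exists_π_app_comp_eq_of_locallyOfFinitePresentation
    D t n c hc (e.inv ≫ a) (by
      ext B
      change c.π.app B ≫ w B ≫ p = (e.inv ≫ a) ≫ n
      rw [Category.assoc, ha, ← H.w, ← hπw B]
      simp)
  refine ⟨B.unop.1, B.unop.2.1, B.unop.2.2, (hp B).isoPullback.inv ≫ g, ?_, ?_⟩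
  · rw [Category.assoc, h₂]
    exact (hp B).isoPullback_inv_fst_assoc _
  · have : pullback.lift q (f ≫ specVal B.unop.1)
        (by rw [H.w, Category.assoc, specVal_specIncl]) = e.hom ≫ c.π.app B ≫
          (hp B).isoPullback.hom := by
      apply pullback.hom_ext
      · exact (pullback.lift_fst _ _ _).trans (by simp [hπw])
      · exact (pullback.lift_snd _ _ _).trans (by simp [hπs])
    rw [this, Category.assoc, Category.assoc, Iso.hom_inv_id_assoc, h₁, Iso.hom_inv_id_assoc]

/-- The uniqueness counterpart of descending morphisms: local finite type of the target suffices for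
two morphisms that agree in the limit to agree at a finite stage. -/
lemma exists_fst_comp_eq_of_locallyOfFiniteType (h₀ : B₀.FG)
    [hqc : QuasiCompact p] (H : IsPullback q f p (specVal B₀))
    (n : N ⟶ Spec (.of B₀)) [LocallyOfFiniteType n] (a b : W ⟶ N) (ha : a ≫ n = p)
    (hb : b ≫ n = p) (hab : q ≫ a = q ≫ b) :
    ∃ (B : Subalgebra ℤ R) (_ : B.FG) (h : B₀ ≤ B),
      pullback.fst p (specIncl h) ≫ a = pullback.fst p (specIncl h) ≫ b := by
  have := directed_fgAbove B₀
  have : Nonempty (FGAbove B₀) := ⟨⟨B₀, h₀, le_rfl⟩⟩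
  obtain ⟨D, c, hc, w, s, e, hp, hw, hs, hπw, hπs⟩ := exists_baseChange_isLimit p h₀ H
  have (B : (FGAbove B₀)ᵒᵖ) : CompactSpace (D.obj B) :=
    have : QuasiCompact (s B) := MorphismProperty.of_isPullback (hp B) hqc
    QuasiCompact.compactSpace_of_compactSpace (s B)
  have {B C : (FGAbove B₀)ᵒᵖ} (g : B ⟶ C) := isAffineHom_of_isPullback_specIncl hp hw hs g
  let t : D ⟶ (Functor.const _).obj (Spec (.of B₀)) :=
    { app B := w B ≫ p
      naturality B C g := by
        refine Eq.trans ?_ (Category.comp_id _).symm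
        rw [reassoc_of% (hw B C g)] }
  obtain ⟨B, g, h₁⟩ := Scheme.exists_hom_comp_eq_comp_of_locallyOfFiniteType
    D t n c hc (i := .op ⟨B₀, h₀, le_rfl⟩) (w _ ≫ a) (w _ ≫ b)
    (by rw [Category.assoc, ha]) (by rw [Category.assoc, hb]) (by
      rw [← cancel_epi e.hom, reassoc_of% hπw, reassoc_of% hπw, hab])
  refine ⟨B.unop.1, B.unop.2.1, B.unop.2.2, ?_⟩
  rw [reassoc_of% hw, reassoc_of% hw] at h₁
  rw [← cancel_epi (hp B).isoPullback.hom, IsPullback.isoPullback_hom_fst_assoc,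
    IsPullback.isoPullback_hom_fst_assoc, h₁]

lemma exists_preimage_lift_eq (h₀ : B₀.FG)
    (H : IsPullback q f p (specVal B₀))
    (U : X.Opens) (hU : IsCompact (U : Set X)) :
    ∃ (B : Subalgebra ℤ R) (_ : B.FG) (h : B₀ ≤ B) (V : Scheme.Opens (pullback p (specIncl h))),
      IsCompact (SetLike.coe V) ∧
      pullback.lift q (f ≫ specVal B)
        (by rw [H.w, Category.assoc, specVal_specIncl]) ⁻¹ᵁ V = U := by
  have := directed_fgAbove B₀
  have : Nonempty (FGAbove B₀) := ⟨⟨B₀, h₀, le_rfl⟩⟩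
  obtain ⟨D, c, hc, w, s, e, hp, hw, hs, hπw, hπs⟩ := exists_baseChange_isLimit p h₀ H
  have {B C : (FGAbove B₀)ᵒᵖ} (g : B ⟶ C) := isAffineHom_of_isPullback_specIncl hp hw hs g
  obtain ⟨B, V, hV, hVU⟩ := exists_preimage_eq D c hc (e.inv ⁻¹ᵁ U) (e.inv.isCompact_preimage hU)
  have key : pullback.lift q (f ≫ specVal B.unop.1)
      (by rw [H.w, Category.assoc, specVal_specIncl]) = e.hom ≫ c.π.app B ≫
        (hp B).isoPullback.hom := by
    apply pullback.hom_ext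
    · exact (pullback.lift_fst _ _ _).trans (by simp [hπw])
    · exact (pullback.lift_snd _ _ _).trans (by simp [hπs])
  refine ⟨B.unop.1, B.unop.2.1, B.unop.2.2, (hp B).isoPullback.inv ⁻¹ᵁ V,
    (hp B).isoPullback.inv.isCompact_preimage hV, ?_⟩
  rw [key, Scheme.Hom.comp_preimage, Scheme.Hom.comp_preimage, ← Scheme.Hom.comp_preimage _ _ V,
    Iso.hom_inv_id, Scheme.Hom.id_preimage, hVU, ← Scheme.Hom.comp_preimage, Iso.hom_inv_id,
    Scheme.Hom.id_preimage]

end LimitSystem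

/-! ### Models over finitely generated subrings -/

section SpecModel

variable {R : Type u} [CommRing R]

/-- A model over the subring `B` of `R` of a scheme over `R`. -/
structure SpecModel {X : Scheme.{u}} (f : X ⟶ Spec (.of R)) (B : Subalgebra ℤ R) where
  /-- The underlying scheme. -/
  left : Scheme.{u}
  /-- The structure morphism. -/
  hom : left ⟶ Spec (.of B)
  /-- The projection from the scheme over `R`. -/
  π : X ⟶ left
  isPullback : IsPullback π f hom (specVal B)

namespace SpecModel

variable {X : Scheme.{u}} {f : X ⟶ Spec (.of R)} {B B' B'' : Subalgebra ℤ R}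

/-- The base change of a model to a larger subring. -/
noncomputable def baseChange (M : SpecModel f B) (h : B ≤ B') : SpecModel f B' where
  left := pullback M.hom (specIncl h)
  hom := pullback.snd _ _
  π := pullback.lift M.π (f ≫ specVal B')
    (by rw [M.isPullback.w, Category.assoc, specVal_specIncl])
  isPullback := by
    have key : ∀ (a : X ⟶ M.left) (b : Spec (.of R) ⟶ Spec (.of B)), a = M.π → b = specVal B →
        IsPullback a f M.hom b := by
      rintro _ _ rfl rfl
      exact M.isPullback
    exact IsPullback.of_right (h₁₂ := pullback.fst _ _) (v₁₃ := M.hom) (h₂₂ := specIncl h)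
      (key _ _ (pullback.lift_fst _ _ _) (specVal_specIncl h)) (pullback.lift_snd _ _ _)
      (IsPullback.of_hasPullback _ _)

/-- A morphism exhibiting a model as the base change of another one. -/
structure Hom (M' : SpecModel f B') (M : SpecModel f B) where
  /-- The inclusion of subrings. -/
  le : B ≤ B'
  /-- The projection from the base change. -/
  map : M'.left ⟶ M.left
  isPullback : IsPullback map M'.hom M.hom (specIncl le)
  π_map : M'.π ≫ map = M.π

lemma Hom.π_map_assoc {M' : SpecModel f B'} {M : SpecModel f B} (a : Hom M' M) {Z : Scheme.{u}}
    (h : M.left ⟶ Z) : M'.π ≫ a.map ≫ h = M.π ≫ h := by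
  rw [← Category.assoc, a.π_map]

/-- The projection from the base change of a model. -/
noncomputable def baseChangeHom (M : SpecModel f B) (h : B ≤ B') : Hom (M.baseChange h) M where
  le := h
  map := pullback.fst _ _
  isPullback := IsPullback.of_hasPullback _ _
  π_map := pullback.lift_fst _ _ _

/-- The composition of base changes. -/
def Hom.comp {M'' : SpecModel f B''} {M' : SpecModel f B'} {M : SpecModel f B} (a : Hom M'' M')
    (b : Hom M' M) : Hom M'' M where
  le := b.le.trans a.le
  map := a.map ≫ b.map
  isPullback := by
    rw [← specIncl_specIncl b.le a.le]
    exact a.isPullback.paste_horiz b.isPullback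
  π_map := by rw [a.π_map_assoc, b.π_map]

section

variable {M' : SpecModel f B'} {M : SpecModel f B} (a : Hom M' M)
include a

lemma Hom.smooth [h : Smooth M.hom] : Smooth M'.hom := MorphismProperty.of_isPullback a.isPullback h

lemma Hom.quasiCompact [h : QuasiCompact M.hom] : QuasiCompact M'.hom :=
  MorphismProperty.of_isPullback a.isPullback h

lemma Hom.isSeparated [h : IsSeparated M.hom] : IsSeparated M'.hom :=
  MorphismProperty.of_isPullback a.isPullback h

lemma Hom.isProper [h : IsProper M.hom] : IsProper M'.hom :=
  MorphismProperty.of_isPullback a.isPullback h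

end

/-- A lift of a model to a base change, given a morphism to the smaller model. -/
lemma Hom.exists_lift {M' : SpecModel f B'} {M : SpecModel f B} (a : Hom M' M)
    {T : Scheme.{u}} (t : T ⟶ M.left) (s : T ⟶ Spec (.of B')) (h : t ≫ M.hom = s ≫ specIncl a.le) :
    ∃ l : T ⟶ M'.left, l ≫ a.map = t ∧ l ≫ M'.hom = s :=
  ⟨a.isPullback.lift t s h, a.isPullback.lift_fst _ _ _, a.isPullback.lift_snd _ _ _⟩

lemma Hom.hom_ext {M' : SpecModel f B'} {M : SpecModel f B} (a : Hom M' M)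
    {T : Scheme.{u}} {x y : T ⟶ M'.left} (h : x ≫ a.map = y ≫ a.map)
    (h' : x ≫ M'.hom = y ≫ M'.hom) : x = y :=
  a.isPullback.hom_ext h h'

lemma isNoetherianRing_of_fg (hB : B.FG) : IsNoetherianRing B :=
  have : Algebra.FiniteType ℤ B := B.fg_iff_finiteType.mp hB
  Algebra.FiniteType.isNoetherianRing ℤ B

lemma isLocallyNoetherian (M : SpecModel f B) (hB : B.FG) [LocallyOfFiniteType M.hom] :
    IsLocallyNoetherian M.left :=
  have := isNoetherianRing_of_fg hB
  have : IsNoetherianRing (CommRingCat.of B) := this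
  LocallyOfFiniteType.isLocallyNoetherian M.hom

lemma quasiSeparated (M : SpecModel f B) (hB : B.FG) [LocallyOfFiniteType M.hom] :
    QuasiSeparated M.hom :=
  have := M.isLocallyNoetherian hB
  (quasiSeparated_iff_quasiSeparatedSpace M.hom).mpr inferInstance

lemma exists_hom_desc (M : SpecModel f B) (hB : B.FG) [QuasiCompact M.hom] [QuasiSeparated M.hom]
    {N : Scheme.{u}} (n : N ⟶ Spec (.of B)) [LocallyOfFinitePresentation n] (a : X ⟶ N)
    (ha : a ≫ n = f ≫ specVal B) :
    ∃ (B' : Subalgebra ℤ R) (_ : B'.FG) (M' : SpecModel f B') (j : Hom M' M) (g : M'.left ⟶ N),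
      g ≫ n = M'.hom ≫ specIncl j.le ∧ M'.π ≫ g = a := by
  obtain ⟨B', hB', h, g, h₁, h₂⟩ :=
    exists_desc_of_locallyOfFinitePresentation hB M.isPullback n a ha
  refine ⟨B', hB', M.baseChange h, M.baseChangeHom h, g,
    h₁.trans pullback.condition, h₂⟩

lemma exists_hom_comp_eq (M : SpecModel f B) (hB : B.FG) [QuasiCompact M.hom]
    {N : Scheme.{u}} (n : N ⟶ Spec (.of B)) [LocallyOfFiniteType n] (a b : M.left ⟶ N)
    (ha : a ≫ n = M.hom) (hb : b ≫ n = M.hom) (hab : M.π ≫ a = M.π ≫ b) :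
    ∃ (B' : Subalgebra ℤ R) (_ : B'.FG) (M' : SpecModel f B') (j : Hom M' M),
      j.map ≫ a = j.map ≫ b := by
  obtain ⟨B', hB', h, e⟩ := exists_fst_comp_eq_of_locallyOfFiniteType hB M.isPullback n a b ha hb hab
  exact ⟨B', hB', M.baseChange h, M.baseChangeHom h, e⟩

lemma exists_hom_preimage_eq (M : SpecModel f B) (hB : B.FG) (U : X.Opens)
    (hU : IsCompact (U : Set X)) :
    ∃ (B' : Subalgebra ℤ R) (_ : B'.FG) (M' : SpecModel f B') (_ : Hom M' M) (V : M'.left.Opens),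
      IsCompact (V : Set M'.left) ∧ M'.π ⁻¹ᵁ V = U := by
  obtain ⟨B', hB', h, V, hV, e⟩ := exists_preimage_lift_eq hB M.isPullback U hU
  exact ⟨B', hB', M.baseChange h, M.baseChangeHom h, V, hV, e⟩

/-- Two smooth quasi-compact models have a common base change. -/
lemma exists_common_baseChange (M N : SpecModel f B) (hB : B.FG) [Smooth M.hom]
    [QuasiCompact M.hom] [Smooth N.hom] [QuasiCompact N.hom] :
    ∃ (B' : Subalgebra ℤ R) (_ : B'.FG) (M' : SpecModel f B') (_ : Hom M' M) (_ : Hom M' N),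
      True := by
  have := M.quasiSeparated hB
  have := N.quasiSeparated hB
  -- The identity of `X` descends to a morphism `M → N` and, further on, to a morphism `N → M`. The
  -- two composites become identities over `R`, hence over a larger subring; each direction costs
  -- one more enlargement.
  obtain ⟨B₁, hB₁, M₁, j₁, g, hg, hπg⟩ := M.exists_hom_desc hB N.hom N.π N.isPullback.w
  let N₁ := N.baseChange j₁.le
  let k₁ : Hom N₁ N := N.baseChangeHom j₁.le
  obtain ⟨g₁, hg₁, hg₁'⟩ := k₁.exists_lift g M₁.hom hg
  have hπ₁ : M₁.π ≫ g₁ = N₁.π := by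
    apply k₁.hom_ext
    · rw [Category.assoc, hg₁, hπg, k₁.π_map]
    · rw [Category.assoc, hg₁', M₁.isPullback.w, N₁.isPullback.w]
  have := j₁.smooth
  have := j₁.quasiCompact
  have := k₁.smooth
  have := k₁.quasiCompact
  have := N₁.quasiSeparated hB₁
  have := M₁.quasiSeparated hB₁
  obtain ⟨B₂, hB₂, N₂, k₂, h, hh, hπh⟩ := N₁.exists_hom_desc hB₁ M₁.hom M₁.π M₁.isPullback.w
  let M₂ := M₁.baseChange k₂.le
  let j₂ : Hom M₂ M₁ := M₁.baseChangeHom k₂.le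
  obtain ⟨h₂, hh₂, hh₂'⟩ := j₂.exists_lift h N₂.hom hh
  obtain ⟨g₂, hg₂, hg₂'⟩ := k₂.exists_lift (j₂.map ≫ g₁) M₂.hom (by
    rw [Category.assoc, hg₁', j₂.isPullback.w])
  have hπg₂ : M₂.π ≫ g₂ = N₂.π := by
    apply k₂.hom_ext
    · rw [Category.assoc, hg₂, j₂.π_map_assoc, hπ₁, k₂.π_map]
    · rw [Category.assoc, hg₂', M₂.isPullback.w, N₂.isPullback.w]
  have hπh₂ : N₂.π ≫ h₂ = M₂.π := by
    apply j₂.hom_ext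
    · rw [Category.assoc, hh₂, hπh, j₂.π_map]
    · rw [Category.assoc, hh₂', M₂.isPullback.w, N₂.isPullback.w]
  have := j₂.smooth
  have := j₂.quasiCompact
  have := k₂.smooth
  have := k₂.quasiCompact
  obtain ⟨B₃, hB₃, M₃, j₃, h₃⟩ := M₂.exists_hom_comp_eq hB₂ M₂.hom (g₂ ≫ h₂) (𝟙 _)
    (by rw [Category.assoc, hh₂', hg₂']) (Category.id_comp _)
    (by rw [reassoc_of% hπg₂, hπh₂, Category.comp_id])
  let N₃ := N₂.baseChange j₃.le
  let k₃ : Hom N₃ N₂ := N₂.baseChangeHom j₃.le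
  have := k₃.quasiCompact
  obtain ⟨g₃, hg₃, hg₃'⟩ := k₃.exists_lift (j₃.map ≫ g₂) M₃.hom (by
    rw [Category.assoc, hg₂', j₃.isPullback.w])
  obtain ⟨h₃', hh₃, hh₃'⟩ := j₃.exists_lift (k₃.map ≫ h₂) N₃.hom (by
    rw [Category.assoc, hh₂', k₃.isPullback.w])
  have hgh : g₃ ≫ h₃' = 𝟙 _ := by
    apply j₃.hom_ext
    · rw [Category.assoc, hh₃, reassoc_of% hg₃, h₃, Category.id_comp, Category.comp_id]
    · rw [Category.assoc, hh₃', hg₃', Category.id_comp]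
  have hπg₃ : M₃.π ≫ g₃ = N₃.π := by
    apply k₃.hom_ext
    · rw [Category.assoc, hg₃, j₃.π_map_assoc, hπg₂, k₃.π_map]
    · rw [Category.assoc, hg₃', M₃.isPullback.w, N₃.isPullback.w]
  have hπh₃ : N₃.π ≫ h₃' = M₃.π := by
    rw [← hπg₃, Category.assoc, hgh, Category.comp_id]
  have := k₃.smooth
  obtain ⟨B₄, hB₄, N₄, k₄, h₄⟩ := N₃.exists_hom_comp_eq hB₃ N₃.hom (h₃' ≫ g₃) (𝟙 _)
    (by rw [Category.assoc, hg₃', hh₃']) (Category.id_comp _)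
    (by rw [reassoc_of% hπh₃, hπg₃, Category.comp_id])
  let M₄ := M₃.baseChange k₄.le
  let j₄ : Hom M₄ M₃ := M₃.baseChangeHom k₄.le
  obtain ⟨g₄, hg₄, hg₄'⟩ := k₄.exists_lift (j₄.map ≫ g₃) M₄.hom (by
    rw [Category.assoc, hg₃', j₄.isPullback.w])
  obtain ⟨h₄', hh₄, hh₄'⟩ := j₄.exists_lift (k₄.map ≫ h₃') N₄.hom (by
    rw [Category.assoc, hh₃', k₄.isPullback.w])
  let e : M₄.left ≅ N₄.left :=
    { hom := g₄
      inv := h₄'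
      hom_inv_id := by
        apply j₄.hom_ext
        · rw [Category.assoc, hh₄, reassoc_of% hg₄, hgh, Category.id_comp, Category.comp_id]
        · rw [Category.assoc, hh₄', hg₄', Category.id_comp]
      inv_hom_id := by
        apply k₄.hom_ext
        · rw [Category.assoc, hg₄, reassoc_of% hh₄, h₄, Category.id_comp, Category.comp_id]
        · rw [Category.assoc, hg₄', hh₄', Category.id_comp] }
  have hπg₄ : M₄.π ≫ g₄ = N₄.π := by
    apply k₄.hom_ext
    · rw [Category.assoc, hg₄, j₄.π_map_assoc, hπg₃, k₄.π_map]
    · rw [Category.assoc, hg₄', M₄.isPullback.w, N₄.isPullback.w]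
  let l : Hom M₄ N₄ :=
    { le := le_rfl
      map := g₄
      isPullback := by
        rw [specIncl_refl]
        have : IsIso g₄ := e.isIso_hom
        exact IsPullback.of_horiz_isIso ⟨by rw [hg₄', Category.comp_id]⟩
      π_map := hπg₄ }
  exact ⟨B₄, hB₄, M₄, j₄.comp (j₃.comp (j₂.comp j₁)),
    l.comp (k₄.comp (k₃.comp (k₂.comp k₁))), trivial⟩

/-- A smooth affine scheme has a smooth affine model. -/
lemma exists_of_isAffine [IsAffine X] (f : X ⟶ Spec (.of R)) [Smooth f] :
    ∃ (B : Subalgebra ℤ R) (_ : B.FG) (M : SpecModel f B), Smooth M.hom ∧ QuasiCompact M.hom := by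
  obtain ⟨φ, hφ⟩ := Spec.map_surjective (X.isoSpec.inv ≫ f)
  have hs : Smooth (Spec.map φ) := by rw [hφ]; infer_instance
  have hs' : φ.hom.Smooth := HasRingHomProperty.Spec_iff.mp hs
  algebraize [φ.hom]
  have : Algebra.Smooth R Γ(X, ⊤) := hs'
  -- A smooth algebra is already defined, as a smooth algebra, over a subring generated by finitely
  -- many coefficients.
  obtain ⟨B, C, _, _, hB, hC, ⟨e⟩⟩ := Algebra.Smooth.exists_subalgebra_fg (R := ℤ) (A := R)
    (B := Γ(X, ⊤))
  have hp := CommRingCat.isPushout_tensorProduct B R C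
  let ψ : CommRingCat.of C ⟶ Γ(X, ⊤) := CommRingCat.ofHom
    (e.symm.toRingHom.comp
      (Algebra.TensorProduct.includeRight (R := B) (A := R) (B := C)).toRingHom)
  have hq : IsPushout (CommRingCat.ofHom (algebraMap B C)) (CommRingCat.ofHom B.val.toRingHom)
      ψ φ := by
    refine hp.flip.of_iso (Iso.refl _) (Iso.refl _) (Iso.refl _)
      (RingEquiv.toCommRingCatIso e.symm.toRingEquiv) (by simp) (by simp; rfl) (by rfl) ?_
    ext x
    exact e.symm.commutes x
  have h1 := (isPullback_SpecMap_of_isPushout _ _ _ _ hq).flip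
  have h2 : IsPullback X.isoSpec.hom f (Spec.map φ) (𝟙 _) :=
    IsPullback.of_horiz_isIso ⟨by rw [hφ, Iso.hom_inv_id_assoc, Category.comp_id]⟩
  have h3 := h2.paste_horiz h1.flip
  rw [Category.id_comp] at h3
  have hs : Smooth (Spec.map (CommRingCat.ofHom (algebraMap B C))) :=
    HasRingHomProperty.Spec_iff.mpr (RingHom.smooth_algebraMap.mpr hC)
  exact ⟨B, hB, ⟨Spec (.of C), _, _, h3⟩, hs, inferInstance⟩

end SpecModel

end SpecModel

/-! ### Gluing along two open immersions -/

section GluingTwo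

lemma mem_range_homOfLE {X : Scheme.{u}} {S T : X.Opens} (h : S ≤ T) (x : T)
    (hx : T.ι x ∈ S) : x ∈ Set.range (X.homOfLE h) := by
  obtain ⟨y, hy⟩ : T.ι x ∈ Set.range S.ι := by rwa [Scheme.Opens.range_ι]
  refine ⟨y, T.ι.isOpenEmbedding.injective ?_⟩
  rw [← hy, ← Scheme.Hom.comp_apply, Scheme.homOfLE_ι]

variable {X X₁ X₂ W : Scheme.{u}} {i₁ : X₁ ⟶ X} {i₂ : X₂ ⟶ X}

/-- The open cover of a scheme given by two jointly surjective open immersions. -/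
noncomputable def openCoverOfTwo (i₁ : X₁ ⟶ X) (i₂ : X₂ ⟶ X) [IsOpenImmersion i₁]
    [IsOpenImmersion i₂] (h : ∀ x : X, x ∈ Set.range i₁ ∨ x ∈ Set.range i₂) : X.OpenCover where
  I₀ := ULift.{u} Bool
  X b := cond b.down X₁ X₂
  f b := match b with
    | ⟨true⟩ => i₁
    | ⟨false⟩ => i₂
  mem₀ := by
    rw [Scheme.presieve₀_mem_precoverage_iff]
    refine ⟨fun x ↦ ?_, ?_⟩
    · obtain h | h := h x
      exacts [⟨⟨true⟩, h⟩, ⟨⟨false⟩, h⟩]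
    · rintro ⟨_ | _⟩
      exacts [‹IsOpenImmersion i₂›, ‹IsOpenImmersion i₁›]

variable [IsOpenImmersion i₁] [IsOpenImmersion i₂]
  (hcov : ∀ x : X, x ∈ Set.range i₁ ∨ x ∈ Set.range i₂)
include hcov

lemma exists_desc_of_two {j₁ : W ⟶ X₁} {j₂ : W ⟶ X₂} (h : IsPullback j₁ j₂ i₁ i₂)
    {Z : Scheme.{u}} (a₁ : X₁ ⟶ Z) (a₂ : X₂ ⟶ Z) (ha : j₁ ≫ a₁ = j₂ ≫ a₂) :
    ∃ a : X ⟶ Z, i₁ ≫ a = a₁ ∧ i₂ ≫ a = a₂ := by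
  let φ : ∀ b, (openCoverOfTwo i₁ i₂ hcov).X b ⟶ Z := fun b ↦ match b with
    | ⟨true⟩ => a₁
    | ⟨false⟩ => a₂
  have H : ∀ x y, pullback.fst ((openCoverOfTwo i₁ i₂ hcov).f x)
      ((openCoverOfTwo i₁ i₂ hcov).f y) ≫ φ x = pullback.snd _ _ ≫ φ y := by
    have e₁ : pullback.fst i₁ i₁ = pullback.snd i₁ i₁ := by
      rw [← cancel_mono i₁]; exact pullback.condition
    have e₂ : pullback.fst i₂ i₂ = pullback.snd i₂ i₂ := by
      rw [← cancel_mono i₂]; exact pullback.condition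
    rintro ⟨_ | _⟩ ⟨_ | _⟩
    · exact congrArg (· ≫ a₂) e₂
    · change pullback.fst i₂ i₁ ≫ a₂ = pullback.snd i₂ i₁ ≫ a₁
      rw [← h.flip.isoPullback_inv_fst, ← h.flip.isoPullback_inv_snd, Category.assoc,
        Category.assoc, ha]
    · change pullback.fst i₁ i₂ ≫ a₁ = pullback.snd i₁ i₂ ≫ a₂
      rw [← h.isoPullback_inv_fst, ← h.isoPullback_inv_snd, Category.assoc,
        Category.assoc, ha]
    · exact congrArg (· ≫ a₁) e₁
  exact ⟨_, (openCoverOfTwo i₁ i₂ hcov).ι_glueMorphisms φ H ⟨true⟩,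
    (openCoverOfTwo i₁ i₂ hcov).ι_glueMorphisms φ H ⟨false⟩⟩

lemma isPullback_of_two {T T₁ T₂ Y Z : Scheme.{u}} {p : T ⟶ X} {q : T ⟶ Y} {r : X ⟶ Z} {s : Y ⟶ Z}
    {t₁ : T₁ ⟶ T} {t₂ : T₂ ⟶ T} {g₁ : T₁ ⟶ X₁} {g₂ : T₂ ⟶ X₂}
    (h₁ : IsPullback t₁ g₁ p i₁) (h₂ : IsPullback t₂ g₂ p i₂)
    (h₁' : IsPullback g₁ (t₁ ≫ q) (i₁ ≫ r) s) (h₂' : IsPullback g₂ (t₂ ≫ q) (i₂ ≫ r) s) :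
    IsPullback p q r s := by
  refine Scheme.isPullback_of_openCover p q r s (openCoverOfTwo i₁ i₂ hcov) ?_
  rintro ⟨_ | _⟩
  · change IsPullback (pullback.snd p i₂) (pullback.fst p i₂ ≫ q) (i₂ ≫ r) s
    refine h₂'.of_iso h₂.isoPullback (Iso.refl _) (Iso.refl _) (Iso.refl _) ?_ ?_ ?_ ?_ <;> simp
  · change IsPullback (pullback.snd p i₁) (pullback.fst p i₁ ≫ q) (i₁ ≫ r) s
    refine h₁'.of_iso h₁.isoPullback (Iso.refl _) (Iso.refl _) (Iso.refl _) ?_ ?_ ?_ ?_ <;> simp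

lemma property_of_two (P : MorphismProperty Scheme.{u}) [IsZariskiLocalAtSource P]
    {Z : Scheme.{u}} {a : X ⟶ Z} (h₁ : P (i₁ ≫ a)) (h₂ : P (i₂ ≫ a)) : P a := by
  refine IsZariskiLocalAtSource.of_openCover (openCoverOfTwo i₁ i₂ hcov) ?_
  rintro ⟨_ | _⟩
  exacts [h₂, h₁]

omit [IsOpenImmersion i₁] [IsOpenImmersion i₂] in
lemma compactSpace_of_two [CompactSpace X₁] [CompactSpace X₂] : CompactSpace X := by
  refine ⟨?_⟩
  have : (Set.univ : Set X) = Set.range i₁ ∪ Set.range i₂ := by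
    ext x; simpa using hcov x
  rw [this]
  exact (isCompact_range i₁.continuous).union (isCompact_range i₂.continuous)

-- Gluing two schemes along a common open subscheme. The pushout square is also cartesian, because
-- the two charts meet only in the image of `W`.
omit hcov [IsOpenImmersion i₁] [IsOpenImmersion i₂] in
lemma exists_pushout_of_isOpenImmersion (k₁ : W ⟶ X₁) (k₂ : W ⟶ X₂) [IsOpenImmersion k₁]
    [IsOpenImmersion k₂] :
    ∃ (P : Scheme.{u}) (l₁ : X₁ ⟶ P) (l₂ : X₂ ⟶ P), IsOpenImmersion l₁ ∧ IsOpenImmersion l₂ ∧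
      IsPullback k₁ k₂ l₁ l₂ ∧ (∀ x, x ∈ Set.range l₁ ∨ x ∈ Set.range l₂) := by
  have h1 : IsOpenImmersion (pushout.inl k₁ k₂) :=
    inferInstanceAs (IsOpenImmersion (colimit.ι (span k₁ k₂) _))
  have h2 : IsOpenImmersion (pushout.inr k₁ k₂) :=
    inferInstanceAs (IsOpenImmersion (colimit.ι (span k₁ k₂) _))
  refine ⟨pushout k₁ k₂, pushout.inl _ _, pushout.inr _ _, h1, h2, ?_, ?_⟩
  · refine (IsOpenImmersion.isPullback k₁ k₂ (pushout.inl _ _) (pushout.inr _ _)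
      pushout.condition.symm ?_).flip.flip
    ext x
    constructor
    · rintro ⟨y, hy⟩
      obtain ⟨a, fi, fj, z, hz, hz'⟩ := (Scheme.IsLocallyDirected.ι_eq_ι_iff (span k₁ k₂)
        (i := .left) (j := .right) (xi := y) (xj := x)).mp hy
      -- The only index mapping to both feet of the span is its apex, so points identified in the
      -- pushout come from `W`.
      have aux : ∀ (a : WalkingSpan) (fi : a ⟶ .left) (fj : a ⟶ .right) (z : (span k₁ k₂).obj a),
          (span k₁ k₂).map fj z = x → x ∈ Set.range k₂ := by
        rintro a (_ | _) fj z hz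
        · exact (nomatch fj)
        · obtain rfl : fj = WalkingSpan.Hom.snd := Subsingleton.elim _ _
          exact ⟨z, hz⟩
      exact aux a fi fj z hz'
    · rintro ⟨y, rfl⟩
      exact ⟨k₁ y, by
        rw [← Scheme.Hom.comp_apply, ← Scheme.Hom.comp_apply, pushout.condition]⟩
  · intro x
    obtain ⟨i, y, rfl⟩ := Scheme.IsLocallyDirected.ι_jointly_surjective (span k₁ k₂) x
    obtain _ | _ | _ := i
    · have key : k₁ ≫ pushout.inl k₁ k₂ = colimit.ι (span k₁ k₂) none :=
        colimit.w (span k₁ k₂) WalkingSpan.Hom.fst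
      have (q : W ⟶ pushout k₁ k₂) (h : k₁ ≫ pushout.inl k₁ k₂ = q) (y : W) :
          pushout.inl k₁ k₂ (k₁ y) = q y := by
        rw [← h, Scheme.Hom.comp_apply]
      exact .inl ⟨k₁ y, this _ key y⟩
    · exact .inl ⟨y, rfl⟩
    · exact .inr ⟨y, rfl⟩

end GluingTwo

/-! ### Existence of smooth models by gluing -/

namespace SpecModel

variable {R : Type u} [CommRing R]

section

variable {X W : Scheme.{u}} {f : X ⟶ Spec (.of R)} {w : W ⟶ Spec (.of R)}
  {B B' : Subalgebra ℤ R}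

/-- An open immersion of models, lifting an open immersion of schemes. -/
structure OpenHom (N : SpecModel w B) (M : SpecModel f B) (j : W ⟶ X) where
  /-- The morphism of models. -/
  map : N.left ⟶ M.left
  isOpenImmersion : IsOpenImmersion map
  map_hom : map ≫ M.hom = N.hom
  π_map : N.π ≫ map = j ≫ M.π

/-- The base change of an open immersion of models. -/
lemma OpenHom.nonempty_of_hom {N : SpecModel w B} {M : SpecModel f B} {j : W ⟶ X}
    (k : OpenHom N M j) (hj : j ≫ f = w) {N' : SpecModel w B'} {M' : SpecModel f B'} (b : Hom N' N)
    (a : Hom M' M) : Nonempty (OpenHom N' M' j) := by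
  obtain ⟨l, hl, hl'⟩ := a.exists_lift (b.map ≫ k.map) N'.hom (by
    rw [Category.assoc, k.map_hom, b.isPullback.w])
  have hl'' : IsPullback l b.map a.map k.map := by
    have h : IsPullback (l ≫ M'.hom) b.map (specIncl a.le) (k.map ≫ M.hom) := by
      rw [hl', k.map_hom]
      exact b.isPullback.flip
    exact IsPullback.of_right h hl a.isPullback.flip
  have h : IsOpenImmersion l := by
    have := k.isOpenImmersion
    exact MorphismProperty.of_isPullback hl''.flip inferInstance
  refine ⟨⟨l, h, hl', a.hom_ext ?_ ?_⟩⟩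
  · rw [Category.assoc, hl, b.π_map_assoc, Category.assoc, a.π_map, k.π_map]
  · rw [Category.assoc, hl', N'.isPullback.w, Category.assoc, M'.isPullback.w, ← hj,
      Category.assoc]

/-- A quasi-compact open of the limit is the preimage of a quasi-compact open at a finite stage, and
that open is the model of `W`. -/
lemma exists_openHom (M : SpecModel f B) (hB : B.FG) (j : W ⟶ X) [IsOpenImmersion j]
    [CompactSpace W] (hj : j ≫ f = w) :
    ∃ (B' : Subalgebra ℤ R) (_ : B'.FG) (M' : SpecModel f B') (_ : Hom M' M)
      (N : SpecModel w B') (_ : OpenHom N M' j), QuasiCompact N.hom := by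
  obtain ⟨B', hB', M', a, V, hV, e⟩ := M.exists_hom_preimage_eq hB j.opensRange
    (isCompact_range j.continuous)
  have hr : Set.range (j ≫ M'.π) ⊆ Set.range V.ι := by
    rintro _ ⟨x, rfl⟩
    have : j x ∈ M'.π ⁻¹ᵁ V := e ▸ ⟨x, rfl⟩
    rw [Scheme.Opens.range_ι]
    simpa using this
  have h : IsPullback (IsOpenImmersion.lift V.ι (j ≫ M'.π) hr) j V.ι M'.π :=
    IsOpenImmersion.isPullback _ _ _ _ (IsOpenImmersion.lift_fac _ _ _).symm (by simpa using e)
  have h' := h.paste_vert M'.isPullback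
  rw [hj] at h'
  have hc : CompactSpace V := isCompact_iff_compactSpace.mp hV
  exact ⟨B', hB', M', a, ⟨V, V.ι ≫ M'.hom, _, h'⟩, ⟨V.ι, inferInstance, rfl, h.w⟩,
    (quasiCompact_iff_compactSpace (V.ι ≫ M'.hom)).mpr hc⟩

end

variable {X X₁ X₂ W : Scheme.{u}} {i₁ : X₁ ⟶ X} {i₂ : X₂ ⟶ X} [IsOpenImmersion i₁]
  [IsOpenImmersion i₂]

/-- The pushout of `M₁` and `M₂` along `N` is a model of `X`. The square over `specVal B` is
cartesian because it is so over each chart, once the preimage of a chart of the pushout is known to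
be the corresponding chart of `X`. -/
lemma exists_of_openHom (hcov : ∀ x : X, x ∈ Set.range i₁ ∨ x ∈ Set.range i₂)
    {j₁ : W ⟶ X₁} {j₂ : W ⟶ X₂} (h : IsPullback j₁ j₂ i₁ i₂) {f : X ⟶ Spec (.of R)}
    {f₁ : X₁ ⟶ Spec (.of R)} {f₂ : X₂ ⟶ Spec (.of R)} {w : W ⟶ Spec (.of R)}
    (h₁ : i₁ ≫ f = f₁) (h₂ : i₂ ≫ f = f₂) (hw : j₁ ≫ f₁ = w)
    {B : Subalgebra ℤ R} {M₁ : SpecModel f₁ B} {M₂ : SpecModel f₂ B} {N : SpecModel w B}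
    (k₁ : OpenHom N M₁ j₁) (k₂ : OpenHom N M₂ j₂) [Smooth M₁.hom] [Smooth M₂.hom]
    [QuasiCompact M₁.hom] [QuasiCompact M₂.hom] :
    ∃ M : SpecModel f B, Smooth M.hom ∧ QuasiCompact M.hom := by
  have := k₁.isOpenImmersion
  have := k₂.isOpenImmersion
  obtain ⟨P, l₁, l₂, hl₁, hl₂, hl, hP⟩ := exists_pushout_of_isOpenImmersion k₁.map k₂.map
  obtain ⟨π, hπ₁, hπ₂⟩ := exists_desc_of_two hcov h (M₁.π ≫ l₁) (M₂.π ≫ l₂) (by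
    rw [← reassoc_of% k₁.π_map, ← reassoc_of% k₂.π_map, hl.w])
  obtain ⟨p, hp₁, hp₂⟩ := exists_desc_of_two hP hl M₁.hom M₂.hom (by
    rw [k₁.map_hom, k₂.map_hom])
  have hw₂ : j₂ ≫ f₂ = w := by rw [← h₂, ← h.w_assoc, h₁, hw]
  have hN₁ : IsPullback N.π j₁ k₁.map M₁.π := by
    have : IsPullback N.π (j₁ ≫ f₁) (k₁.map ≫ M₁.hom) (specVal B) := by
      rw [k₁.map_hom, hw]
      exact N.isPullback
    exact IsPullback.of_bot this k₁.π_map M₁.isPullback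
  have hN₂ : IsPullback N.π j₂ k₂.map M₂.π := by
    have : IsPullback N.π (j₂ ≫ f₂) (k₂.map ≫ M₂.hom) (specVal B) := by
      rw [k₂.map_hom, hw₂]
      exact N.isPullback
    exact IsPullback.of_bot this k₂.π_map M₂.isPullback
  have hπ : IsPullback π f p (specVal B) := by
    refine isPullback_of_two hP (IsOpenImmersion.isPullback _ _ _ _ hπ₁ ?_).flip
      (IsOpenImmersion.isPullback _ _ _ _ hπ₂ ?_).flip ?_ ?_
    · ext x
      constructor
      · rintro ⟨y, hy⟩
        obtain ⟨x, rfl⟩ | ⟨x, rfl⟩ := hcov x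
        · exact ⟨x, rfl⟩
        · rw [← Scheme.Hom.comp_apply, hπ₂, Scheme.Hom.comp_apply] at hy
          -- A point of `X₂` whose image lies in the chart `M₁` maps into the overlap `N`, so it
          -- comes from `W` and lies in `X₁` too.
          obtain ⟨z, -, hz⟩ := Scheme.exists_preimage_of_isPullback hl y (M₂.π x) hy
          obtain ⟨v, -, rfl⟩ := Scheme.exists_preimage_of_isPullback hN₂ z x hz
          exact ⟨j₁ v, by rw [← Scheme.Hom.comp_apply, h.w, Scheme.Hom.comp_apply]⟩
      · rintro ⟨y, rfl⟩
        exact ⟨M₁.π y, by rw [← Scheme.Hom.comp_apply, ← Scheme.Hom.comp_apply, hπ₁]⟩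
    · ext x
      constructor
      · rintro ⟨y, hy⟩
        obtain ⟨x, rfl⟩ | ⟨x, rfl⟩ := hcov x
        · rw [← Scheme.Hom.comp_apply, hπ₁, Scheme.Hom.comp_apply] at hy
          obtain ⟨z, hz, -⟩ := Scheme.exists_preimage_of_isPullback hl (M₁.π x) y hy.symm
          obtain ⟨v, -, rfl⟩ := Scheme.exists_preimage_of_isPullback hN₁ z x hz
          exact ⟨j₂ v, by rw [← Scheme.Hom.comp_apply, ← h.w, Scheme.Hom.comp_apply]⟩
        · exact ⟨x, rfl⟩
      · rintro ⟨y, rfl⟩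
        exact ⟨M₂.π y, by rw [← Scheme.Hom.comp_apply, ← Scheme.Hom.comp_apply, hπ₂]⟩
    · rw [h₁, hp₁]
      exact M₁.isPullback
    · rw [h₂, hp₂]
      exact M₂.isPullback
  refine ⟨⟨P, p, π, hπ⟩, ?_, ?_⟩
  · have : IsZariskiLocalAtSource @Smooth.{u} :=
      HasRingHomProperty.instIsZariskiLocalAtSource (Q := RingHom.Smooth)
    exact property_of_two hP @Smooth (by rwa [hp₁]) (by rwa [hp₂])
  · have : CompactSpace M₁.left := (quasiCompact_iff_compactSpace M₁.hom).mp inferInstance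
    have : CompactSpace M₂.left := (quasiCompact_iff_compactSpace M₂.hom).mp inferInstance
    exact (quasiCompact_iff_compactSpace p).mpr (compactSpace_of_two hP)

/-- Each `Mᵢ` induces, over a larger subring, a model of the overlap `W`. These two models become
isomorphic after another enlargement, and then the `Mᵢ` can be glued along them. -/
lemma exists_of_two (hcov : ∀ x : X, x ∈ Set.range i₁ ∨ x ∈ Set.range i₂)
    {j₁ : W ⟶ X₁} {j₂ : W ⟶ X₂} (h : IsPullback j₁ j₂ i₁ i₂) [CompactSpace W]
    (f : X ⟶ Spec (.of R)) {f₁ : X₁ ⟶ Spec (.of R)} {f₂ : X₂ ⟶ Spec (.of R)} (h₁ : i₁ ≫ f = f₁)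
    (h₂ : i₂ ≫ f = f₂) {B₁ B₂ : Subalgebra ℤ R} (hB₁ : B₁.FG) (hB₂ : B₂.FG)
    (M₁ : SpecModel f₁ B₁) (M₂ : SpecModel f₂ B₂) [Smooth M₁.hom] [Smooth M₂.hom]
    [QuasiCompact M₁.hom] [QuasiCompact M₂.hom] :
    ∃ (B : Subalgebra ℤ R) (_ : B.FG) (M : SpecModel f B), Smooth M.hom ∧ QuasiCompact M.hom := by
  subst h₁ h₂
  have o₁ : IsOpenImmersion j₁ := MorphismProperty.of_isPullback h.flip inferInstance
  have o₂ : IsOpenImmersion j₂ := MorphismProperty.of_isPullback h inferInstance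
  have hw₂ : j₂ ≫ i₂ ≫ f = j₁ ≫ i₁ ≫ f := by rw [← h.w_assoc]
  obtain ⟨C₁, hC₁, M₁', a₁, N₁, k₁, _⟩ := M₁.exists_openHom hB₁ j₁ rfl
  obtain ⟨C₂, hC₂, M₂', a₂, N₂, k₂, _⟩ := M₂.exists_openHom hB₂ j₂ hw₂
  let C := C₁ ⊔ C₂
  let N₁' := N₁.baseChange (le_sup_left : C₁ ≤ C)
  let b₁ : Hom N₁' N₁ := N₁.baseChangeHom _
  let N₂' := N₂.baseChange (le_sup_right : C₂ ≤ C)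
  let b₂ : Hom N₂' N₂ := N₂.baseChangeHom _
  have s₁ : Smooth N₁.hom := by
    have := k₁.isOpenImmersion; have := a₁.smooth; rw [← k₁.map_hom]; infer_instance
  have s₂ : Smooth N₂.hom := by
    have := k₂.isOpenImmersion; have := a₂.smooth; rw [← k₂.map_hom]; infer_instance
  have := b₁.smooth
  have := b₂.smooth
  have := b₁.quasiCompact
  have := b₂.quasiCompact
  obtain ⟨D, hD, N, c₁, c₂, -⟩ := N₁'.exists_common_baseChange N₂' (hC₁.sup hC₂)
  let L₁ := M₁'.baseChange (b₁.le.trans c₁.le)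
  let d₁ : Hom L₁ M₁' := M₁'.baseChangeHom _
  let L₂ := M₂'.baseChange (b₂.le.trans c₂.le)
  let d₂ : Hom L₂ M₂' := M₂'.baseChangeHom _
  obtain ⟨m₁⟩ := k₁.nonempty_of_hom rfl (c₁.comp b₁) d₁
  obtain ⟨m₂⟩ := k₂.nonempty_of_hom hw₂ (c₂.comp b₂) d₂
  have := (d₁.comp a₁).smooth
  have := (d₂.comp a₂).smooth
  have := (d₁.comp a₁).quasiCompact
  have := (d₂.comp a₂).quasiCompact
  exact ⟨D, hD, exists_of_openHom hcov h rfl rfl rfl m₁ m₂⟩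

/-- A smooth quasi-compact quasi-separated scheme over a ring has a smooth quasi-compact model over
a finitely generated subring. -/
lemma exists_smooth {X : Scheme.{u}} (f : X ⟶ Spec (.of R)) [Smooth f] [CompactSpace X]
    [QuasiSeparatedSpace X] :
    ∃ (B : Subalgebra ℤ R) (_ : B.FG) (M : SpecModel f B), Smooth M.hom ∧ QuasiCompact M.hom := by
  suffices H : ∀ S : X.Opens, IsCompact (S : Set X) → ∃ (B : Subalgebra ℤ R) (_ : B.FG)
      (M : SpecModel (S.ι ≫ f) B), Smooth M.hom ∧ QuasiCompact M.hom by
    obtain ⟨B, hB, M, hM⟩ := H ⊤ isCompact_univ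
    refine ⟨B, hB, ⟨M.left, M.hom, X.topIso.inv ≫ M.π, ?_⟩, hM⟩
    exact M.isPullback.of_iso X.topIso (Iso.refl _) (Iso.refl _) (Iso.refl _)
      (by simp) (by simp) (by simp) (by simp)
  intro S hS
  refine compact_open_induction_on S hS ?_ ?_
  · have : IsAffine ((⊥ : X.Opens) : Scheme.{u}) := isAffineOpen_bot X
    exact exists_of_isAffine _
  · rintro S hS ⟨U, hU⟩ ⟨B₁, hB₁, M₁, _, _⟩
    have : IsAffine (U : Scheme.{u}) := hU
    obtain ⟨B₂, hB₂, M₂, _, _⟩ := exists_of_isAffine (U.ι ≫ f)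
    -- Quasi-separatedness of `X` enters here: the overlap must be quasi-compact to have a model.
    have hc : CompactSpace ((S ⊓ U : X.Opens) : Scheme.{u}) :=
      isCompact_iff_compactSpace.mp (hS.inter_of_isOpen hU.isCompact S.2 U.2)
    have e₁ : X.homOfLE (le_sup_left : S ≤ S ⊔ U) ≫ (S ⊔ U).ι ≫ f = S.ι ≫ f := by simp
    have e₂ : X.homOfLE (le_sup_right : U ≤ S ⊔ U) ≫ (S ⊔ U).ι ≫ f = U.ι ≫ f := by simp
    refine exists_of_two (i₁ := X.homOfLE (le_sup_left : S ≤ S ⊔ U))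
      (i₂ := X.homOfLE (le_sup_right : U ≤ S ⊔ U)) ?_ (isPullback_opens_inf_le _ _) _ e₁ e₂ hB₁ hB₂
      M₁ M₂
    intro x
    obtain hx | hx := x.2
    · exact .inl (mem_range_homOfLE _ _ hx)
    · exact .inr (mem_range_homOfLE _ _ hx)

end SpecModel

/-! ### Products and diagonals under base change -/

section PullbackSquares

variable {C : Type*} [Category C] [HasPullbacks C] {X₁ X₂ Y₁ Y₂ S T : C} {f₁ : X₁ ⟶ S} {f₂ : X₂ ⟶ S}
  {g₁ : Y₁ ⟶ T} {g₂ : Y₂ ⟶ T} {s : S ⟶ T} {π₁ : X₁ ⟶ Y₁} {π₂ : X₂ ⟶ Y₂}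

lemma isPullback_map_fst (h₁ : π₁ ≫ g₁ = f₁ ≫ s) (h₂ : IsPullback π₂ f₂ g₂ s) :
    IsPullback (pullback.map f₁ f₂ g₁ g₂ π₁ π₂ s h₁.symm h₂.w.symm) (pullback.fst f₁ f₂)
      (pullback.fst g₁ g₂) π₁ := by
  have h := (IsPullback.of_hasPullback f₁ f₂).flip.paste_horiz h₂
  rw [← h₁] at h
  refine IsPullback.of_right (h₁₂ := pullback.snd g₁ g₂) (v₁₃ := g₂) (h₂₂ := g₁)
    ?_ (pullback.lift_fst _ _ _) (IsPullback.of_hasPullback _ _).flip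
  rwa [pullback.lift_snd]

lemma isPullback_diagonal_map (h₁ : IsPullback π₁ f₁ g₁ s) :
    IsPullback π₁ (pullback.diagonal f₁) (pullback.diagonal g₁)
      (pullback.map f₁ f₁ g₁ g₁ π₁ π₁ s h₁.w.symm h₁.w.symm) := by
  refine (IsPullback.of_right (h₁₂ := pullback.fst f₁ f₁) (v₁₃ := π₁) (h₂₂ := pullback.fst g₁ g₁)
    ?_ ?_ (isPullback_map_fst h₁.w h₁).flip).flip
  · rw [pullback.diagonal_fst, pullback.diagonal_fst]
    exact IsPullback.of_horiz_isIso ⟨by simp⟩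
  · apply pullback.hom_ext
    · rw [Category.assoc, pullback.lift_fst, pullback.diagonal_fst_assoc, Category.assoc,
        pullback.diagonal_fst, Category.comp_id]
    · rw [Category.assoc, pullback.lift_snd, pullback.diagonal_snd_assoc, Category.assoc,
        pullback.diagonal_snd, Category.comp_id]

end PullbackSquares

/-! ### Products, descent of morphisms, and separatedness of models -/

namespace SpecModel

section Ring

variable {R : Type u} [CommRing R]

lemma preimage_eq_top_of_comp {X Y Z : Scheme.{u}} {φ : X ⟶ Z} (ψ : X ⟶ Y) {χ : Y ⟶ Z}
    (h : ψ ≫ χ = φ) {U : Z.Opens} (hU : χ ⁻¹ᵁ U = ⊤) : φ ⁻¹ᵁ U = ⊤ := by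
  rw [← h, Scheme.Hom.comp_preimage, hU, Scheme.Hom.preimage_top]

/-- By quasi-compactness, an open subset that contains the image of the limit contains the image of
some finite stage. -/
lemma exists_fst_preimage_eq_top {X W : Scheme.{u}} {f : X ⟶ Spec (.of R)} {B : Subalgebra ℤ R}
    {p : W ⟶ Spec (.of B)} {q : X ⟶ W} (hB : B.FG) [hqc : QuasiCompact p]
    (H : IsPullback q f p (specVal B)) (U : W.Opens) (hU : q ⁻¹ᵁ U = ⊤) :
    ∃ (B' : Subalgebra ℤ R) (_ : B'.FG) (h : B ≤ B'), pullback.fst p (specIncl h) ⁻¹ᵁ U = ⊤ := by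
  have := directed_fgAbove B
  have : Nonempty (FGAbove B) := ⟨⟨B, hB, le_rfl⟩⟩
  obtain ⟨D, c, hc, w, s, e, hp, hw, hs, hπw, hπs⟩ := exists_baseChange_isLimit p hB H
  have (C : (FGAbove B)ᵒᵖ) : CompactSpace (D.obj C) :=
    have : QuasiCompact (s C) := MorphismProperty.of_isPullback (hp C) hqc
    QuasiCompact.compactSpace_of_compactSpace (s C)
  have {C C' : (FGAbove B)ᵒᵖ} (g : C ⟶ C') := isAffineHom_of_isPullback_specIncl hp hw hs g
  obtain ⟨C, g, hC⟩ := exists_map_eq_top D c hc (i := .op ⟨B, hB, le_rfl⟩) (w _ ⁻¹ᵁ U) (by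
    have : e.inv ≫ q = c.π.app _ ≫ w (.op ⟨B, hB, le_rfl⟩) := by
      rw [← hπw (.op ⟨B, hB, le_rfl⟩), Iso.inv_hom_id_assoc]
    rw [← Scheme.Hom.comp_preimage]
    exact preimage_eq_top_of_comp _ this hU)
  rw [← Scheme.Hom.comp_preimage, hw] at hC
  exact ⟨C.unop.1, C.unop.2.1, C.unop.2.2,
    preimage_eq_top_of_comp _ (hp C).isoPullback_inv_fst hC⟩

variable {X Z P : Scheme.{u}} {f : X ⟶ Spec (.of R)} {g : Z ⟶ Spec (.of R)}
  {w : P ⟶ Spec (.of R)} {p₁ : P ⟶ X} {p₂ : P ⟶ Z} {B B' : Subalgebra ℤ R}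

/-- The product of two models. -/
lemma exists_prod (M : SpecModel f B) (N : SpecModel g B) (h : IsPullback p₁ p₂ f g)
    (hw : p₁ ≫ f = w) {Q : Scheme.{u}} {q₁ : Q ⟶ M.left} {q₂ : Q ⟶ N.left} {q : Q ⟶ Spec (.of B)}
    (h' : IsPullback q₁ q₂ M.hom N.hom) (hq : q₁ ≫ M.hom = q) :
    ∃ P : SpecModel w B, ∃ e : P.left = Q, eqToHom e ≫ q = P.hom ∧
      P.π ≫ eqToHom e ≫ q₁ = p₁ ≫ M.π ∧ P.π ≫ eqToHom e ≫ q₂ = p₂ ≫ N.π := by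
  have h₁ := h.flip.paste_horiz N.isPullback
  rw [← M.isPullback.w] at h₁
  have hc : (p₁ ≫ M.π) ≫ M.hom = (p₂ ≫ N.π) ≫ N.hom := by
    rw [Category.assoc, Category.assoc, M.isPullback.w, N.isPullback.w, h.w_assoc]
  obtain ⟨π, hπ₁, hπ₂⟩ : ∃ π : P ⟶ Q, π ≫ q₁ = p₁ ≫ M.π ∧ π ≫ q₂ = p₂ ≫ N.π :=
    ⟨h'.lift _ _ hc, h'.lift_fst _ _ _, h'.lift_snd _ _ _⟩
  have key : IsPullback π p₁ q₁ M.π := by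
    refine IsPullback.of_right (h₁₂ := q₂) (v₁₃ := N.hom) (h₂₂ := M.hom) ?_ hπ₁ h'.flip
    rwa [hπ₂]
  have := key.paste_vert M.isPullback
  rw [hw, hq] at this
  exact ⟨⟨Q, q, π, this⟩, rfl, by simp, by simpa using hπ₁, by simpa using hπ₂⟩

/-- A morphism over the base ring descends to a morphism of models over a finitely generated
subring. -/
lemma exists_map {φ : X ⟶ Z} (hφ : φ ≫ g = f) (M : SpecModel f B) (N : SpecModel g B)
    (hB : B.FG) [QuasiCompact M.hom] [Smooth M.hom] [Smooth N.hom] :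
    ∃ (B' : Subalgebra ℤ R) (_ : B'.FG), ∀ (B'' : Subalgebra ℤ R) (_ : B' ≤ B'')
      (M' : SpecModel f B'') (N' : SpecModel g B'') (_ : Hom M' M) (_ : Hom N' N),
      ∃ γ : M'.left ⟶ N'.left, γ ≫ N'.hom = M'.hom ∧ M'.π ≫ γ = φ ≫ N'.π := by
  have := M.quasiSeparated hB
  obtain ⟨B', hB', M₁, j, γ, h₁, h₂⟩ := M.exists_hom_desc hB N.hom (φ ≫ N.π) (by
    rw [Category.assoc, N.isPullback.w, reassoc_of% hφ])
  -- The result is transported to arbitrary base changes over arbitrary larger subrings, so that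
  -- several morphisms can later be descended over one common subring.
  refine ⟨B', hB', fun B'' h M' N' a b ↦ ?_⟩
  obtain ⟨l, hl, hl'⟩ := j.exists_lift a.map (M'.hom ≫ specIncl h) (by
    rw [a.isPullback.w, Category.assoc, specIncl_specIncl])
  obtain ⟨γ', h₃, h₄⟩ := b.exists_lift (l ≫ γ) M'.hom (by
    rw [Category.assoc, h₁, reassoc_of% hl', specIncl_specIncl])
  refine ⟨γ', h₄, b.hom_ext ?_ ?_⟩
  · have : M'.π ≫ l = M₁.π := by
      refine j.hom_ext ?_ ?_
      · rw [Category.assoc, hl, a.π_map, j.π_map]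
      · rw [Category.assoc, hl', M'.isPullback.w_assoc, specVal_specIncl, M₁.isPullback.w]
    rw [Category.assoc, h₃, reassoc_of% this, h₂, Category.assoc, b.π_map]
  · rw [Category.assoc, h₄, M'.isPullback.w, Category.assoc, N'.isPullback.w, reassoc_of% hφ]

end Ring

section Field

variable {K : Type u} [Field K] {X : Scheme.{u}} {f : X ⟶ Spec (.of K)} {B B' : Subalgebra ℤ K}

instance isDominant_specVal (B : Subalgebra ℤ K) : IsDominant (specVal B) := by
  refine ⟨(PrimeSpectrum.denseRange_comap_iff_ker_le_nilRadical B.val.toRingHom).mpr ?_⟩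
  rw [(RingHom.injective_iff_ker_eq_bot _).mp (Subtype.val_injective : Function.Injective B.val)]
  exact bot_le

omit [Field K] in
lemma flat_of_isFractionRing (B L K : Type*) [CommRing B] [IsDomain B] [Field L] [Algebra B L]
    [IsFractionRing B L] [Field K] [Algebra B K] [Algebra L K] [IsScalarTower B L K] :
    Module.Flat B K :=
  have : Module.Flat B L := IsLocalization.flat L (nonZeroDivisors B)
  Module.Flat.trans B L K

instance flat_specVal (B : Subalgebra ℤ K) : Flat (specVal B) := by
  let : Algebra (FractionRing B) K := FractionRing.liftAlgebra B K
  have h : Module.Flat B K := flat_of_isFractionRing B (FractionRing B) K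
  exact HasRingHomProperty.Spec_iff.mpr h

instance isSchemeTheoreticallyDominant_specVal (B : Subalgebra ℤ K) :
    IsSchemeTheoreticallyDominant (specVal B) :=
  have : IsReduced (Spec (.of B)) := inferInstance
  .of_isDominant _

/-- `Spec K` is scheme-theoretically dense in `Spec B`, and this persists under flat base change. -/
lemma isSchemeTheoreticallyDominant_π (M : SpecModel f B) [Flat M.hom] :
    IsSchemeTheoreticallyDominant M.π :=
  .of_isPullback M.isPullback.flip

lemma quasiCompact_π (M : SpecModel f B) : QuasiCompact M.π :=
  MorphismProperty.of_isPullback M.isPullback.flip inferInstance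

lemma flat_π (M : SpecModel f B) : Flat M.π :=
  MorphismProperty.of_isPullback M.isPullback.flip inferInstance

lemma isDominant_π (M : SpecModel f B) [Flat M.hom] : IsDominant M.π :=
  have := M.isSchemeTheoreticallyDominant_π
  have := M.quasiCompact_π
  inferInstance

/-- Reducedness and irreducibility pass from the scheme-theoretically dense generic fibre to the
model. -/
lemma isIntegral_left (M : SpecModel f B) [Flat M.hom] [IsIntegral X] : IsIntegral M.left := by
  have := M.isSchemeTheoreticallyDominant_π
  have := M.quasiCompact_π
  have := M.isDominant_π
  have : IsReduced M.left := IsSchemeTheoreticallyDominant.isReduced M.π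
  have : IrreducibleSpace M.left := by
    have h := (IrreducibleSpace.isIrreducible_univ X).image M.π M.π.continuous.continuousOn
    rw [Set.image_univ] at h
    have h' := h.closure
    rw [M.π.denseRange.closure_eq] at h'
    have : Nonempty M.left := ⟨h'.1.some⟩
    exact { isPreirreducible_univ := h'.2, toNonempty := this }
  exact isIntegral_of_irreducibleSpace_of_isReduced _

/-- A flat model of finite type with separated generic fibre is separated over a larger subring. -/
lemma exists_isSeparated (M : SpecModel f B) (hB : B.FG) [Flat M.hom] [LocallyOfFiniteType M.hom]
    [QuasiCompact M.hom] [IsIntegral X] [IsSeparated f] :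
    ∃ (B' : Subalgebra ℤ K) (_ : B'.FG) (M' : SpecModel f B') (_ : Hom M' M),
      IsSeparated M'.hom := by
  have := M.isIntegral_left
  obtain ⟨Δ, hΔ⟩ : ∃ Δ : M.left ⟶ pullback M.hom M.hom, Δ = pullback.diagonal M.hom := ⟨_, rfl⟩
  have : IsImmersion Δ := hΔ ▸ inferInstance
  let q := pullback.map f f M.hom M.hom M.π M.π (specVal B) M.isPullback.w.symm M.isPullback.w.symm
  have hq₀ := isPullback_map_fst M.isPullback.w M.isPullback
  have hq := hq₀.paste_vert M.isPullback
  -- The diagonal is closed in the open set `Δ.coborderRange`, the complement of its boundary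
  -- points. The generic fibre of the product avoids these boundary points.
  have hU : q ⁻¹ᵁ Δ.coborderRange = ⊤ := by
    rw [eq_top_iff]
    intro z _
    change q z ∈ coborder (Set.range Δ)
    rw [coborder, Set.mem_compl_iff]
    rintro ⟨hz, hz'⟩
    apply hz'
    have hη : Δ (genericPoint M.left) ⤳ q z := by
      rw [specializes_iff_mem_closure]
      refine closure_minimal ?_ isClosed_closure hz
      rintro _ ⟨y, rfl⟩
      exact ((genericPoint_specializes y).map Δ.continuous).mem_closure
    have := M.flat_π
    have : Flat q := MorphismProperty.of_isPullback hq₀.flip inferInstance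
    -- A boundary point in the image of `q` specializes from the generic point of the diagonal.
    -- Flatness lifts this to a specialization `w ⤳ z` with `w` on the diagonal of `X`, which is
    -- closed, so `z` lies on it as well.
    obtain ⟨w, hw, hw'⟩ := Flat.generalizingMap q hη
    have hsq := isPullback_diagonal_map M.isPullback
    rw [← hΔ] at hsq
    obtain ⟨x, -, hx⟩ := Scheme.exists_preimage_of_isPullback hsq (genericPoint M.left) w hw'.symm
    have hcl : IsClosed (Set.range (pullback.diagonal f)) :=
      (pullback.diagonal f).isClosedEmbedding.isClosed_range
    obtain ⟨x', rfl⟩ := hw.mem_closed hcl ⟨x, hx⟩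
    refine ⟨M.π x', ?_⟩
    rw [← Scheme.Hom.comp_apply, hsq.w, Scheme.Hom.comp_apply]
  obtain ⟨B', hB', h, hj⟩ := exists_fst_preimage_eq_top hB hq Δ.coborderRange hU
  obtain ⟨N, a⟩ : ∃ N : SpecModel f B', Nonempty {a : Hom N M // a.le = h} :=
    ⟨M.baseChange h, ⟨M.baseChangeHom h, rfl⟩⟩
  obtain ⟨a, -⟩ := a
  refine ⟨B', hB', N, a, ⟨?_⟩⟩
  have hsq := isPullback_diagonal_map a.isPullback
  rw [← hΔ] at hsq
  let r := pullback.map N.hom N.hom M.hom M.hom a.map a.map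
    (specIncl a.le) a.isPullback.w.symm a.isPullback.w.symm
  have hr : r ⁻¹ᵁ Δ.coborderRange = ⊤ := by
    refine preimage_eq_top_of_comp (pullback.lift r (pullback.fst _ _ ≫ N.hom) ?_)
      (pullback.lift_fst _ _ _) hj
    change r ≫ pullback.fst _ _ ≫ M.hom = _
    rw [pullback.lift_fst_assoc, Category.assoc, Category.assoc, a.isPullback.w]
  refine .of_isPreimmersion _ ?_
  have : Set.range (pullback.diagonal N.hom) = r ⁻¹' closure (Set.range Δ) := by
    ext z
    constructor
    · rintro ⟨y, rfl⟩
      refine subset_closure ⟨a.map y, ?_⟩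
      rw [← Scheme.Hom.comp_apply, hsq.w, Scheme.Hom.comp_apply]
    · intro hz
      obtain ⟨y, hy⟩ : r z ∈ Set.range Δ := by
        by_contra h
        have hz' : z ∈ r ⁻¹ᵁ Δ.coborderRange := hr ▸ trivial
        exact hz' ⟨hz, h⟩
      obtain ⟨x, -, hx⟩ := Scheme.exists_preimage_of_isPullback hsq y z hy
      exact ⟨x, hx⟩
  rw [this]
  exact isClosed_closure.preimage r.continuous

end Field

end SpecModel

/-! ### Valuation rings: domination, extension, composition, finiteness -/

namespace ValuationSubring

/-- Chevalley's extension theorem, transported from the subring `φ.range` to `R`. For `I` the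
maximal ideal of a local ring it says that the ring is dominated by a valuation ring. -/
lemma exists_le_of_ringHom {R F : Type*} [CommRing R] [Field F] (φ : R →+* F)
    (hφ : Function.Injective φ) {I : Ideal R} (hI : I ≠ ⊤) :
    ∃ W : ValuationSubring F, (∀ r, φ r ∈ W) ∧ ∀ r ∈ I, φ r ∈ W.nonunits := by
  let e : R ≃+* φ.range := RingEquiv.ofBijective φ.rangeRestrict
    ⟨fun x y h ↦ hφ (congrArg Subtype.val h), φ.rangeRestrict_surjective⟩
  have hJ : I.comap (e.symm : φ.range →+* R) ≠ ⊤ := by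
    rw [Ideal.ne_top_iff_one] at hI ⊢
    simpa using hI
  obtain ⟨W, hW, hW'⟩ := Ideal.image_subset_nonunits_valuationSubring _ hJ
  refine ⟨W, fun r ↦ hW ⟨r, rfl⟩, fun r hr ↦ hW' ⟨e r, ?_, rfl⟩⟩
  simpa using hr

/-- A valuation subring extends along a field extension. -/
lemma exists_comap_eq {k l : Type*} [Field k] [Field l] (φ : k →+* l) (V : ValuationSubring k) :
    ∃ W : ValuationSubring l, ∀ a, φ a ∈ W ↔ a ∈ V := by
  obtain ⟨W, hW, hW'⟩ := exists_le_of_ringHom (φ.comp V.subtype)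
    (φ.injective.comp Subtype.val_injective) (I := IsLocalRing.maximalIdeal V)
    (Ideal.IsPrime.ne_top inferInstance)
  refine ⟨W, fun a ↦ ⟨fun ha ↦ ?_, fun ha ↦ hW ⟨a, ha⟩⟩⟩
  by_contra h
  have h' : a⁻¹ ∈ V := (V.mem_or_inv_mem a).resolve_left h
  have ha₀ : a ≠ 0 := by
    rintro rfl
    exact h V.zero_mem
  have hm : (⟨a⁻¹, h'⟩ : V) ∈ IsLocalRing.maximalIdeal V := by
    rw [IsLocalRing.mem_maximalIdeal, _root_.mem_nonunits_iff]
    rintro ⟨u, hu⟩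
    have h₁ : ((u : V) : k) * ((u⁻¹ : Vˣ) : V) = 1 := by
      rw [← MulMemClass.coe_mul, Units.mul_inv, OneMemClass.coe_one]
    rw [hu] at h₁
    have : (((u⁻¹ : Vˣ) : V) : k) = a := by
      have h₂ : a⁻¹ * (((u⁻¹ : Vˣ) : V) : k) = 1 := h₁
      field_simp at h₂
      exact h₂
    exact h (this ▸ Subtype.property _)
  have := hW' _ hm
  rw [mem_nonunits_iff] at this
  have h₁ : W.valuation (φ a) ≤ 1 := (W.valuation_le_one_iff _).mpr ha
  have h₂ : W.valuation (φ a⁻¹) < 1 := this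
  have h₃ : W.valuation (φ a) * W.valuation (φ a⁻¹) = 1 := by
    rw [← map_mul, ← map_mul, mul_inv_cancel₀ ha₀, map_one, map_one]
  exact absurd h₃ ((mul_le_of_le_one_left' h₁).trans_lt h₂).ne

/-- The composition of a valuation with a valuation of its residue field. -/
lemma exists_composite {F : Type*} [Field F] (W : ValuationSubring F)
    (V : ValuationSubring (IsLocalRing.ResidueField W)) :
    ∃ W' : ValuationSubring F, ∀ x, x ∈ W' ↔ ∃ h : x ∈ W, IsLocalRing.residue W ⟨x, h⟩ ∈ V := by
  refine ⟨{ carrier := {x | ∃ h : x ∈ W, IsLocalRing.residue W ⟨x, h⟩ ∈ V}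
            mul_mem' := ?_, one_mem' := ?_, add_mem' := ?_, zero_mem' := ?_, neg_mem' := ?_
            mem_or_inv_mem' := ?_ }, fun x ↦ Iff.rfl⟩
  · rintro x y ⟨hx, hx'⟩ ⟨hy, hy'⟩
    exact ⟨W.mul_mem _ _ hx hy, by
      have := V.mul_mem _ _ hx' hy'
      rwa [← map_mul] at this⟩
  · exact ⟨W.one_mem, by
      have : (⟨1, W.one_mem⟩ : W) = 1 := rfl
      rw [this, map_one]
      exact V.one_mem⟩
  · rintro x y ⟨hx, hx'⟩ ⟨hy, hy'⟩
    exact ⟨W.add_mem _ _ hx hy, by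
      have := V.add_mem _ _ hx' hy'
      rwa [← map_add] at this⟩
  · exact ⟨W.zero_mem, by
      have : (⟨0, W.zero_mem⟩ : W) = 0 := rfl
      rw [this, map_zero]
      exact V.zero_mem⟩
  · rintro x ⟨hx, hx'⟩
    exact ⟨W.neg_mem _ hx, by
      have := V.neg_mem _ hx'
      rwa [← map_neg] at this⟩
  · have aux : ∀ x : F, x ∈ W → x⁻¹ ∉ W →
        ∃ h : x ∈ W, IsLocalRing.residue W ⟨x, h⟩ ∈ V := by
      intro x hx hx'
      refine ⟨hx, ?_⟩
      have : IsLocalRing.residue W ⟨x, hx⟩ = 0 := by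
        rw [IsLocalRing.residue_eq_zero_iff, IsLocalRing.mem_maximalIdeal,
          _root_.mem_nonunits_iff]
        intro hu
        have hv : W.valuation x = 1 := (W.valuation_eq_one_iff ⟨x, hx⟩).mp hu
        apply hx'
        rw [← W.valuation_le_one_iff, map_inv₀, hv, inv_one]
      rw [this]
      exact V.zero_mem
    intro x
    by_cases hx : x ∈ W
    · by_cases hx' : x⁻¹ ∈ W
      · by_cases h₀ : x = 0
        · subst h₀
          left
          refine ⟨hx, ?_⟩
          have : (⟨0, hx⟩ : W) = 0 := rfl
          rw [this, map_zero]
          exact V.zero_mem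
        have h : IsLocalRing.residue W ⟨x⁻¹, hx'⟩ = (IsLocalRing.residue W ⟨x, hx⟩)⁻¹ := by
          apply eq_inv_of_mul_eq_one_left
          rw [← map_mul]
          have : (⟨x⁻¹, hx'⟩ * ⟨x, hx⟩ : W) = 1 := Subtype.ext (inv_mul_cancel₀ h₀)
          rw [this, map_one]
        obtain h' | h' := V.mem_or_inv_mem (IsLocalRing.residue W ⟨x, hx⟩)
        · exact .inl ⟨hx, h'⟩
        · exact .inr ⟨hx', h ▸ h'⟩
      · exact .inl (aux x hx hx')
    · right
      refine aux _ ((W.mem_or_inv_mem x).resolve_left hx) ?_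
      rwa [inv_inv]

section Certificate

variable {K F : Type*} [Field K] [Field F] [Algebra K F]

/-- A polynomial expression for `z` in elements of `S` involves only finitely many coefficients from
`K`. -/
lemma exists_finset_of_mem_adjoin (S : Set F) {z : F} (hz : z ∈ Algebra.adjoin K S) :
    ∃ T : Finset K, ∀ W : ValuationSubring F, (∀ k ∈ T, algebraMap K F k ∈ W) → S ⊆ W → z ∈ W := by
  classical
  induction hz using Algebra.adjoin_induction with
  | mem x hx => exact ⟨∅, fun W _ h ↦ h hx⟩
  | algebraMap r => exact ⟨{r}, fun W h _ ↦ h r (Finset.mem_singleton_self r)⟩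
  | add x y _ _ hx hy =>
    obtain ⟨T, hT⟩ := hx
    obtain ⟨T', hT'⟩ := hy
    exact ⟨T ∪ T', fun W h h' ↦ W.add_mem _ _
      (hT W (fun k hk ↦ h k (Finset.mem_union_left _ hk)) h')
      (hT' W (fun k hk ↦ h k (Finset.mem_union_right _ hk)) h')⟩
  | mul x y _ _ hx hy =>
    obtain ⟨T, hT⟩ := hx
    obtain ⟨T', hT'⟩ := hy
    exact ⟨T ∪ T', fun W h h' ↦ W.mul_mem _ _
      (hT W (fun k hk ↦ h k (Finset.mem_union_left _ hk)) h')
      (hT' W (fun k hk ↦ h k (Finset.mem_union_right _ hk)) h')⟩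

/-- If no valuation ring containing `K` has all elements of a finite set in its maximal ideal, then
this holds for all valuation rings containing a certain finite subset of `K`. -/
lemma exists_finset_forall_notMem_nonunits (S : Finset F)
    (h : ∀ W : ValuationSubring F, (∀ k, algebraMap K F k ∈ W) → ∃ s ∈ S, s ∉ W.nonunits) :
    ∃ T : Finset K, ∀ W : ValuationSubring F, (∀ k ∈ T, algebraMap K F k ∈ W) →
      ∃ s ∈ S, s ∉ W.nonunits := by
  classical
  let A := Algebra.adjoin K (S : Set F)
  let σ : S → A := fun s ↦ ⟨s, Algebra.subset_adjoin s.2⟩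
  -- A proper ideal would be contained in the maximal ideal of a valuation ring over `K[S]`, against
  -- `h`. The resulting relation `1 = ∑ aₛ s` with `aₛ ∈ K[S]` is a certificate that uses only
  -- finitely many elements of `K`.
  have hI : Ideal.span (Set.range σ) = ⊤ := by
    by_contra hI
    obtain ⟨W, hW, hW'⟩ := exists_le_of_ringHom A.val.toRingHom Subtype.val_injective hI
    obtain ⟨s, hs, hs'⟩ := h W fun k ↦ hW (algebraMap K A k)
    exact hs' (hW' _ (Ideal.subset_span ⟨⟨s, hs⟩, rfl⟩))
  obtain ⟨a, ha⟩ := (Ideal.mem_span_range_iff_exists_fun).mp ((Ideal.eq_top_iff_one _).mp hI)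
  choose T hT using fun s ↦ exists_finset_of_mem_adjoin (S : Set F) (a s).2
  refine ⟨Finset.univ.biUnion T, fun W hW ↦ ?_⟩
  by_contra! hS
  have h₁ : ∀ s : S, ((a s : F) * s) ∈ W.nonunits := by
    intro s
    have hs : (a s : F) ∈ W := hT s W (fun k hk ↦ hW k (Finset.mem_biUnion.mpr ⟨s, by simp, hk⟩))
      fun x hx ↦ W.nonunits_subset (hS x hx)
    rw [ValuationSubring.mem_nonunits_iff, map_mul]
    exact (mul_le_of_le_one_left' ((W.valuation_le_one_iff _).mpr hs)).trans_lt (hS s s.2)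
  have h₂ : W.valuation (∑ s, (a s : F) * s) < 1 :=
    W.valuation.map_sum_lt one_ne_zero fun s _ ↦ h₁ s
  have h₃ : (∑ s, (a s : F) * s) = 1 := by
    have := congrArg A.val ha
    simpa [map_sum] using this
  rw [h₃, map_one] at h₂
  exact lt_irrefl _ h₂

/-- A finiteness property for valuation rings which contain one of finitely many finite sets. -/
lemma exists_finset_forall_exists_forall_mem {ι : Type*} [Finite ι] {J : ι → Type*}
    [∀ a, Finite (J a)] (x : ∀ a, J a → F)
    (h : ∀ W : ValuationSubring F, (∀ k, algebraMap K F k ∈ W) → ∃ a, ∀ j, x a j ∈ W) :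
    ∃ T : Finset K, ∀ W : ValuationSubring F, (∀ k ∈ T, algebraMap K F k ∈ W) →
      ∃ a, ∀ j, x a j ∈ W := by
  classical
  have := Fintype.ofFinite ι
  have (a : ι) := Fintype.ofFinite (J a)
  -- Failure for every `a` means that some choice function `c` has all `x a (c a)` outside `W`, that
  -- is, all their inverses in the maximal ideal. There are only finitely many choice functions to
  -- exclude.
  have key : ∀ c : ∀ a, J a, ∃ T : Finset K, ∀ W : ValuationSubring F,
      (∀ k ∈ T, algebraMap K F k ∈ W) → ∃ a, x a (c a) ∈ W := by
    intro c
    by_cases h₀ : ∃ a, x a (c a) = 0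
    · obtain ⟨a, ha⟩ := h₀
      exact ⟨∅, fun W _ ↦ ⟨a, ha ▸ W.zero_mem⟩⟩
    push Not at h₀
    have hx : ∀ (W : ValuationSubring F) a, x a (c a) ∈ W ↔ (x a (c a))⁻¹ ∉ W.nonunits := by
      intro W a
      rw [ValuationSubring.mem_nonunits_iff, ← W.valuation_le_one_iff, map_inv₀, not_lt,
        one_le_inv₀ (by simpa [zero_lt_iff] using h₀ a)]
    obtain ⟨T, hT⟩ := exists_finset_forall_notMem_nonunits (K := K)
      (Finset.univ.image fun a ↦ (x a (c a))⁻¹) (by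
        intro W hW
        obtain ⟨a, ha⟩ := h W hW
        exact ⟨_, Finset.mem_image_of_mem _ (Finset.mem_univ a), (hx W a).mp (ha _)⟩)
    refine ⟨T, fun W hW ↦ ?_⟩
    obtain ⟨s, hs, hs'⟩ := hT W hW
    obtain ⟨a, -, rfl⟩ := Finset.mem_image.mp hs
    exact ⟨a, (hx W a).mpr hs'⟩
  choose T hT using key
  refine ⟨Finset.univ.biUnion T, fun W hW ↦ ?_⟩
  by_contra! hW'
  choose c hc using hW'
  obtain ⟨a, ha⟩ := hT c W fun k hk ↦ hW k (Finset.mem_biUnion.mpr ⟨c, Finset.mem_univ _, hk⟩)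
  exact hc a ha

end Certificate

end ValuationSubring

/-! ### Morphisms from spectra of local rings -/

section LocalRingPoints

variable {Y : Scheme.{u}}

lemma exists_stalk_hom_of_isLocalRing {R : Type u} [CommRing R] [IsLocalRing R]
    (f : Spec (.of R) ⟶ Y) :
    ∃ (y : Y) (ψ : Y.presheaf.stalk y →+* R), f (IsLocalRing.closedPoint R) = y ∧ IsLocalHom ψ ∧
      Spec.map (CommRingCat.ofHom ψ) ≫ Y.fromSpecStalk y = f :=
  ⟨_, (Scheme.stalkClosedPointTo f).hom, rfl, inferInstance,
    Scheme.Spec_stalkClosedPointTo_fromSpecStalk f⟩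

lemma specMap_comp_stalkSpecializes {x y : Y} (h : x ⤳ y) {R : Type u} [CommRing R]
    (γ : Y.presheaf.stalk x →+* R) :
    Spec.map (CommRingCat.ofHom (γ.comp (Y.presheaf.stalkSpecializes h).hom)) ≫
      Y.fromSpecStalk y = Spec.map (CommRingCat.ofHom γ) ≫ Y.fromSpecStalk x := by
  have key : ∀ (A B C : CommRingCat.{u}) (f : A ⟶ B) (g : B ⟶ C) (q : Spec A ⟶ Y) (r : Spec B ⟶ Y),
      Spec.map f ≫ q = r → Spec.map (f ≫ g) ≫ q = Spec.map g ≫ r := by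
    rintro A B C f g q r rfl
    rw [Spec.map_comp, Category.assoc]
  exact key _ _ _ _ (CommRingCat.ofHom γ) _ _ (Scheme.SpecMap_stalkSpecializes_fromSpecStalk h)

lemma comp_closedPoint {R S : Type u} [CommRing R] [CommRing S] [IsLocalRing R] [IsLocalRing S]
    (γ : S →+* R) [IsLocalHom γ] (g : Spec (.of S) ⟶ Y) :
    (Spec.map (CommRingCat.ofHom γ) ≫ g) (IsLocalRing.closedPoint R) =
      g (IsLocalRing.closedPoint S) :=
  congrArg g (IsLocalRing.comap_closedPoint γ)

lemma comp_specializes_closedPoint {R : Type u} [CommRing R] [IsLocalRing R] {T : Scheme.{u}}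
    (g : T ⟶ Spec (.of R)) (f : Spec (.of R) ⟶ Y) (z : T) :
    (g ≫ f) z ⤳ f (IsLocalRing.closedPoint R) :=
  (IsLocalRing.specializes_closedPoint (g z)).map f.continuous

lemma exists_stalk_hom_of_field [IsIntegral Y] {F : Type u} [Field F] (i : Spec (.of F) ⟶ Y)
    (hi : i (IsLocalRing.closedPoint F) = genericPoint Y) (x : Y) :
    ∃ φ : Y.presheaf.stalk x →+* F, Function.Injective φ ∧
      Spec.map (CommRingCat.ofHom φ) ≫ Y.fromSpecStalk x = i := by
  obtain ⟨y, ψ, hy, -, hψ⟩ := exists_stalk_hom_of_isLocalRing i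
  rw [hi] at hy
  subst hy
  let σ := Y.presheaf.stalkSpecializes ((genericPoint_spec Y).specializes (Set.mem_univ x))
  refine ⟨ψ.comp σ.hom, ?_, ?_⟩
  · have h₁ : Function.Injective σ.hom :=
      IsFractionRing.injective (Y.presheaf.stalk x) Y.functionField
    have h₂ : Function.Injective (ψ : Y.functionField →+* F) := RingHom.injective _
    exact h₂.comp h₁
  · rw [← hψ]
    exact specMap_comp_stalkSpecializes _ ψ

lemma isDominant_specMap {R S : Type u} [CommRing R] [CommRing S] (φ : R →+* S)
    (hφ : Function.Injective φ) : IsDominant (Spec.map (CommRingCat.ofHom φ)) := by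
  refine ⟨(PrimeSpectrum.denseRange_comap_iff_ker_le_nilRadical φ).mpr ?_⟩
  rw [(RingHom.injective_iff_ker_eq_bot _).mp hφ]
  exact bot_le

/-- `Spec S` is dense in the reduced scheme `Spec R`, and `Y` is separated over `Z`. -/
lemma hom_ext_of_injective {R S : Type u} [CommRing R] [IsDomain R] [CommRing S] (φ : R →+* S)
    (hφ : Function.Injective φ) {Z : Scheme.{u}} {p : Y ⟶ Z} [IsSeparated p]
    {a b : Spec (.of R) ⟶ Y} (hab : a ≫ p = b ≫ p)
    (h : Spec.map (CommRingCat.ofHom φ) ≫ a = Spec.map (CommRingCat.ofHom φ) ≫ b) : a = b :=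
  have := isDominant_specMap φ hφ
  have : IsReduced (Spec (CommRingCat.of R)) := inferInstance
  ext_of_isDominant_of_isSeparated p hab _ h

lemma hom_ext_of_injective_of_isAffine {R S B : Type u} [CommRing R] [CommRing S] [CommRing B]
    (φ : R →+* S) (hφ : Function.Injective φ) {a b : Spec (.of R) ⟶ Spec (.of B)}
    (h : Spec.map (CommRingCat.ofHom φ) ≫ a = Spec.map (CommRingCat.ofHom φ) ≫ b) : a = b := by
  obtain ⟨α, rfl⟩ := Spec.map_surjective a
  obtain ⟨β, rfl⟩ := Spec.map_surjective b
  rw [← Spec.map_comp, ← Spec.map_comp] at h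
  have h' := Spec.map_injective h
  congr 1
  ext x
  apply hφ
  exact congrArg (fun γ ↦ γ.hom x) h'

end LocalRingPoints

/-! ### The valuative criterion tested at the generic point -/

section ValuativeCriterion

variable {Y : Scheme.{u}} {B : Type u} [CommRing B]

/-- For a separated integral scheme, the existence part of the valuative criterion can be checked
for valuation rings of a field whose spectrum maps to the generic point. -/
lemma valuativeCriterion_existence_of_valuationSubring [IsIntegral Y] (p : Y ⟶ Spec (.of B))
    [IsSeparated p] {F : Type u} [Field F] (i : Spec (.of F) ⟶ Y)
    (hi : i (IsLocalRing.closedPoint F) = genericPoint Y)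
    (β : B →+* F) (hβ : Spec.map (CommRingCat.ofHom β) = i ≫ p)
    (H : ∀ W : ValuationSubring F, (∀ b, β b ∈ W) →
      ∃ l : Spec (.of W) ⟶ Y, Spec.map (CommRingCat.ofHom W.subtype) ≫ l = i) :
    ValuativeCriterion.Existence p := by
  intro S
  obtain ⟨x, α, -, hα, hα'⟩ := exists_stalk_hom_of_isLocalRing S.i₁
  obtain ⟨j, hj, hji⟩ := exists_stalk_hom_of_field i hi x
  -- The given test diagram starts at an arbitrary point `x`. The local ring at `x` is dominated by
  -- a valuation ring `W` of `F`, which reduces the test to a valuation of the residue field of `x`.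
  obtain ⟨W, hW, hW'⟩ := ValuationSubring.exists_le_of_ringHom j hj
    (I := IsLocalRing.maximalIdeal _) (Ideal.IsPrime.ne_top inferInstance)
  let γ : Y.presheaf.stalk x →+* W := j.codRestrict W.toSubring hW
  have hγj : W.subtype.comp γ = j := rfl
  have hγ : IsLocalHom γ := by
    refine ⟨fun a ha ↦ ?_⟩
    by_contra hna
    have h₁ := hW' a ((IsLocalRing.mem_maximalIdeal _).mpr hna)
    have h₂ : W.valuation (j a) = 1 := (W.valuation_eq_one_iff (γ a)).mp ha
    rw [ValuationSubring.mem_nonunits_iff, h₂] at h₁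
    exact lt_irrefl _ h₁
  let k := IsLocalRing.ResidueField (Y.presheaf.stalk x)
  let βk : k →+* IsLocalRing.ResidueField W := IsLocalRing.ResidueField.map γ
  let αk : k →+* S.K := IsLocalRing.ResidueField.lift α
  let V : ValuationSubring S.K := (ValuationRing.valuation S.R S.K).valuationSubring
  have hV (a : S.K) : a ∈ V ↔ ∃ r, algebraMap S.R S.K r = a :=
    ValuationRing.mem_integer_iff S.R S.K a
  -- The valuation ring of the test diagram is restricted to the residue field of `x`, extended to
  -- the residue field of `W`, and composed with `W`. The composite `W'` is a valuation ring of `F`,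
  -- to which `H` applies.
  obtain ⟨V₁, hV₁⟩ := ValuationSubring.exists_comap_eq βk (V.comap αk)
  have hV₁' (a : Y.presheaf.stalk x) : IsLocalRing.residue W (γ a) ∈ V₁ ↔ α a ∈ V :=
    hV₁ (IsLocalRing.residue _ a)
  obtain ⟨W', hWW'⟩ := ValuationSubring.exists_composite W V₁
  have hle (a) (ha : a ∈ W') : a ∈ W := ((hWW' a).mp ha).1
  have hmem (a : Y.presheaf.stalk x) : j a ∈ W' ↔ α a ∈ V := by
    rw [hWW', ← hV₁']
    exact ⟨fun ⟨_, h⟩ ↦ h, fun h ↦ ⟨hW a, h⟩⟩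
  obtain ⟨βx, hβx⟩ : ∃ βx : B →+* Y.presheaf.stalk x,
      Spec.map (CommRingCat.ofHom βx) = Y.fromSpecStalk x ≫ p :=
    ⟨(Spec.preimage (Y.fromSpecStalk x ≫ p)).hom, Spec.map_preimage _⟩
  obtain ⟨s, hs⟩ : ∃ s : B →+* S.R, Spec.map (CommRingCat.ofHom s) = S.i₂ :=
    ⟨(Spec.preimage S.i₂).hom, Spec.map_preimage _⟩
  have hβj : β = j.comp βx := by
    have : CommRingCat.ofHom β = CommRingCat.ofHom βx ≫ CommRingCat.ofHom j := by
      apply Spec.map_injective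
      rw [Spec.map_comp, hβ, hβx, reassoc_of% hji]
    exact congrArg CommRingCat.Hom.hom this
  have hαs : α.comp βx = (algebraMap S.R S.K).comp s := by
    have : CommRingCat.ofHom βx ≫ CommRingCat.ofHom α =
        CommRingCat.ofHom s ≫ CommRingCat.ofHom (algebraMap S.R S.K) := by
      apply Spec.map_injective
      rw [Spec.map_comp, Spec.map_comp, hβx, hs, reassoc_of% hα', S.commSq.w]
    exact congrArg CommRingCat.Hom.hom this
  obtain ⟨l, hl⟩ := H W' fun b ↦ by
    rw [hβj]
    refine (hmem (βx b)).mpr ((hV _).mpr ⟨s b, ?_⟩)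
    exact (congrArg (fun φ : B →+* S.K ↦ φ b) hαs).symm
  obtain ⟨y, ψ, hy, hψ, hψl⟩ := exists_stalk_hom_of_isLocalRing l
  let ι : W' →+* W := W'.subtype.codRestrict W.toSubring fun a ↦ hle a a.2
  have hw : Spec.map (CommRingCat.ofHom ι) ≫ l =
      Spec.map (CommRingCat.ofHom γ) ≫ Y.fromSpecStalk x := by
    have hinj : Function.Injective W.subtype := Subtype.val_injective
    have h₁ : Spec.map (CommRingCat.ofHom W.subtype) ≫ Spec.map (CommRingCat.ofHom ι) ≫ l =
        Spec.map (CommRingCat.ofHom W.subtype) ≫ Spec.map (CommRingCat.ofHom γ) ≫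
          Y.fromSpecStalk x := by
      rw [← Spec.map_comp_assoc, ← Spec.map_comp_assoc]
      exact hl.trans hji.symm
    refine hom_ext_of_injective (p := p) W.subtype hinj ?_ h₁
    refine hom_ext_of_injective_of_isAffine W.subtype hinj ?_
    simpa only [Category.assoc] using congrArg (· ≫ p) h₁
  -- The closed point of `W'` goes to `y`, while that of `W`, a localization of `W'`, goes to `x`.
  have hxy : x ⤳ y := by
    have h₁ : (Spec.map (CommRingCat.ofHom ι) ≫ l) (IsLocalRing.closedPoint W) = x := by
      rw [hw]
      exact (comp_closedPoint γ _).trans Scheme.fromSpecStalk_closedPoint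
    rw [← h₁, ← hy]
    exact comp_specializes_closedPoint _ _ _
  let φ := Y.presheaf.stalkSpecializes hxy
  have hφ : γ.comp φ.hom = ι.comp ψ := by
    have : CommRingCat.ofHom (γ.comp φ.hom) = CommRingCat.ofHom (ι.comp ψ) := by
      apply Spec.map_injective
      rw [← cancel_mono (Y.fromSpecStalk y)]
      refine (specMap_comp_stalkSpecializes hxy γ).trans ?_
      rw [← hw, ← hψl, CommRingCat.ofHom_comp, Spec.map_comp, Category.assoc]
    exact congrArg CommRingCat.Hom.hom this
  -- The stalk at `y` lands in `W'`, hence its image in `S.K` lies in `S.R`. This gives the required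
  -- extension.
  have hφV (r) : ∃ v, algebraMap S.R S.K v = α (φ.hom r) := by
    rw [← hV, ← hmem, ← hγj]
    have : γ (φ.hom r) = ι (ψ r) := congrArg (fun χ : Y.presheaf.stalk y →+* W ↦ χ r) hφ
    change ((γ (φ.hom r) : W) : F) ∈ W'
    rw [this]
    exact (ψ r).2
  have hR : Function.Injective (algebraMap S.R S.K) := IsFractionRing.injective _ _
  let e : S.R ≃+* (algebraMap S.R S.K).range := RingEquiv.ofBijective
    (algebraMap S.R S.K).rangeRestrict
    ⟨fun a b h ↦ hR (congrArg Subtype.val h), (algebraMap S.R S.K).rangeRestrict_surjective⟩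
  let θ : Y.presheaf.stalk y →+* S.R := (e.symm : _ →+* S.R).comp
    ((α.comp φ.hom).codRestrict (algebraMap S.R S.K).range hφV)
  have hθ : (algebraMap S.R S.K).comp θ = α.comp φ.hom := by
    ext r
    exact congrArg Subtype.val (e.apply_symm_apply
      ((α.comp φ.hom).codRestrict (algebraMap S.R S.K).range hφV r))
  have hfac : Spec.map (CommRingCat.ofHom (algebraMap S.R S.K)) ≫
      Spec.map (CommRingCat.ofHom θ) ≫ Y.fromSpecStalk y = S.i₁ := by
    rw [← Spec.map_comp_assoc, ← CommRingCat.ofHom_comp, hθ, ← hα']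
    exact specMap_comp_stalkSpecializes hxy α
  refine ⟨⟨⟨Spec.map (CommRingCat.ofHom θ) ≫ Y.fromSpecStalk y, hfac, ?_⟩⟩⟩
  refine hom_ext_of_injective_of_isAffine _ hR ?_
  rw [← S.commSq.w, ← hfac]
  simp only [Category.assoc]

end ValuativeCriterion

/-! ### Finite affine covers and lifting to a chart -/

section AffineCharts

variable {Y : Scheme.{u}}

lemma exists_finite_affine_charts (Y : Scheme.{u}) [CompactSpace Y] :
    ∃ (ι : Type u) (_ : Finite ι) (A : ι → Type u) (_ : ∀ a, CommRing (A a))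
      (v : ∀ a, Spec (.of (A a)) ⟶ Y), (∀ a, IsOpenImmersion (v a)) ∧
        ∀ y : Y, ∃ a, y ∈ Set.range (v a) := by
  have h (y : Y) : ∃ U : Y.affineOpens, y ∈ (U : Y.Opens) := by
    obtain ⟨_, ⟨U, hU, rfl⟩, hyU, -⟩ := Y.isBasis_affineOpens.exists_subset_of_mem_open
      (Set.mem_univ y) isOpen_univ
    exact ⟨⟨U, hU⟩, hyU⟩
  choose U hU using h
  have hA (y : Y) : IsAffineOpen (U y : Y.Opens) := (U y).2
  obtain ⟨t, -, ht⟩ := (isCompact_univ (X := Y)).elim_nhds_subcover (fun y ↦ ((U y : Y.Opens) : Set Y))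
    fun y _ ↦ (U y : Y.Opens).2.mem_nhds (hU y)
  refine ⟨t, inferInstance, fun y ↦ Γ(Y, (U y : Y.Opens)), inferInstance,
    fun y ↦ (hA y).fromSpec, fun y ↦ (hA y).isOpenImmersion_fromSpec,
    fun y ↦ ?_⟩
  obtain ⟨z, hz, hy⟩ := Set.mem_iUnion₂.mp (ht (Set.mem_univ y))
  exact ⟨⟨z, hz⟩, by rwa [(hA z).range_fromSpec]⟩

/-- Every point of `Spec R` specializes to the closed point, so an open set containing the image of
the closed point contains the whole image. -/
lemma exists_lift_of_closedPoint_mem_range {R A : Type u} [CommRing R] [IsLocalRing R] [CommRing A]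
    (v : Spec (.of A) ⟶ Y) [IsOpenImmersion v] (g : Spec (.of R) ⟶ Y)
    (h : g (IsLocalRing.closedPoint R) ∈ Set.range v) :
    ∃ φ : A →+* R, Spec.map (CommRingCat.ofHom φ) ≫ v = g := by
  have hr : Set.range g ⊆ Set.range v := by
    rintro _ ⟨z, rfl⟩
    have hs : g z ⤳ g (IsLocalRing.closedPoint R) :=
      (IsLocalRing.specializes_closedPoint z).map g.continuous
    exact hs.mem_open v.isOpenEmbedding.isOpen_range h
  refine ⟨(Spec.preimage (IsOpenImmersion.lift v g hr)).hom, ?_⟩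
  rw [CommRingCat.ofHom_hom, Spec.map_preimage, IsOpenImmersion.lift_fac]

end AffineCharts

/-! ### Properness of models -/

namespace SpecModel

variable {K : Type u} [Field K] {X : Scheme.{u}} {f : X ⟶ Spec (.of K)} {B B' : Subalgebra ℤ K}

/-- Extending the `F`-point over `W` amounts to finding a chart, among finitely many, whose finitely
many coordinate functions take values in `W`. For `W` containing `K` one exists because `X` is
proper, so the finiteness result for valuation rings yields the set `T`. -/
lemma exists_finset_forall_exists_lift (M : SpecModel f B) [QuasiCompact M.hom]
    [LocallyOfFiniteType M.hom] [IsProper f] {F : Type u} [Field F] (i : Spec (.of F) ⟶ X)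
    (κ : K →+* F) (hκ : Spec.map (CommRingCat.ofHom κ) = i ≫ f) :
    ∃ T : Finset K, ∀ W : ValuationSubring F, (∀ k ∈ T, κ k ∈ W) → (∀ b : B, κ b ∈ W) →
      ∃ l : Spec (.of W) ⟶ M.left, Spec.map (CommRingCat.ofHom W.subtype) ≫ l = i ≫ M.π := by
  let : Algebra K F := κ.toAlgebra
  have : CompactSpace M.left := (quasiCompact_iff_compactSpace M.hom).mp inferInstance
  obtain ⟨ι₀, _, A, _, v, hv, hcov⟩ := exists_finite_affine_charts M.left
  let pt : M.left := (i ≫ M.π) (IsLocalRing.closedPoint F)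
  let ι := {a // pt ∈ Set.range (v a)}
  choose φ hφ using fun a : ι ↦ exists_lift_of_closedPoint_mem_range (v a.1) (i ≫ M.π) a.2
  have hρ (a : ι) : ∃ ρ : B →+* A a.1, Spec.map (CommRingCat.ofHom ρ) = v a.1 ≫ M.hom :=
    ⟨(Spec.preimage (v a.1 ≫ M.hom)).hom, Spec.map_preimage _⟩
  choose ρ hρ using hρ
  have hφρ (a : ι) (b : B) : φ a (ρ a b) = κ b := by
    have : CommRingCat.ofHom ((φ a).comp (ρ a)) = CommRingCat.ofHom (κ.comp B.val.toRingHom) := by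
      apply Spec.map_injective
      rw [CommRingCat.ofHom_comp, CommRingCat.ofHom_comp, Spec.map_comp, Spec.map_comp, hρ,
        reassoc_of% hφ a, M.isPullback.w, hκ, Category.assoc]
    exact congrArg (fun g ↦ g.hom b) this
  have hft (a : ι) : ∃ G : Finset (A a.1), ∀ S : Subring (A a.1), (∀ b, ρ a b ∈ S) →
      (∀ x ∈ G, x ∈ S) → S = ⊤ := by
    have h₁ : LocallyOfFiniteType (Spec.map (CommRingCat.ofHom (ρ a))) := by
      rw [hρ]
      infer_instance
    have h₂ : (ρ a).FiniteType := HasRingHomProperty.Spec_iff.mp h₁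
    let := (ρ a).toAlgebra
    obtain ⟨G, hG⟩ := h₂
    refine ⟨G, fun S hS hG' ↦ ?_⟩
    rw [eq_top_iff]
    intro x _
    have hx : x ∈ Algebra.adjoin B (G : Set (A a.1)) := by
      rw [hG]
      trivial
    induction hx using Algebra.adjoin_induction with
    | mem x hx => exact hG' x hx
    | algebraMap b => exact hS b
    | add x y _ _ hx hy => exact S.add_mem (hx trivial) (hy trivial)
    | mul x y _ _ hx hy => exact S.mul_mem (hx trivial) (hy trivial)
  choose G hG using hft
  obtain ⟨T, hT⟩ := ValuationSubring.exists_finset_forall_exists_forall_mem (K := K) (F := F)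
    (fun (a : ι) (x : G a) ↦ φ a x) (by
      intro W hW
      let κW : K →+* W := κ.codRestrict W.toSubring hW
      have hs : CommSq i (Spec.map (CommRingCat.ofHom (algebraMap W F))) f
          (Spec.map (CommRingCat.ofHom κW)) := ⟨by
        rw [← Spec.map_comp, ← CommRingCat.ofHom_comp, ← hκ]
        rfl⟩
      have hex : ValuativeCriterion.Existence f := by
        have : UniversallyClosed f := inferInstance
        rw [UniversallyClosed.eq_valuativeCriterion] at this
        exact this.1
      obtain ⟨⟨l, hl, -⟩⟩ := hex ⟨W, F, i, _, hs⟩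
      obtain ⟨a, ha⟩ := hcov ((l ≫ M.π) (IsLocalRing.closedPoint W))
      have hl' : Spec.map (CommRingCat.ofHom W.subtype) ≫ l ≫ M.π = i ≫ M.π := by
        rw [← Category.assoc]
        exact congrArg (· ≫ M.π) hl
      have hpt : pt ∈ Set.range (v a) := by
        have hs := comp_specializes_closedPoint (Spec.map (CommRingCat.ofHom W.subtype)) (l ≫ M.π)
          (IsLocalRing.closedPoint F)
        rw [hl'] at hs
        exact hs.mem_open (v a).isOpenEmbedding.isOpen_range ha
      obtain ⟨ψ, hψ⟩ := exists_lift_of_closedPoint_mem_range (v a) (l ≫ M.π) ha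
      refine ⟨⟨a, hpt⟩, fun x ↦ ?_⟩
      have : CommRingCat.ofHom (φ ⟨a, hpt⟩) = CommRingCat.ofHom (W.subtype.comp ψ) := by
        apply Spec.map_injective
        rw [← cancel_mono (v a), hφ, CommRingCat.ofHom_comp, Spec.map_comp, Category.assoc, hψ, hl']
      rw [show φ ⟨a, hpt⟩ x = W.subtype (ψ x) from congrArg (fun g ↦ g.hom x.1) this]
      exact (ψ x).2)
  refine ⟨T, fun W hW hB ↦ ?_⟩
  obtain ⟨a, ha⟩ := hT W hW
  -- `W` contains the images of `B` and of the generators, so it contains the image of the whole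
  -- coordinate ring of the chart.
  have htop := hG a (W.toSubring.comap (φ a)) (fun b ↦ by
    change φ a (ρ a b) ∈ W
    rw [hφρ]
    exact hB b) fun x hx ↦ ha ⟨x, hx⟩
  have hmem (x) : φ a x ∈ W.toSubring := by
    have : x ∈ W.toSubring.comap (φ a) := htop ▸ trivial
    exact this
  refine ⟨Spec.map (CommRingCat.ofHom ((φ a).codRestrict W.toSubring hmem)) ≫ v a.1, ?_⟩
  rw [← hφ a, ← Spec.map_comp_assoc]
  rfl

lemma π_genericPoint (M : SpecModel f B) [Flat M.hom] [IsIntegral X] [IsIntegral M.left] :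
    M.π (genericPoint X) = genericPoint M.left := by
  have := M.isDominant_π
  have h := (genericPoint_spec X).image M.π.continuous
  rw [Set.image_univ, M.π.denseRange.closure_eq] at h
  exact h.eq (genericPoint_spec M.left)

/-- A smooth model of a proper integral scheme is proper over a larger subring. -/
lemma exists_isProper (M : SpecModel f B) (hB : B.FG) [Smooth M.hom] [QuasiCompact M.hom]
    [IsIntegral X] [IsProper f] :
    ∃ (B' : Subalgebra ℤ K) (_ : B'.FG) (M' : SpecModel f B') (_ : Hom M' M), IsProper M'.hom := by
  obtain ⟨B₁, hB₁, M₁, a₁, _⟩ := M.exists_isSeparated hB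
  have := a₁.smooth
  have := a₁.quasiCompact
  let F := X.functionField
  let i : Spec (.of F) ⟶ X := X.fromSpecStalk (genericPoint X)
  have hi : i (IsLocalRing.closedPoint F) = genericPoint X := Scheme.fromSpecStalk_closedPoint
  obtain ⟨κ, hκ⟩ : ∃ κ : K →+* F, Spec.map (CommRingCat.ofHom κ) = i ≫ f :=
    ⟨(Spec.preimage (i ≫ f)).hom, Spec.map_preimage _⟩
  obtain ⟨T, hT⟩ := M₁.exists_finset_forall_exists_lift i κ hκ
  -- With `T` adjoined, every valuation ring of the function field that contains `B₂` meets the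
  -- condition under which the generic point extends.
  let B₂ := B₁ ⊔ Algebra.adjoin ℤ (T : Set K)
  have hB₂ : B₂.FG := hB₁.sup ⟨T, rfl⟩
  obtain ⟨M₂, ⟨a₂⟩⟩ : ∃ M₂ : SpecModel f B₂, Nonempty (Hom M₂ M₁) :=
    ⟨M₁.baseChange le_sup_left, ⟨M₁.baseChangeHom le_sup_left⟩⟩
  have := a₂.smooth
  have := a₂.quasiCompact
  have := a₂.isSeparated
  have := M₂.isIntegral_left
  refine ⟨B₂, hB₂, M₂, a₂.comp a₁, ?_⟩
  let β : B₂ →+* F := κ.comp B₂.val.toRingHom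
  have hβ : Spec.map (CommRingCat.ofHom β) = (i ≫ M₂.π) ≫ M₂.hom := by
    rw [CommRingCat.ofHom_comp, Spec.map_comp, hκ, Category.assoc, Category.assoc, M₂.isPullback.w]
  have hex : ValuativeCriterion.Existence M₂.hom := by
    refine valuativeCriterion_existence_of_valuationSubring M₂.hom (i ≫ M₂.π) ?_ β hβ ?_
    · rw [← M₂.π_genericPoint, ← hi]
      exact Scheme.Hom.comp_apply _ _ _
    · intro W hW
      obtain ⟨l, hl⟩ := hT W
        (fun k hk ↦ hW ⟨k, (le_sup_right : _ ≤ B₂) (Algebra.subset_adjoin hk)⟩)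
        (fun b ↦ hW ⟨b, a₂.le b.2⟩)
      let βW : B₂ →+* W := β.codRestrict W.toSubring hW
      have hβW : Spec.map (CommRingCat.ofHom W.subtype) ≫ Spec.map (CommRingCat.ofHom βW) =
          (i ≫ M₂.π) ≫ M₂.hom := by
        rw [← hβ, ← Spec.map_comp]
        rfl
      obtain ⟨l', hl', hl''⟩ := a₂.exists_lift l (Spec.map (CommRingCat.ofHom βW)) (by
        refine hom_ext_of_injective_of_isAffine W.subtype Subtype.val_injective ?_
        rw [reassoc_of% hl, reassoc_of% hβW, ← a₂.π_map, Category.assoc, a₂.isPullback.w])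
      refine ⟨l', a₂.hom_ext ?_ ?_⟩
      · rw [Category.assoc, hl', hl, Category.assoc, a₂.π_map]
      · rw [Category.assoc, hl'', hβW]
  have := UniversallyClosed.of_valuativeCriterion M₂.hom hex
  exact {}

end SpecModel

/-! ### Lifting group structures along a functor -/

section GrpObj

open MonoidalCategory CartesianMonoidalCategory MonObj

variable {C D : Type*} [Category* C] [Category* D] [CartesianMonoidalCategory C]
  [CartesianMonoidalCategory D]

/-- A group structure on the image of an object under a functor lifts to the object if the
structure morphisms lift, and if the functor is faithful enough to check the axioms. -/
@[reducible] def CategoryTheory.GrpObj.ofFunctor (F : C ⥤ D) {Y : C} {G : D} [GrpObj G]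
    (e : F.obj Y ⟶ G) (P : ObjectProperty C) (h₁ : P (𝟙_ C)) (hY : P Y)
    (hP : ∀ T T', P T → P T' → P (T ⊗ T'))
    (hF : ∀ (T : C), P T → ∀ x y : T ⟶ Y, F.map x ≫ e = F.map y ≫ e → x = y)
    (m : Y ⊗ Y ⟶ Y) (u : 𝟙_ C ⟶ Y) (i : Y ⟶ Y)
    (hm : F.map m ≫ e = (F.map (fst Y Y) ≫ e) * (F.map (snd Y Y) ≫ e))
    (hu : F.map u ≫ e = 1) (hi : F.map i ≫ e = e⁻¹) : GrpObj Y :=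
  -- On `T`-points the candidate operations correspond to those of `G`. Each axiom thus holds after
  -- applying `F`, and `hF` brings it back.
  have hmul : ∀ {T : C} (x y : T ⟶ Y),
      F.map (lift x y ≫ m) ≫ e = (F.map x ≫ e) * (F.map y ≫ e) := by
    intro T x y
    rw [F.map_comp, Category.assoc, hm, comp_mul, ← Functor.map_comp_assoc, lift_fst,
      ← Functor.map_comp_assoc, lift_snd]
  have hone : ∀ {T : C}, F.map (toUnit T ≫ u) ≫ e = 1 := by
    intro T
    rw [F.map_comp, Category.assoc, hu, comp_one]
  have hinv : ∀ {T : C} (x : T ⟶ Y), F.map (x ≫ i) ≫ e = (F.map x ≫ e)⁻¹ := by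
    intro T x
    rw [F.map_comp, Category.assoc, hi, GrpObj.comp_inv]
  { one := u
    mul := m
    inv := i
    one_mul := hF _ (hP _ _ h₁ hY) _ _ (by
      have : u ▷ Y = lift (toUnit _ ≫ u) (snd _ _) := by
        ext
        · rw [whiskerRight_fst, lift_fst]
          congr 1
          exact toUnit_unique _ _
        · rw [whiskerRight_snd, lift_snd]
      rw [this, hmul, hone, _root_.one_mul, leftUnitor_hom])
    mul_one := hF _ (hP _ _ hY h₁) _ _ (by
      have : Y ◁ u = lift (fst _ _) (toUnit _ ≫ u) := by
        ext
        · rw [whiskerLeft_fst, lift_fst]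
        · rw [whiskerLeft_snd, lift_snd]
          congr 1
          exact toUnit_unique _ _
      rw [this, hmul, hone, _root_.mul_one, rightUnitor_hom])
    mul_assoc := hF _ (hP _ _ (hP _ _ hY hY) hY) _ _ (by
      have h₁ : m ▷ Y = lift (lift (fst _ _ ≫ fst _ _) (fst _ _ ≫ snd _ _) ≫ m) (snd _ _) := by
        ext
        · rw [whiskerRight_fst, lift_fst, ← comp_lift, lift_fst_snd, Category.comp_id]
        · rw [whiskerRight_snd, lift_snd]
      have h₂ : (α_ Y Y Y).hom ≫ Y ◁ m =
          lift (fst _ _ ≫ fst _ _) (lift (fst _ _ ≫ snd _ _) (snd _ _) ≫ m) := by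
        ext
        · rw [Category.assoc, whiskerLeft_fst, associator_hom_fst, lift_fst]
        · rw [Category.assoc, whiskerLeft_snd, lift_snd, ← Category.assoc]
          congr 1
          ext
          · rw [Category.assoc, associator_hom_snd_fst, lift_fst]
          · rw [Category.assoc, associator_hom_snd_snd, lift_snd]
      rw [h₁, reassoc_of% h₂, hmul, hmul, hmul, hmul, _root_.mul_assoc])
    left_inv := hF _ hY _ _ (by
      have := hinv (𝟙 Y)
      rw [Category.id_comp] at this
      rw [hmul, hone, this, inv_mul_cancel])
    right_inv := hF _ hY _ _ (by
      have := hinv (𝟙 Y)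
      rw [Category.id_comp] at this
      rw [hmul, hone, this, mul_inv_cancel]) }

/-- A group object whose image under a monoidal functor is a given group object. -/
lemma CategoryTheory.Grp.exists_mapGrp_iso (F : C ⥤ D) [F.Monoidal] {Y : C} (G : Grp D)
    (e : F.obj Y ≅ G.X) (P : ObjectProperty C) (h₁ : P (𝟙_ C)) (hY : P Y)
    (hP : ∀ T T', P T → P T' → P (T ⊗ T'))
    (hF : ∀ (T : C), P T → ∀ x y : T ⟶ Y, F.map x ≫ e.hom = F.map y ≫ e.hom → x = y)
    (m : Y ⊗ Y ⟶ Y) (u : 𝟙_ C ⟶ Y) (i : Y ⟶ Y)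
    (hm : F.map m ≫ e.hom = (F.map (fst Y Y) ≫ e.hom) * (F.map (snd Y Y) ≫ e.hom))
    (hu : F.map u ≫ e.hom = 1) (hi : F.map i ≫ e.hom = e.hom⁻¹) :
    ∃ H : Grp C, H.X = Y ∧ Nonempty (F.mapGrp.obj H ≅ G) := by
  let inst : GrpObj Y := .ofFunctor F e.hom P h₁ hY hP hF m u i hm hu hi
  refine ⟨⟨Y⟩, rfl, ⟨Grp.mkIso e ?_ ?_⟩⟩
  · have h : (Functor.LaxMonoidal.ε F ≫ F.map u) ≫ e.hom = η[G.X] := by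
      rw [Category.assoc, hu, comp_one, one_eq_one]
    exact h
  · have h : (Functor.LaxMonoidal.μ F Y Y ≫ F.map m) ≫ e.hom = (e.hom ⊗ₘ e.hom) ≫ μ[G.X] := by
      rw [Category.assoc, hm, comp_mul, Functor.Monoidal.μ_fst_assoc,
        Functor.Monoidal.μ_snd_assoc, mul_eq_mul, comp_mul, tensorHom_fst, tensorHom_snd]
    exact h

end GrpObj

/-! ### Equality of morphisms on a scheme-theoretically dense part -/

namespace AlgebraicGeometry

/-- The equalizer of `f` and `g` is a closed subscheme through which `j` factors. Its ideal is
contained in the zero kernel of `j`, so it is all of `X`. -/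
lemma ext_of_isSchemeTheoreticallyDominant {W X Y Z : Scheme.{u}} {f g : X ⟶ Y} (s : Y ⟶ Z)
    [IsSeparated s] (h : f ≫ s = g ≫ s) (j : W ⟶ X) [IsSchemeTheoreticallyDominant j]
    (hj : j ≫ f = j ≫ g) : f = g := by
  let E := pullback (pullback.diagonal s) (pullback.lift f g h)
  obtain ⟨k, hk⟩ : ∃ k : E ⟶ X, k = pullback.snd _ _ := ⟨_, rfl⟩
  have : IsClosedImmersion k := hk ▸ inferInstance
  have hjk : ∃ l, l ≫ k = j := by
    refine ⟨pullback.lift (j ≫ f) j ?_, by rw [hk, pullback.lift_snd]⟩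
    apply pullback.hom_ext
    · rw [Category.assoc, Category.assoc, pullback.diagonal_fst, Category.assoc, pullback.lift_fst,
        Category.comp_id]
    · rw [Category.assoc, Category.assoc, pullback.diagonal_snd, Category.assoc, pullback.lift_snd,
        Category.comp_id, hj]
  obtain ⟨l, rfl⟩ := hjk
  have hker : k.ker = ⊥ := by
    rw [eq_bot_iff, ← Scheme.Hom.ker_eq_bot (l ≫ k)]
    exact l.le_ker_comp k
  have := IsClosedImmersion.isIso_iff_ker_eq_bot.mpr hker
  rw [← cancel_epi k]
  have hc := pullback.condition (f := pullback.diagonal s) (g := pullback.lift f g h)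
  rw [← hk] at hc
  have h₁ := congr($hc ≫ pullback.fst s s)
  have h₂ := congr($hc ≫ pullback.snd s s)
  rw [Category.assoc, Category.assoc, pullback.diagonal_fst, pullback.lift_fst,
    Category.comp_id] at h₁
  rw [Category.assoc, Category.assoc, pullback.diagonal_snd, pullback.lift_snd,
    Category.comp_id] at h₂
  rw [← h₁, ← h₂]

end AlgebraicGeometry

/-! ### Extending the group law to a model -/

namespace SpecModel

section Field

open MonoidalCategory CartesianMonoidalCategory MonObj

variable {K : Type u} [Field K] {B B' : Subalgebra ℤ K}

/-- The generic fibre of a model, as an object over the base field. -/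
lemma exists_pullback_iso {X : Over (Spec (.of K))} (M : SpecModel X.hom B) :
    ∃ e : (Over.pullback (specVal B)).obj (Over.mk M.hom) ≅ X,
      e.hom.left ≫ M.π = pullback.fst M.hom (specVal B) :=
  ⟨Over.isoMk M.isPullback.isoPullback.symm M.isPullback.isoPullback_inv_snd,
    M.isPullback.isoPullback_inv_fst⟩

lemma map_comp_left_π {X : Over (Spec (.of K))} (M : SpecModel X.hom B)
    (e : (Over.pullback (specVal B)).obj (Over.mk M.hom) ⟶ X)
    (he : e.left ≫ M.π = pullback.fst M.hom (specVal B)) {T : Over (Spec (.of B))}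
    (x : T ⟶ Over.mk M.hom) :
    ((Over.pullback (specVal B)).map x ≫ e).left ≫ M.π =
      pullback.fst T.hom (specVal B) ≫ x.left := by
  have h : ((Over.pullback (specVal B)).map x).left ≫ pullback.fst M.hom (specVal B) =
      pullback.fst T.hom (specVal B) ≫ x.left := pullback.lift_fst _ _ _
  rw [Over.comp_left, Category.assoc, he, h]

lemma over_hom_ext {X T : Over (Spec (.of K))} (M : SpecModel X.hom B) {x y : T ⟶ X}
    (h : x.left ≫ M.π = y.left ≫ M.π) : x = y :=
  Over.OverMorphism.ext (M.isPullback.hom_ext h ((Over.w x).trans (Over.w y).symm))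

/-- A group law on the generic fibre of a smooth separated model extends to the model if its
structure morphisms do. -/
lemma exists_grp_of_exists (A : Grp (Over (Spec (.of K)))) (M : SpecModel A.X.hom B)
    [Flat M.hom] [IsSeparated M.hom]
    (hm : ∃ m : Over.mk M.hom ⊗ Over.mk M.hom ⟶ Over.mk M.hom,
      ∀ q : (A.X ⊗ A.X).left ⟶ (Over.mk M.hom ⊗ Over.mk M.hom).left,
        q ≫ (fst (Over.mk M.hom) (Over.mk M.hom)).left = (fst A.X A.X).left ≫ M.π →
        q ≫ (snd (Over.mk M.hom) (Over.mk M.hom)).left = (snd A.X A.X).left ≫ M.π →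
        q ≫ m.left = μ[A.X].left ≫ M.π)
    (hu : ∃ u : 𝟙_ _ ⟶ Over.mk M.hom, specVal B ≫ u.left = η[A.X].left ≫ M.π)
    (hi : ∃ i : Over.mk M.hom ⟶ Over.mk M.hom, M.π ≫ i.left = ι[A.X].left ≫ M.π) :
    ∃ Y : Grp (Over (Spec (.of B))), Y.X = Over.mk M.hom ∧
      Nonempty ((Over.pullback (specVal B)).mapGrp.obj Y ≅ A) := by
  obtain ⟨e, he⟩ := M.exists_pullback_iso
  obtain ⟨m, hm⟩ := hm
  obtain ⟨u, hu⟩ := hu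
  obtain ⟨i, hi⟩ := hi
  -- Flat `B`-schemes form the class of test objects: they are stable under products, and their
  -- generic fibre is dense enough to detect equality of morphisms to the separated model.
  refine Grp.exists_mapGrp_iso (Over.pullback (specVal B)) A e (fun T ↦ Flat T.hom) ?_ ?_ ?_ ?_
    m u i ?_ ?_ ?_
  · exact inferInstanceAs (Flat (𝟙 (Spec (.of B))))
  · exact inferInstanceAs (Flat M.hom)
  · intro T T' (h : Flat T.hom) (h' : Flat T'.hom)
    exact inferInstanceAs (Flat (pullback.fst T.hom T'.hom ≫ T.hom))
  · intro T (hT : Flat T.hom) x y h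
    have h' := congr(Over.Hom.left $h ≫ M.π)
    rw [M.map_comp_left_π e.hom he, M.map_comp_left_π e.hom he] at h'
    exact Over.OverMorphism.ext (ext_of_isSchemeTheoreticallyDominant M.hom
      ((Over.w x).trans (Over.w y).symm) _ h')
  · apply M.over_hom_ext
    rw [M.map_comp_left_π e.hom he, Hom.mul_def, Over.comp_left, Category.assoc]
    obtain ⟨q, hq₁, hq₂⟩ : ∃ q : (A.X ⊗ A.X).left ⟶ (Over.mk M.hom ⊗ Over.mk M.hom).left,
        q ≫ (fst (Over.mk M.hom) (Over.mk M.hom)).left = (fst A.X A.X).left ≫ M.π ∧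
        q ≫ (snd (Over.mk M.hom) (Over.mk M.hom)).left = (snd A.X A.X).left ≫ M.π :=
      ⟨pullback.map _ _ _ _ M.π M.π (specVal B) M.isPullback.w.symm M.isPullback.w.symm,
        pullback.lift_fst _ _ _, pullback.lift_snd _ _ _⟩
    rw [← hm q hq₁ hq₂, ← Category.assoc]
    congr 1
    refine pullback.hom_ext (f := M.hom) (g := M.hom) ?_ ?_
    · refine (M.map_comp_left_π e.hom he (fst _ _)).symm.trans ?_
      refine .trans ?_ (Category.assoc _ _ _).symm
      refine .trans ?_ congr(_ ≫ $hq₁).symm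
      rw [← Over.comp_left_assoc, lift_fst]
    · refine (M.map_comp_left_π e.hom he (snd _ _)).symm.trans ?_
      refine .trans ?_ (Category.assoc _ _ _).symm
      refine .trans ?_ congr(_ ≫ $hq₂).symm
      rw [← Over.comp_left_assoc, lift_snd]
  · apply M.over_hom_ext
    rw [M.map_comp_left_π e.hom he, Hom.one_def, Over.comp_left, Category.assoc, ← hu,
      ← Category.assoc]
    congr 1
    exact (Category.comp_id _).symm.trans (pullback.condition (f := 𝟙 _) (g := specVal B))
  · apply M.over_hom_ext
    rw [M.map_comp_left_π e.hom he, Hom.inv_def, Over.comp_left, Category.assoc, ← hi,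
      reassoc_of% he]
    rfl

/-- The self-product of a model. -/
lemma exists_self_prod {X : Over (Spec (.of K))} (M : SpecModel X.hom B) :
    ∃ (P : SpecModel (X ⊗ X).hom B) (q₁ q₂ : P.left ⟶ M.left),
      IsPullback q₁ q₂ M.hom M.hom ∧ q₁ ≫ M.hom = P.hom ∧
      P.π ≫ q₁ = (fst X X).left ≫ M.π ∧ P.π ≫ q₂ = (snd X X).left ≫ M.π := by
  obtain ⟨P, e, h₁, h₂, h₃⟩ := M.exists_prod M (IsPullback.of_hasPullback X.hom X.hom) rfl
    (IsPullback.of_hasPullback M.hom M.hom) rfl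
  refine ⟨P, eqToHom e ≫ pullback.fst _ _, eqToHom e ≫ pullback.snd _ _,
    (IsPullback.of_hasPullback M.hom M.hom).of_iso (eqToIso e).symm (Iso.refl _) (Iso.refl _)
      (Iso.refl _) ?_ ?_ ?_ ?_, ?_, h₂, h₃⟩
  any_goals simp
  simpa using h₁

/-- Fibre products commute with base change. This lets the multiplication, defined on the product
model, descend along the same enlargement as the model itself. -/
lemma Hom.exists_self_prod {X : Over (Spec (.of K))} {M : SpecModel X.hom B}
    {M' : SpecModel X.hom B'} (a : Hom M' M) {P : SpecModel (X ⊗ X).hom B}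
    {P' : SpecModel (X ⊗ X).hom B'} {q₁ q₂ : P.left ⟶ M.left} {q₁' q₂' : P'.left ⟶ M'.left}
    (h : IsPullback q₁ q₂ M.hom M.hom) (hP : q₁ ≫ M.hom = P.hom)
    (h₁ : P.π ≫ q₁ = (fst X X).left ≫ M.π) (h₂ : P.π ≫ q₂ = (snd X X).left ≫ M.π)
    (h' : IsPullback q₁' q₂' M'.hom M'.hom) (hP' : q₁' ≫ M'.hom = P'.hom)
    (h₁' : P'.π ≫ q₁' = (fst X X).left ≫ M'.π) (h₂' : P'.π ≫ q₂' = (snd X X).left ≫ M'.π) :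
    Nonempty (Hom P' P) := by
  have hw : (q₁' ≫ a.map) ≫ M.hom = (q₂' ≫ a.map) ≫ M.hom := by
    rw [Category.assoc, Category.assoc, a.isPullback.w, reassoc_of% h'.w]
  obtain ⟨l, hl₁, hl₂⟩ : ∃ l, l ≫ q₁ = q₁' ≫ a.map ∧ l ≫ q₂ = q₂' ≫ a.map :=
    ⟨h.lift _ _ hw, h.lift_fst _ _ _, h.lift_snd _ _ _⟩
  have key : IsPullback l q₁' q₁ a.map := by
    have := h'.flip.paste_horiz a.isPullback
    rw [← a.isPullback.w] at this
    refine IsPullback.of_right (h₁₂ := q₂) (v₁₃ := M.hom) (h₂₂ := M.hom) ?_ hl₁ h.flip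
    rwa [hl₂]
  have hp := key.paste_vert a.isPullback
  rw [hP, hP'] at hp
  refine ⟨⟨a.le, l, hp, h.hom_ext ?_ ?_⟩⟩
  · rw [Category.assoc, hl₁, reassoc_of% h₁', a.π_map, h₁]
  · rw [Category.assoc, hl₂, reassoc_of% h₂', a.π_map, h₂]

/-- A group law on the generic fibre of a smooth separated model extends to the model over a
larger finitely generated subring. -/
lemma exists_grp (A : Grp (Over (Spec (.of K)))) (M : SpecModel A.X.hom B) (hB : B.FG)
    [Smooth M.hom] [QuasiCompact M.hom] [IsSeparated M.hom] :
    ∃ (B' : Subalgebra ℤ K) (_ : B'.FG) (M' : SpecModel A.X.hom B') (_ : Hom M' M)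
      (Y : Grp (Over (Spec (.of B')))), Y.X = Over.mk M'.hom ∧
      Nonempty ((Over.pullback (specVal B')).mapGrp.obj Y ≅ A) := by
  obtain ⟨P, q₁, q₂, h, hP, h₁, h₂⟩ := M.exists_self_prod
  have : Smooth P.hom := by
    rw [← hP]
    have : Smooth q₁ := MorphismProperty.of_isPullback h.flip inferInstance
    infer_instance
  have : QuasiCompact P.hom := by
    rw [← hP]
    have : QuasiCompact q₁ := MorphismProperty.of_isPullback h.flip inferInstance
    infer_instance
  -- The base is a model of the unit object, so the unit section descends in the same way as the
  -- other two operations.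
  let I (B : Subalgebra ℤ K) : SpecModel (𝟙_ (Over (Spec (.of K)))).hom B :=
    ⟨Spec (.of B), 𝟙 _, specVal B, by
      have h : IsPullback (specVal B) (𝟙 _) (𝟙 _) (specVal B) := IsPullback.of_vert_isIso ⟨by simp⟩
      exact h⟩
  have : Smooth (I B).hom := inferInstanceAs (Smooth (𝟙 _))
  have : QuasiCompact (I B).hom := inferInstanceAs (QuasiCompact (𝟙 _))
  obtain ⟨B₁, hB₁, H₁⟩ := exists_map (Over.w μ[A.X]) P M hB
  obtain ⟨B₂, hB₂, H₂⟩ := exists_map (Over.w η[A.X]) (I B) M hB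
  obtain ⟨B₃, hB₃, H₃⟩ := exists_map (Over.w ι[A.X]) M M hB
  obtain ⟨B', hB', hle, hle₁, hle₂, hle₃⟩ : ∃ B' : Subalgebra ℤ K, B'.FG ∧ B ≤ B' ∧ B₁ ≤ B' ∧
      B₂ ≤ B' ∧ B₃ ≤ B' :=
    ⟨B ⊔ B₁ ⊔ B₂ ⊔ B₃, ((hB.sup hB₁).sup hB₂).sup hB₃,
      le_sup_of_le_left (le_sup_of_le_left le_sup_left),
      le_sup_of_le_left (le_sup_of_le_left le_sup_right),
      le_sup_of_le_left le_sup_right, le_sup_right⟩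
  obtain ⟨M', ⟨a⟩⟩ : ∃ M' : SpecModel A.X.hom B', Nonempty (Hom M' M) :=
    ⟨M.baseChange hle, ⟨M.baseChangeHom hle⟩⟩
  have : Smooth M'.hom := a.smooth
  have : IsSeparated M'.hom := a.isSeparated
  obtain ⟨P', q₁', q₂', h', hP', h₁', h₂'⟩ := M'.exists_self_prod
  obtain ⟨b⟩ := a.exists_self_prod h hP h₁ h₂ h' hP' h₁' h₂'
  let c : Hom (I B') (I B) := ⟨hle, specIncl hle, by
      have h : IsPullback (specIncl hle) (𝟙 _) (𝟙 _) (specIncl hle) :=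
        IsPullback.of_vert_isIso ⟨by simp⟩
      exact h,
    specVal_specIncl hle⟩
  obtain ⟨m, hm, hm'⟩ := H₁ B' hle₁ P' M' b a
  obtain ⟨η', hu, hu'⟩ := H₂ B' hle₂ (I B') M' c a
  obtain ⟨i, hi, hi'⟩ := H₃ B' hle₃ M' M' a a
  obtain ⟨r, hr₁, hr₂⟩ : ∃ r : (Over.mk M'.hom ⊗ Over.mk M'.hom).left ⟶ P'.left,
      r ≫ q₁' = (fst (Over.mk M'.hom) (Over.mk M'.hom)).left ∧
      r ≫ q₂' = (snd (Over.mk M'.hom) (Over.mk M'.hom)).left :=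
    ⟨h'.isoPullback.inv, h'.isoPullback_inv_fst, h'.isoPullback_inv_snd⟩
  refine ⟨B', hB', M', a, exists_grp_of_exists A M' ⟨Over.homMk (r ≫ m) ?_, ?_⟩
    ⟨Over.homMk η' hu, hu'⟩ ⟨Over.homMk i hi, hi'⟩⟩
  · rw [Category.assoc]
    refine congr(r ≫ $hm).trans ?_
    rw [← hP', reassoc_of% hr₁]
    exact Over.w (fst (Over.mk M'.hom) (Over.mk M'.hom))
  · intro q hq₁ hq₂
    have : q ≫ r = P'.π := by
      apply h'.hom_ext
      · rw [Category.assoc, hr₁, hq₁, h₁']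
      · rw [Category.assoc, hr₂, hq₂, h₂']
    exact (Category.assoc _ _ _).symm.trans (congr($this ≫ m).trans hm')

end Field

end SpecModel

/-! ### Infinitesimal algebra of a local ring -/

section LocalAlgebra

/-- The universal first-order deformation of a point of an algebra. -/
lemma AlgHom.exists_trivSqZeroExt {K O : Type u} [Field K] [CommRing O] [Algebra K O]
    (ε : O →ₐ[K] K) :
    ∃ (V : Type u) (_ : AddCommGroup V) (_ : Module K V) (_ : Module Kᵐᵒᵖ V)
      (_ : IsCentralScalar K V) (D : O →ₐ[K] TrivSqZeroExt K V), (∀ f, (D f).fst = ε f) ∧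
        ∀ f, ε f = 0 → (D f).snd = 0 → f ∈ RingHom.ker ε ^ 2 := by
  let I : Ideal O := RingHom.ker ε
  let : Module Kᵐᵒᵖ I.Cotangent := Module.compHom _ ((RingHom.id K).fromOpposite mul_comm)
  have : IsCentralScalar K I.Cotangent := ⟨fun _ _ ↦ rfl⟩
  have hI (f : O) : f - algebraMap K O (ε f) ∈ I := by
    rw [RingHom.mem_ker, map_sub, AlgHom.commutes, Algebra.algebraMap_self_apply, sub_self]
  -- This is the universal derivation at the point: the class of `f - ε f` in the cotangent space.
  -- It vanishes on an `f` in `ker ε` exactly when `f` lies in the square of the ideal.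
  let d (f : O) : I.Cotangent := I.toCotangent ⟨_, hI f⟩
  have hd_alg (c : K) : d (algebraMap K O c) = 0 := by
    rw [Ideal.toCotangent_eq_zero]
    change algebraMap K O c - algebraMap K O (ε (algebraMap K O c)) ∈ I ^ 2
    rw [AlgHom.commutes, Algebra.algebraMap_self_apply, sub_self]
    exact zero_mem _
  have hd_add (f g : O) : d (f + g) = d f + d g := by
    rw [← map_add, Ideal.toCotangent_eq]
    change f + g - algebraMap K O (ε (f + g)) - (f - algebraMap K O (ε f) +
      (g - algebraMap K O (ε g))) ∈ I ^ 2
    rw [map_add, map_add]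
    convert zero_mem (I ^ 2)
    ring
  have hsmul (c : K) (x : I) : c • I.toCotangent x = algebraMap K O c • I.toCotangent x :=
    (algebraMap_smul O c _).symm
  have hd_mul (f g : O) : d (f * g) = ε f • d g + ε g • d f := by
    rw [hsmul, hsmul, ← map_smul, ← map_smul, ← map_add, Ideal.toCotangent_eq]
    change f * g - algebraMap K O (ε (f * g)) - (algebraMap K O (ε f) * (g - algebraMap K O (ε g)) +
      algebraMap K O (ε g) * (f - algebraMap K O (ε f))) ∈ I ^ 2
    rw [map_mul, map_mul, pow_two]
    convert Ideal.mul_mem_mul (hI f) (hI g) using 1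
    ring
  let D : O →ₐ[K] TrivSqZeroExt K I.Cotangent :=
    { toFun f := (ε f, d f)
      map_one' := by
        refine TrivSqZeroExt.ext (map_one ε) ?_
        change d 1 = 0
        rw [← map_one (algebraMap K O), hd_alg]
      map_zero' := by
        refine TrivSqZeroExt.ext (map_zero ε) ?_
        change d 0 = 0
        rw [← map_zero (algebraMap K O), hd_alg]
      map_add' f g := TrivSqZeroExt.ext (map_add ε f g) (hd_add f g)
      map_mul' f g := by
        refine TrivSqZeroExt.ext (map_mul ε f g) ?_
        change d (f * g) = ε f • d g + MulOpposite.op (ε g) • d f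
        rw [op_smul_eq_smul, hd_mul]
      commutes' c := TrivSqZeroExt.ext (ε.commutes c) (hd_alg c) }
  refine ⟨I.Cotangent, inferInstance, inferInstance, inferInstance, inferInstance, D,
    fun f ↦ rfl, fun f hf hf' ↦ ?_⟩
  replace hf' : d f = 0 := hf'
  rw [Ideal.toCotangent_eq_zero] at hf'
  replace hf' : f - algebraMap K O (ε f) ∈ I ^ 2 := hf'
  rwa [hf, map_zero, sub_zero] at hf'

/-- An endomorphism of a noetherian local ring acting on the cotangent space as an invertible
integer is injective. -/
lemma IsLocalRing.injective_of_sub_natCast_mul_mem {O : Type*} [CommRing O] [IsLocalRing O]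
    [IsNoetherianRing O] (φ : O →+* O) (n : ℕ) (hn : IsUnit (n : O))
    (h : ∀ f ∈ maximalIdeal O, φ f - n * f ∈ maximalIdeal O ^ 2) : Function.Injective φ := by
  set m := maximalIdeal O
  have hm (f : O) (hf : f ∈ m) : φ f ∈ m := by
    have := Ideal.pow_le_self two_ne_zero (h f hf)
    simpa using add_mem this (Ideal.mul_mem_left m (n : O) hf)
  -- On each graded piece of the maximal-adic filtration `φ` is multiplication by a power of the
  -- unit `n`. The kernel of `φ` therefore lies in every power of `m`, and Krull's intersection
  -- theorem finishes.
  have key : ∀ k : ℕ, ∀ f ∈ m ^ (k + 1), φ f - n ^ (k + 1) * f ∈ m ^ (k + 2) := by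
    intro k
    induction k with
    | zero => simpa using h
    | succ k ih =>
      intro f hf
      rw [pow_succ'] at hf
      refine Submodule.mul_induction_on hf (fun a ha b hb ↦ ?_) fun a b ha hb ↦ ?_
      · have hφb : φ b ∈ m ^ (k + 1) := by
          have := Ideal.pow_le_pow_right (Nat.le_succ (k + 1)) (ih b hb)
          simpa using add_mem this (Ideal.mul_mem_left _ ((n : O) ^ (k + 1)) hb)
        have h₁ := Ideal.mul_mem_mul (h a ha) hφb
        have h₂ := Ideal.mul_mem_left _ (n : O) (Ideal.mul_mem_mul ha (ih b hb))
        rw [← pow_add] at h₁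
        rw [← pow_succ'] at h₂
        have e₁ : 2 + (k + 1) = k + 1 + 2 := by ring
        have e₂ : k + 2 + 1 = k + 1 + 2 := by ring
        rw [e₁] at h₁
        rw [e₂] at h₂
        convert add_mem h₁ h₂ using 1
        rw [map_mul]
        ring
      · convert add_mem ha hb using 1
        rw [map_add]
        ring
  rw [injective_iff_map_eq_zero]
  intro f hf
  have hfm : f ∈ m := by
    rw [mem_maximalIdeal, mem_nonunits_iff]
    intro hu
    have := hu.map φ
    rw [hf] at this
    exact not_isUnit_zero this
  have hk : ∀ k : ℕ, f ∈ m ^ (k + 1) := by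
    intro k
    induction k with
    | zero => simpa using hfm
    | succ k ih =>
      have := key k f ih
      rw [hf, zero_sub, neg_mem_iff] at this
      exact (Ideal.unit_mul_mem_iff_mem _ (hn.pow _)).mp this
  have : f ∈ ⨅ k : ℕ, m ^ k := by
    rw [Ideal.mem_iInf]
    intro k
    exact Ideal.pow_le_pow_right (Nat.le_succ k) (hk k)
  rwa [Ideal.iInf_pow_eq_bot_of_isLocalRing m Ideal.IsPrime.ne_top'] at this

end LocalAlgebra

/-! ### Tangent vectors of group schemes -/

section TrivSqZeroExt

variable {K V W W' : Type u} [Field K] [AddCommGroup V] [Module K V] [Module Kᵐᵒᵖ V]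
  [IsCentralScalar K V] [AddCommGroup W] [Module K W] [Module Kᵐᵒᵖ W]
  [IsCentralScalar K W] [AddCommGroup W'] [Module K W'] [Module Kᵐᵒᵖ W'] [IsCentralScalar K W']

instance TrivSqZeroExt.isLocalRing : IsLocalRing (TrivSqZeroExt K V) where
  exists_pair_ne := ⟨0, 1, fun h ↦ zero_ne_one congr(TrivSqZeroExt.fst $h)⟩
  isUnit_or_isUnit_of_add_one {a b} h := by
    rw [TrivSqZeroExt.isUnit_iff_isUnit_fst, TrivSqZeroExt.isUnit_iff_isUnit_fst]
    refine IsLocalRing.isUnit_or_isUnit_of_add_one ?_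
    rw [← TrivSqZeroExt.fst_add, h, TrivSqZeroExt.fst_one]

instance TrivSqZeroExt.isLocalHom_map (g : V →ₗ[K] W) :
    IsLocalHom (TrivSqZeroExt.map g).toRingHom := by
  refine ⟨fun a ha ↦ ?_⟩
  rw [TrivSqZeroExt.isUnit_iff_isUnit_fst] at ha ⊢
  rwa [AlgHom.toRingHom_eq_coe, RingHom.coe_coe, TrivSqZeroExt.fst_map] at ha

variable (K V) in
/-- The spectrum of a trivial square-zero extension of a field. -/
noncomputable def trivSqZeroSpec : Over (Spec (.of K)) :=
  Over.mk (Spec.map (CommRingCat.ofHom (algebraMap K (TrivSqZeroExt K V))))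

/-- The functoriality of spectra of trivial square-zero extensions. -/
noncomputable def trivSqZeroSpecMap (g : V →ₗ[K] W) : trivSqZeroSpec K W ⟶ trivSqZeroSpec K V :=
  Over.homMk (Spec.map (CommRingCat.ofHom (TrivSqZeroExt.map g).toRingHom)) (by
    refine (Spec.map_comp _ _).symm.trans ?_
    congr 1
    refine CommRingCat.hom_ext (RingHom.ext fun x ↦ ?_)
    exact (TrivSqZeroExt.map g).commutes x)

lemma trivSqZeroSpecMap_comp (g : V →ₗ[K] W) (g' : W →ₗ[K] W') :
    trivSqZeroSpecMap g' ≫ trivSqZeroSpecMap g = trivSqZeroSpecMap (g' ∘ₗ g) := by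
  apply Over.OverMorphism.ext
  refine (Spec.map_comp _ _).symm.trans ?_
  change Spec.map _ = Spec.map _
  congr 1
  refine CommRingCat.hom_ext (RingHom.ext fun x ↦ ?_)
  exact congr($(TrivSqZeroExt.map_comp_map g g') x).symm

lemma trivSqZeroSpecMap_id :
    trivSqZeroSpecMap (LinearMap.id : V →ₗ[K] V) = 𝟙 _ := by
  apply Over.OverMorphism.ext
  refine .trans ?_ (Spec.map_id _)
  change Spec.map _ = Spec.map _
  congr 1
  refine CommRingCat.hom_ext (RingHom.ext fun x ↦ ?_)
  exact congr($TrivSqZeroExt.map_id x)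

/-- The ring `K[V × W]` embeds in `K[V] × K[W]`. This is what ties the group law to the addition of
tangent vectors. -/
lemma trivSqZeroSpec_prod_hom_ext {X : Over (Spec (.of K))} {x y : trivSqZeroSpec K (V × W) ⟶ X}
    (h₁ : trivSqZeroSpecMap (.fst K V W) ≫ x = trivSqZeroSpecMap (.fst K V W) ≫ y)
    (h₂ : trivSqZeroSpecMap (.snd K V W) ≫ x = trivSqZeroSpecMap (.snd K V W) ≫ y) : x = y := by
  apply Over.OverMorphism.ext
  have key : ∀ a b : Spec (.of (TrivSqZeroExt K (V × W))) ⟶ X.left,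
      Spec.map (CommRingCat.ofHom (TrivSqZeroExt.map (.fst K V W)).toRingHom) ≫ a =
        Spec.map (CommRingCat.ofHom (TrivSqZeroExt.map (.fst K V W)).toRingHom) ≫ b →
      Spec.map (CommRingCat.ofHom (TrivSqZeroExt.map (.snd K V W)).toRingHom) ≫ a =
        Spec.map (CommRingCat.ofHom (TrivSqZeroExt.map (.snd K V W)).toRingHom) ≫ b → a = b := by
    intro a b h₁ h₂
    have hab : a (IsLocalRing.closedPoint _) = b (IsLocalRing.closedPoint _) := by
      have := congr($h₁ (IsLocalRing.closedPoint _))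
      rwa [comp_closedPoint, comp_closedPoint] at this
    obtain ⟨p, α, hp, -, rfl⟩ := exists_stalk_hom_of_isLocalRing a
    obtain ⟨q, β, hq, -, rfl⟩ := exists_stalk_hom_of_isLocalRing b
    obtain rfl : p = q := by rw [← hp, ← hq, hab]
    rw [← Spec.map_comp_assoc, ← Spec.map_comp_assoc, cancel_mono, Spec.map_inj] at h₁ h₂
    congr 3
    refine RingHom.ext fun f ↦ ?_
    have h₁' := congr(TrivSqZeroExt.snd (CommRingCat.Hom.hom $h₁ f))
    have h₂' := congr(TrivSqZeroExt.snd (CommRingCat.Hom.hom $h₂ f))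
    have h₃' := congr(TrivSqZeroExt.fst (CommRingCat.Hom.hom $h₁ f))
    change TrivSqZeroExt.snd (TrivSqZeroExt.map _ _) = TrivSqZeroExt.snd (TrivSqZeroExt.map _ _)
      at h₁' h₂'
    change TrivSqZeroExt.fst (TrivSqZeroExt.map _ _) = TrivSqZeroExt.fst (TrivSqZeroExt.map _ _)
      at h₃'
    rw [TrivSqZeroExt.snd_map, TrivSqZeroExt.snd_map] at h₁' h₂'
    rw [TrivSqZeroExt.fst_map, TrivSqZeroExt.fst_map] at h₃'
    exact TrivSqZeroExt.ext h₃' (Prod.ext h₁' h₂')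
  exact key _ _ congr(Over.Hom.left $h₁) congr(Over.Hom.left $h₂)

open MonObj in
/-- The `n`-th power of a tangent vector at the origin of a group scheme is its `n`-th multiple. -/
lemma trivSqZeroSpec_pow_eq {G : Over (Spec (.of K))} [GrpObj G] (x : trivSqZeroSpec K V ⟶ G)
    (hx : trivSqZeroSpecMap (0 : V →ₗ[K] V) ≫ x = 1) (n : ℕ) :
    x ^ n = trivSqZeroSpecMap ((n : K) • (LinearMap.id : V →ₗ[K] V)) ≫ x := by
  have hx' {W : Type u} [AddCommGroup W] [Module K W] [Module Kᵐᵒᵖ W] [IsCentralScalar K W] :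
      trivSqZeroSpecMap (0 : V →ₗ[K] W) ≫ x = 1 := by
    have := trivSqZeroSpecMap_comp (0 : V →ₗ[K] V) (0 : V →ₗ[K] W)
    rw [LinearMap.comp_zero] at this
    rw [← this, Category.assoc, hx, comp_one]
  induction n with
  | zero => rw [pow_zero, Nat.cast_zero, zero_smul, hx]
  | succ n ih =>
    -- Both sides agree on the two axes of `K[V × V]`. Restricting to the diagonal, which is dual to
    -- the sum map `V × V → V`, then gives `(n + 1) • x = x * (n • x)`.
    have key : trivSqZeroSpecMap (.inl K V V + (n : K) • .inr K V V) ≫ x =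
        (trivSqZeroSpecMap (.inl K V V) ≫ x) *
          (trivSqZeroSpecMap ((n : K) • .inr K V V) ≫ x) := by
      apply trivSqZeroSpec_prod_hom_ext
      · have e₁ : LinearMap.fst K V V ∘ₗ (.inl K V V + (n : K) • .inr K V V) = .id := by
          ext; simp
        have e₂ : LinearMap.fst K V V ∘ₗ .inl K V V = .id := by ext; simp
        have e₃ : LinearMap.fst K V V ∘ₗ ((n : K) • .inr K V V) = 0 := by ext; simp
        rw [comp_mul, ← Category.assoc, ← Category.assoc, ← Category.assoc, trivSqZeroSpecMap_comp,
          trivSqZeroSpecMap_comp, trivSqZeroSpecMap_comp, e₁, e₂, e₃, hx', _root_.mul_one]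
      · have e₁ : LinearMap.snd K V V ∘ₗ (.inl K V V + (n : K) • .inr K V V) = (n : K) • .id := by
          ext; simp
        have e₂ : LinearMap.snd K V V ∘ₗ .inl K V V = 0 := by ext; simp
        have e₃ : LinearMap.snd K V V ∘ₗ ((n : K) • .inr K V V) = (n : K) • .id := by ext; simp
        rw [comp_mul, ← Category.assoc, ← Category.assoc, ← Category.assoc, trivSqZeroSpecMap_comp,
          trivSqZeroSpecMap_comp, trivSqZeroSpecMap_comp, e₁, e₂, e₃, hx', _root_.one_mul]
    have := congr(trivSqZeroSpecMap (.coprod .id .id) ≫ $key)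
    have e₁ : LinearMap.coprod .id .id ∘ₗ (.inl K V V + (n : K) • .inr K V V) =
        ((n + 1 : ℕ) : K) • .id := by
      ext; simp [add_smul, add_comm]
    have e₂ : LinearMap.coprod .id .id ∘ₗ .inl K V V = .id := by ext; simp
    have e₃ : LinearMap.coprod .id .id ∘ₗ ((n : K) • .inr K V V) = (n : K) • .id := by ext; simp
    rw [comp_mul, ← Category.assoc, ← Category.assoc, ← Category.assoc, trivSqZeroSpecMap_comp,
      trivSqZeroSpecMap_comp, trivSqZeroSpecMap_comp, e₁, e₂, e₃, trivSqZeroSpecMap_id,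
      Category.id_comp, ← ih, ← _root_.pow_succ'] at this
    exact this.symm

end TrivSqZeroExt

/-! ### Dominance of multiplication by `n` -/

section Pow

open MonoidalCategory CartesianMonoidalCategory MonObj

lemma isDominant_fromSpecStalk (X : Scheme.{u}) [IsIntegral X] (x : X) :
    IsDominant (X.fromSpecStalk x) := by
  refine ⟨?_⟩
  rw [DenseRange, dense_iff_closure_eq, Set.eq_univ_iff_forall]
  intro z
  have h : genericPoint X ∈ Set.range (X.fromSpecStalk x) := by
    rw [Scheme.range_fromSpecStalk]
    exact genericPoint_specializes x
  exact closure_mono (Set.singleton_subset_iff.mpr h)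
    ((genericPoint_specializes z).mem_closure)

variable {K : Type u} [Field K]

/-- In characteristic zero, multiplication by a positive integer is injective on the local ring at
the origin of a group scheme. -/
lemma injective_of_specMap_comp_eq_pow [CharZero K] {G : Over (Spec (.of K))} [GrpObj G] {O : Type u}
    [CommRing O] [IsLocalRing O] [IsNoetherianRing O] (j : Spec (.of O) ⟶ G.left) [Mono j]
    (ψ : O →+* K) [IsLocalHom ψ] (hψe : Spec.map (CommRingCat.ofHom ψ) ≫ j = η[G].left)
    {n : ℕ} (hn : n ≠ 0) (φ : O →+* O)
    (hφN : Spec.map (CommRingCat.ofHom φ) ≫ j = j ≫ (𝟙 G ^ n : G ⟶ G).left) :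
    Function.Injective φ := by
  obtain ⟨N, hN⟩ : ∃ N : G.left ⟶ G.left, N = (𝟙 G ^ n : G ⟶ G).left := ⟨_, rfl⟩
  rw [← hN] at hφN
  obtain ⟨e, he⟩ : ∃ e : Spec (.of K) ⟶ G.left, e = η[G].left := ⟨_, rfl⟩
  rw [← he] at hψe
  have heG : e ≫ G.hom = 𝟙 _ := he ▸ Over.w η[G]
  obtain ⟨κ, hκ⟩ := Spec.map_surjective (R := .of K) (S := .of O) (j ≫ G.hom)
  let : Algebra K O := κ.hom.toAlgebra
  have hκψ : κ ≫ CommRingCat.ofHom ψ = 𝟙 _ := by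
    apply Spec.map_injective
    rw [Spec.map_comp, hκ, reassoc_of% hψe, heG, Spec.map_id]
  let ε : O →ₐ[K] K := { ψ with commutes' c := congr(CommRingCat.Hom.hom $hκψ c) }
  obtain ⟨V, _, _, _, _, D, hD, hD'⟩ := ε.exists_trivSqZeroExt
  have hDG : (Spec.map (CommRingCat.ofHom D.toRingHom) ≫ j) ≫ G.hom =
      (trivSqZeroSpec K V).hom := by
    rw [Category.assoc]
    refine congr(_ ≫ $hκ).symm.trans ((Spec.map_comp _ _).symm.trans ?_)
    change Spec.map _ = Spec.map _
    congr 1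
    exact CommRingCat.hom_ext (RingHom.ext fun c ↦ D.commutes c)
  -- This is the universal tangent vector at the origin. Computing its image under `[n]` in two ways
  -- compares `D ∘ φ` with the scalar `n` acting on `D`.
  let x : trivSqZeroSpec K V ⟶ G := Over.homMk _ hDG
  have hx : trivSqZeroSpecMap (0 : V →ₗ[K] V) ≫ x = 1 := by
    apply Over.OverMorphism.ext
    have h : Spec.map (CommRingCat.ofHom (TrivSqZeroExt.map (0 : V →ₗ[K] V)).toRingHom) ≫
        Spec.map (CommRingCat.ofHom D.toRingHom) ≫ j =
        Spec.map (CommRingCat.ofHom (algebraMap K (TrivSqZeroExt K V))) ≫ e := by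
      rw [← hψe, ← Spec.map_comp_assoc, ← Spec.map_comp_assoc]
      congr 2
      refine CommRingCat.hom_ext (RingHom.ext fun f ↦ TrivSqZeroExt.ext ?_ ?_)
      · exact (TrivSqZeroExt.fst_map _ _).trans (hD f)
      · exact TrivSqZeroExt.snd_map _ _
    rw [he] at h
    exact h
  have hpow : x ≫ 𝟙 G ^ n = trivSqZeroSpecMap ((n : K) • LinearMap.id) ≫ x := by
    rw [comp_pow, Category.comp_id]
    exact trivSqZeroSpec_pow_eq x hx n
  have hDφ : (D.toRingHom : O →+* _).comp φ =
      (TrivSqZeroExt.map ((n : K) • (LinearMap.id : V →ₗ[K] V))).toRingHom.comp D.toRingHom := by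
    have h : (Spec.map (CommRingCat.ofHom D.toRingHom) ≫ j) ≫ N =
        Spec.map (CommRingCat.ofHom
          (TrivSqZeroExt.map ((n : K) • (LinearMap.id : V →ₗ[K] V))).toRingHom) ≫
        Spec.map (CommRingCat.ofHom D.toRingHom) ≫ j := by
      rw [hN]
      exact congr(Over.Hom.left $hpow)
    rw [Category.assoc, ← hφN, ← Spec.map_comp_assoc, ← Spec.map_comp_assoc, cancel_mono,
      Spec.map_inj] at h
    exact congr(CommRingCat.Hom.hom $h)
  have hm : IsLocalRing.maximalIdeal O = RingHom.ker ε := by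
    ext f
    rw [IsLocalRing.mem_maximalIdeal, mem_nonunits_iff, RingHom.mem_ker]
    have h₁ : IsUnit (ψ f) ↔ IsUnit f := isUnit_map_iff ψ f
    rw [isUnit_iff_ne_zero] at h₁
    exact not_iff_comm.mp h₁
  refine IsLocalRing.injective_of_sub_natCast_mul_mem (O := O) φ n ?_ ?_
  · have : IsUnit (algebraMap K O n) := (Nat.cast_ne_zero.mpr hn).isUnit.map _
    rwa [map_natCast] at this
  · intro f hf
    rw [hm] at hf ⊢
    have hDf : D (φ f) = TrivSqZeroExt.map ((n : K) • (LinearMap.id : V →ₗ[K] V)) (D f) :=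
      congr($hDφ f)
    have hf' : ε f = 0 := hf
    apply hD'
    · rw [← hD, map_sub, hDf, TrivSqZeroExt.fst_sub, TrivSqZeroExt.fst_map, map_mul, map_natCast,
        TrivSqZeroExt.fst_mul, hD, hf', mul_zero, sub_zero]
    · rw [map_sub, hDf, TrivSqZeroExt.snd_sub, TrivSqZeroExt.snd_map, map_mul, map_natCast,
        TrivSqZeroExt.snd_mul, hD, hf', TrivSqZeroExt.fst_natCast, TrivSqZeroExt.snd_natCast]
      simp

/-- Multiplication by a positive integer is dominant on an integral group scheme of finite type
over a field of characteristic zero. -/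
lemma isDominant_pow_left [CharZero K] (G : Over (Spec (.of K))) [GrpObj G] [IsIntegral G.left]
    [LocallyOfFiniteType G.hom] {n : ℕ} (hn : n ≠ 0) : IsDominant (𝟙 G ^ n : G ⟶ G).left := by
  have : IsLocallyNoetherian G.left := by
    have : IsLocallyNoetherian (Spec (.of K)) := inferInstance
    exact LocallyOfFiniteType.isLocallyNoetherian G.hom
  have heN : η[G].left ≫ (𝟙 G ^ n : G ⟶ G).left = η[G].left := by
    have : η[G] ≫ 𝟙 G ^ n = η[G] := by
      rw [comp_pow, Category.comp_id, one_eq_one, one_pow]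
    exact congr(Over.Hom.left $this)
  -- The local ring at the origin, with the endomorphism induced by `N` fixing the origin, is
  -- packaged as an abstract ring `O`.
  have key : ∀ (X : Scheme.{u}) [IsIntegral X] [IsLocallyNoetherian X] (e : Spec (.of K) ⟶ X)
      (N : X ⟶ X) (_ : e ≫ N = e), ∃ (O : Type u) (_ : CommRing O) (_ : IsLocalRing O)
      (_ : IsNoetherianRing O) (j : Spec (.of O) ⟶ X) (ψ : O →+* K) (φ : O →+* O),
      Mono j ∧ IsDominant j ∧ IsLocalHom ψ ∧ Spec.map (CommRingCat.ofHom ψ) ≫ j = e ∧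
      Spec.map (CommRingCat.ofHom φ) ≫ j = j ≫ N := by
    intro X _ _ e N he
    obtain ⟨y, ψ, hy, hψ, hψe⟩ := exists_stalk_hom_of_isLocalRing e
    obtain ⟨y', φ, hy', hφN⟩ : ∃ (y' : X)
        (φ : X.presheaf.stalk y' →+* X.presheaf.stalk y), N y = y' ∧
        Spec.map (CommRingCat.ofHom φ) ≫ X.fromSpecStalk y' = X.fromSpecStalk y ≫ N :=
      ⟨_, (N.stalkMap y).hom, rfl, Scheme.SpecMap_stalkMap_fromSpecStalk _⟩
    obtain rfl : y' = y := by
      rw [← hy', ← hy]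
      exact (Scheme.Hom.comp_apply _ _ _).symm.trans congr($he (IsLocalRing.closedPoint K))
    exact ⟨X.presheaf.stalk y', inferInstance, inferInstance, inferInstance, X.fromSpecStalk y',
      ψ, φ, inferInstance, isDominant_fromSpecStalk X y', hψ, hψe, hφN⟩
  obtain ⟨O, _, _, _, j, ψ, φ, _, _, _, hψe, hφN⟩ := key _ _ _ heN
  -- Injectivity on the local ring makes `[n]` dominant on `Spec O`, which is itself dense in the
  -- integral scheme `G`.
  have := isDominant_specMap φ (injective_of_specMap_comp_eq_pow j ψ hψe hn φ hφN)
  have : IsDominant (j ≫ (𝟙 G ^ n : G ⟶ G).left) := by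
    rw [← hφN]
    exact inferInstance
  exact IsDominant.of_comp j _

end Pow

/-! ### Components of divisible groups -/

section Topology

lemma TopologicalSpace.NoetherianSpace.finite_connectedComponents (X : Type*) [TopologicalSpace X]
    [TopologicalSpace.NoetherianSpace X] : Finite (ConnectedComponents X) := by
  have := (TopologicalSpace.NoetherianSpace.finite_irreducibleComponents (α := X)).to_subtype
  let F (Z : irreducibleComponents X) : ConnectedComponents X :=
    .mk (Set.Nonempty.some (Z.2.1.nonempty))
  refine Finite.of_surjective F fun c ↦ ?_
  obtain ⟨x, rfl⟩ := ConnectedComponents.surjective_coe c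
  let Z : irreducibleComponents X :=
    ⟨irreducibleComponent x, irreducibleComponent_mem_irreducibleComponents x⟩
  refine ⟨Z, ConnectedComponents.coe_eq_coe'.mpr ?_⟩
  exact (isIrreducible_irreducibleComponent (x := x)).isConnected.isPreconnected.subset_connectedComponent
    mem_irreducibleComponent (Set.Nonempty.some_mem Z.2.1.nonempty)

/-- A Jacobson space with finitely many connected components, whose closed points come from a
group acting compatibly by translations, is connected if it is divisible. -/
lemma connectedSpace_of_group {X Γ : Type*} [TopologicalSpace X] [JacobsonSpace X]
    [Finite (ConnectedComponents X)] [Group Γ] (p : Γ → X) (hp : closedPoints X ⊆ Set.range p)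
    (hτ : ∀ g : Γ, ∃ τ : X → X, Continuous τ ∧ ∀ x, τ (p x) = p (x * g))
    (hN : ∀ n : ℕ, n ≠ 0 → ∃ N : X → X, Continuous N ∧ N.Surjective ∧ ∀ x, N (p x) = p (x ^ n)) :
    ConnectedSpace X := by
  let c (x : Γ) : ConnectedComponents X := .mk (p x)
  have hc {x y : Γ} (g : Γ) (h : c x = c y) : c (x * g) = c (y * g) := by
    obtain ⟨τ, hτ, hτp⟩ := hτ g
    have h' : p x ∈ connectedComponent (p y) := ConnectedComponents.coe_eq_coe'.mp h
    refine ConnectedComponents.coe_eq_coe'.mpr ?_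
    rw [← hτp, ← hτp]
    exact hτ.image_connectedComponent_subset _ ⟨_, h', rfl⟩
  have hpow {x : Γ} (h : c x = c 1) (m : ℕ) : c (x ^ m) = c 1 := by
    induction m with
    | zero => rw [pow_zero]
    | succ m ih => rw [pow_succ, hc x ih, one_mul, h]
  have := Fintype.ofFinite (ConnectedComponents X)
  let n := Fintype.card (ConnectedComponents X)
  -- Among the powers with exponents `0, …, n`, two lie in the same one of the `n` components. Their
  -- exponents differ by some `d ≤ n`, which divides `n!`, and `x ^ d` lies in the component of `p
  -- 1`.
  have hfac (x : Γ) : c (x ^ n.factorial) = c 1 := by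
    obtain ⟨i, j, hij, h⟩ := Fintype.exists_ne_map_eq_of_card_lt
      (fun i : Fin (n + 1) ↦ c (x ^ (i : ℕ))) (by simp [n])
    wlog hlt : i < j generalizing i j
    · exact this j i hij.symm h.symm (lt_of_le_of_ne (not_lt.mp hlt) hij.symm)
    have h₁ := hc ((x ^ (i : ℕ))⁻¹) h
    have hlt' : (i : ℕ) < j := hlt
    rw [mul_inv_cancel, ← pow_sub x hlt'.le] at h₁
    obtain ⟨m, hm⟩ : (j - i : ℕ) ∣ n.factorial :=
      Nat.dvd_factorial (Nat.sub_pos_of_lt hlt') ((Nat.sub_le _ _).trans (Nat.lt_succ_iff.mp j.2))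
    rw [hm, pow_mul]
    exact hpow h₁.symm m
  obtain ⟨N, hN, hN', hNp⟩ := hN n.factorial n.factorial_ne_zero
  refine connectedSpace_iff_connectedComponent.mpr ⟨p 1, ?_⟩
  rw [Set.eq_univ_iff_forall]
  by_contra! ⟨y, hy⟩
  obtain ⟨x, rfl⟩ := hN' y
  -- A nonempty open subset of a Jacobson space contains a closed point, which comes from `Γ`; its
  -- image under `N` lies in the component of `p 1` after all.
  obtain ⟨_, hz, hz'⟩ := nonempty_inter_closedPoints (Z := N ⁻¹' (connectedComponent (p 1))ᶜ) ⟨x, hy⟩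
    (isClosed_connectedComponent.isOpen_compl.preimage hN).isLocallyClosed
  obtain ⟨z, rfl⟩ := hp hz'
  rw [Set.mem_preimage, hNp] at hz
  exact hz (ConnectedComponents.coe_eq_coe'.mp (hfac z))

end Topology

/-! ### Geometric connectedness of the fibres -/

section GeometricallyConnected

open MonoidalCategory CartesianMonoidalCategory MonObj

/-- A group scheme of finite type over an algebraically closed field is connected if it is
divisible. -/
lemma connectedSpace_of_surjective_pow {K : Type u} [Field K] [IsAlgClosed K]
    (G : Over (Spec (.of K))) [GrpObj G] [LocallyOfFiniteType G.hom] [QuasiCompact G.hom]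
    (h : ∀ n : ℕ, n ≠ 0 → Surjective (𝟙 G ^ n : G ⟶ G).left) : ConnectedSpace G.left := by
  have : JacobsonSpace G.left := LocallyOfFiniteType.jacobsonSpace (Y := Spec (.of K)) G.hom
  have : IsLocallyNoetherian (Spec (.of K)) := inferInstance
  have : IsLocallyNoetherian G.left := LocallyOfFiniteType.isLocallyNoetherian G.hom
  have : CompactSpace G.left := QuasiCompact.compactSpace_of_compactSpace G.hom
  have : IsNoetherian G.left := {}
  have := TopologicalSpace.NoetherianSpace.finite_connectedComponents G.left
  let pt : Spec (.of K) := IsLocalRing.closedPoint K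
  refine connectedSpace_of_group (Γ := 𝟙_ (Over (Spec (.of K))) ⟶ G) (fun x ↦ x.left pt) ?_ ?_ ?_
  · intro y hy
    refine ⟨Over.homMk (pointOfClosedPoint G.hom y hy) (pointOfClosedPoint_comp G.hom y hy), ?_⟩
    exact pointOfClosedPoint_apply G.hom y hy pt
  · intro g
    refine ⟨(𝟙 G * (toUnit G ≫ g) : G ⟶ G).left, Scheme.Hom.continuous _, fun x ↦ ?_⟩
    have : x ≫ (𝟙 G * (toUnit G ≫ g)) = x * g := by
      rw [comp_mul, Category.comp_id, ← Category.assoc, toUnit_unique (x ≫ toUnit G) (𝟙 _),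
        Category.id_comp]
    rw [← this]
    exact (Scheme.Hom.comp_apply _ _ _).symm
  · intro n hn
    refine ⟨(𝟙 G ^ n : G ⟶ G).left, Scheme.Hom.continuous _, (h n hn).surj, fun x ↦ ?_⟩
    have : x ≫ 𝟙 G ^ n = x ^ n := by rw [comp_pow, Category.comp_id]
    rw [← this]
    exact (Scheme.Hom.comp_apply _ _ _).symm

lemma isPullback_overPullback_map {S T : Scheme.{u}} (g : T ⟶ S) {X Y : Over S} (h : X ⟶ Y) :
    IsPullback (pullback.fst X.hom g) ((Over.pullback g).map h).left h.left
      (pullback.fst Y.hom g) := by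
  have h₁ : ((Over.pullback g).map h).left ≫ pullback.snd Y.hom g = pullback.snd X.hom g :=
    Over.w ((Over.pullback g).map h)
  have h₂ : pullback.fst X.hom g ≫ h.left =
      ((Over.pullback g).map h).left ≫ pullback.fst Y.hom g := (pullback.lift_fst _ _ _).symm
  have key : IsPullback (pullback.fst X.hom g)
      (((Over.pullback g).map h).left ≫ pullback.snd Y.hom g) (h.left ≫ Y.hom) g := by
    rw [h₁, Over.w]
    exact IsPullback.of_hasPullback X.hom g
  exact IsPullback.of_bot key h₂ (IsPullback.of_hasPullback Y.hom g)

lemma overPullback_map_pow {S T : Scheme.{u}} (g : T ⟶ S) (G : Grp (Over S)) (n : ℕ) :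
    (𝟙 ((Over.pullback g).mapGrp.obj G).X ^ n : _ ⟶ ((Over.pullback g).mapGrp.obj G).X) =
      (Over.pullback g).map (𝟙 G.X ^ n) := by
  let : MonObj ((Over.pullback g).obj G.X) := ((Over.pullback g).mapGrp.obj G).grp.toMonObj
  have h := map_pow (Functor.homMonoidHom (Over.pullback g) (X := G.X) (M := G.X)) (𝟙 G.X) n
  have h₁ : Functor.homMonoidHom (Over.pullback g) (X := G.X) (M := G.X) (𝟙 G.X) =
    𝟙 ((Over.pullback g).obj G.X) := (Over.pullback g).map_id _
  rw [h₁] at h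
  exact h.symm

/-- A group scheme of finite type is geometrically connected over its base if it is divisible. -/
lemma geometricallyConnected_of_surjective_pow {S : Scheme.{u}} (G : Grp (Over S))
    [LocallyOfFiniteType G.X.hom] [QuasiCompact G.X.hom]
    (h : ∀ n : ℕ, n ≠ 0 → Surjective (𝟙 G.X ^ n : G.X ⟶ G.X).left) :
    GeometricallyConnected G.X.hom := by
  refine ⟨geometrically_iff_of_isClosedUnderIsomorphisms.mpr fun K _ y ↦ ?_⟩
  -- The fibre over an algebraic closure surjects onto the fibre over `K`, so it suffices to treat
  -- the former, where closed points are rational.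
  let a : Spec (.of (AlgebraicClosure K)) ⟶ Spec (.of K) :=
    Spec.map (CommRingCat.ofHom (algebraMap K (AlgebraicClosure K)))
  obtain ⟨g, hg⟩ : ∃ g, g = a ≫ y := ⟨_, rfl⟩
  have hc : ConnectedSpace ((Over.pullback g).mapGrp.obj G).X.left := by
    have : LocallyOfFiniteType ((Over.pullback g).mapGrp.obj G).X.hom :=
      inferInstanceAs (LocallyOfFiniteType (pullback.snd G.X.hom g))
    have : QuasiCompact ((Over.pullback g).mapGrp.obj G).X.hom :=
      inferInstanceAs (QuasiCompact (pullback.snd G.X.hom g))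
    refine connectedSpace_of_surjective_pow _ fun n hn ↦ ?_
    rw [overPullback_map_pow]
    have := h n hn
    exact MorphismProperty.of_isPullback (P := @Surjective) (isPullback_overPullback_map g _) this
  have hc' : ConnectedSpace (pullback G.X.hom g :) := hc
  obtain ⟨q, hq⟩ : ∃ q : pullback G.X.hom g ⟶ pullback G.X.hom y, Surjective q := by
    have key := IsPullback.of_hasPullback G.X.hom g
    rw [hg] at key ⊢
    have h₁ : pullback.fst G.X.hom (a ≫ y) ≫ G.X.hom = (pullback.snd G.X.hom (a ≫ y) ≫ a) ≫ y := by
      rw [pullback.condition, Category.assoc]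
    refine ⟨pullback.lift _ _ h₁, ?_⟩
    have h₂ : IsPullback (pullback.lift _ _ h₁) (pullback.snd G.X.hom (a ≫ y))
        (pullback.snd G.X.hom y) a := by
      refine IsPullback.of_right ?_ (pullback.lift_snd _ _ h₁) (IsPullback.of_hasPullback G.X.hom y)
      rwa [pullback.lift_fst]
    exact MorphismProperty.of_isPullback (P := @Surjective) h₂.flip inferInstance
  exact q.surjective.connectedSpace q.continuous

variable {K : Type u} [Field K] [CharZero K]

/-- A proper flat group scheme over a subring of a field of characteristic zero is geometrically
connected if its generic fibre is integral. -/
lemma geometricallyConnected_of_isIntegral {B : Subalgebra ℤ K} (G : Grp (Over (Spec (.of B))))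
    [IsProper G.X.hom] [Flat G.X.hom] [IsIntegral (pullback G.X.hom (specVal B))] :
    GeometricallyConnected G.X.hom := by
  refine geometricallyConnected_of_surjective_pow G fun n hn ↦ ?_
  have h₁ : IsDominant (𝟙 ((Over.pullback (specVal B)).mapGrp.obj G).X ^ n :
      _ ⟶ ((Over.pullback (specVal B)).mapGrp.obj G).X).left := by
    have : IsIntegral ((Over.pullback (specVal B)).mapGrp.obj G).X.left :=
      inferInstanceAs (IsIntegral (pullback G.X.hom (specVal B)))
    have : LocallyOfFiniteType ((Over.pullback (specVal B)).mapGrp.obj G).X.hom :=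
      inferInstanceAs (LocallyOfFiniteType (pullback.snd G.X.hom (specVal B)))
    exact isDominant_pow_left _ hn
  rw [overPullback_map_pow] at h₁
  obtain ⟨N, hN⟩ : ∃ N, N = (𝟙 G.X ^ n : G.X ⟶ G.X).left := ⟨_, rfl⟩
  have h₂ := (isPullback_overPullback_map (specVal B) (𝟙 G.X ^ n)).w
  have hw := Over.w (𝟙 G.X ^ n)
  rw [← hN] at h₂ hw ⊢
  have : IsDominant (pullback.fst G.X.hom (specVal B)) := inferInstance
  have : IsDominant (pullback.fst G.X.hom (specVal B) ≫ N) := by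
    rw [h₂]
    exact ⟨((pullback.fst G.X.hom (specVal B)).denseRange.comp h₁.denseRange
      (Scheme.Hom.continuous _))⟩
  have : IsDominant N := IsDominant.of_comp (pullback.fst G.X.hom (specVal B)) N
  have : IsProper (N ≫ G.X.hom) := by
    rw [hw]
    infer_instance
  have : IsProper N := IsProper.of_comp N G.X.hom
  -- `[n]` is dominant on the generic fibre, which is dense in `G`, and it is proper; its image is
  -- thus dense and closed, whatever the residue characteristics.
  refine ⟨Set.range_eq_univ.mp ?_⟩
  rw [← N.isClosedMap.isClosed_range.closure_eq, N.denseRange.closure_eq]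

end GeometricallyConnected

/-! ### Algebraically independent `p`-adic integers -/

section Padic

-- The fraction field `ℚ_[p]` has no larger cardinality than `ℤ_[p]`, and its cardinality is at
-- least the continuum.
open Cardinal in
lemma PadicInt.aleph0_lt_mk (p : ℕ) [Fact p.Prime] : ℵ₀ < #ℤ_[p] := by
  by_contra! h
  have h₁ : #ℚ_[p] ≤ #ℤ_[p] := IsLocalization.cardinalMk_le (nonZeroDivisors ℤ_[p])
  have h₂ := continuum_le_cardinal_of_nontriviallyNormedField ℚ_[p]
  exact aleph0_lt_continuum.not_ge (h₂.trans (h₁.trans h))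

open Cardinal in
/-- A commutative ring of uncountable cardinality contains infinitely many algebraically
independent elements over any countable subring. -/
lemma exists_algebraicIndependent_of_aleph0_lt {R A : Type} [CommRing R] [CommRing A] [Algebra R A]
    [IsDomain A] [FaithfulSMul R A] [Countable R] [Nontrivial R] (hA : ℵ₀ < #A) (n : ℕ) :
    ∃ t : Fin n → A, AlgebraicIndependent R t := by
  obtain ⟨s, hs⟩ := exists_isTranscendenceBasis R A
  -- With a finite transcendence basis, `A` would be algebraic over a countable ring, hence
  -- countable.
  have : Infinite s := by
    by_contra h
    rw [not_infinite_iff_finite] at h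
    have := hs.isAlgebraic
    have h₁ := Algebra.IsAlgebraic.cardinalMk_le_max
      (Algebra.adjoin R (Set.range ((↑) : s → A))) A
    have h₂ : #(Algebra.adjoin R (Set.range ((↑) : s → A))) ≤ ℵ₀ := by
      rw [← Cardinal.mk_congr hs.1.aevalEquiv.toEquiv]
      refine MvPolynomial.cardinalMk_le_max.trans ?_
      exact max_le (max_le (mk_le_aleph0_iff.mpr inferInstance)
        (mk_le_aleph0_iff.mpr inferInstance)) le_rfl
    exact hA.not_ge (h₁.trans (max_le h₂ le_rfl))
  exact ⟨fun i ↦ (Infinite.natEmbedding s i : A),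
    hs.1.comp (fun i : Fin n ↦ Infinite.natEmbedding s i)
      ((Infinite.natEmbedding s).injective.comp Fin.val_injective)⟩

/-- Independence is found over `ℤ`, inside `ℤ_[p]`, and passes to `ℚ` because `ℚ` is algebraic over
`ℤ`. -/
lemma PadicInt.exists_algebraicIndependent (p : ℕ) [Fact p.Prime] (n : ℕ) :
    ∃ t : Fin n → ℤ_[p], AlgebraicIndependent ℚ (fun i ↦ (t i : ℚ_[p])) := by
  obtain ⟨t, ht⟩ := exists_algebraicIndependent_of_aleph0_lt (R := ℤ) (aleph0_lt_mk p) n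
  refine ⟨t, ?_⟩
  have h : AlgebraicIndependent ℤ (fun i ↦ (t i : ℚ_[p])) :=
    ht.map' (f := (algebraMap ℤ_[p] ℚ_[p]).toIntAlgHom) (IsFractionRing.injective ℤ_[p] ℚ_[p])
  have : Algebra.IsAlgebraic ℤ ℚ :=
    (IsFractionRing.comap_isAlgebraic_iff (A := ℤ) (K := ℚ) (C := ℚ)).mpr inferInstance
  exact h.extendScalars ℚ

lemma PadicInt.aeval_mem_subring (p : ℕ) [Fact p.Prime] {σ : Type*} (t : σ → ℤ_[p])
    (f : MvPolynomial σ ℚ) (hf : ∀ m ∈ f.support, ¬ p ∣ (f.coeff m).den) :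
    MvPolynomial.aeval (fun i ↦ (t i : ℚ_[p])) f ∈ PadicInt.subring p := by
  rw [MvPolynomial.aeval_def, MvPolynomial.eval₂_eq]
  refine sum_mem fun m hm ↦ mul_mem ?_ (prod_mem fun i _ ↦ pow_mem (t i).2 _)
  exact Padic.norm_rat_le_one (hf m hm)

lemma isIntegral_padicInt_map {p : ℕ} [Fact p.Prime] {E F : Type*} [Field E] [Field F]
    [Algebra ℚ_[p] E] [Algebra ℚ_[p] F] (e : E →ₐ[ℚ_[p]] F) {x : E}
    (hx : IsIntegral (PadicInt.subring p) x) : IsIntegral (PadicInt.subring p) (e x) :=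
  hx.map (e.restrictScalars (PadicInt.subring p))

end Padic

/-! ### Embedding a finitely generated field into `p`-adic fields -/

section Embedding

variable {K₀ : Type u} [Field K₀] [CharZero K₀]

/-- Noether normalization of the `ℚ`-algebra generated by `T` together with field generators of
`K₀`. Including the latter makes all of `K₀` algebraic over the polynomial ring. -/
lemma exists_normalization (hK₀ : (⊤ : IntermediateField ℚ K₀).FG) (T : Finset K₀) :
    ∃ (n : ℕ) (g : MvPolynomial (Fin n) ℚ →ₐ[ℚ] K₀), Function.Injective g ∧
      (∀ x ∈ T, g.toRingHom.IsIntegralElem x) ∧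
      ∀ x, ∃ q : Polynomial (MvPolynomial (Fin n) ℚ), q ≠ 0 ∧ q.eval₂ g.toRingHom x = 0 := by
  obtain ⟨T', hT'⟩ := hK₀
  let R := Algebra.adjoin ℚ (T ∪ T' : Set K₀)
  have : Algebra.FiniteType ℚ R :=
    (Subalgebra.fg_iff_finiteType R).mp (⟨T.finite_toSet.union T'.finite_toSet |>.toFinset, by simp [R]⟩)
  obtain ⟨n, g, hg, hg'⟩ := exists_integral_inj_algHom_of_fg ℚ R
  let g' : MvPolynomial (Fin n) ℚ →ₐ[ℚ] K₀ := R.val.comp g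
  have hinj : Function.Injective g' := Subtype.val_injective.comp hg
  have hint : ∀ x ∈ R, g'.toRingHom.IsIntegralElem x := by
    intro x hx
    obtain ⟨q, hq, hq'⟩ := hg' ⟨x, hx⟩
    refine ⟨q, hq, ?_⟩
    have := congr(R.val.toRingHom $hq')
    rw [Polynomial.hom_eval₂, map_zero] at this
    exact this
  refine ⟨n, g', hinj, fun x hx ↦ hint x (Algebra.subset_adjoin (Or.inl hx)), ?_⟩
  let : Algebra (MvPolynomial (Fin n) ℚ) K₀ := g'.toRingHom.toAlgebra
  have : IsScalarTower ℚ (MvPolynomial (Fin n) ℚ) K₀ := .of_algebraMap_eq fun x ↦ (g'.commutes x).symm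
  have : FaithfulSMul (MvPolynomial (Fin n) ℚ) K₀ :=
    (faithfulSMul_iff_algebraMap_injective _ _).mpr hinj
  intro x
  have hx : x ∈ IntermediateField.adjoin ℚ (T' : Set K₀) := hT' ▸ IntermediateField.mem_top
  have key : IsAlgebraic (MvPolynomial (Fin n) ℚ) x := by
    induction hx using IntermediateField.adjoin_induction with
    | mem x hx =>
      have : IsIntegral (MvPolynomial (Fin n) ℚ) x :=
        hint x (Algebra.subset_adjoin (Or.inr hx))
      exact this.isAlgebraic
    | algebraMap x =>
      rw [IsScalarTower.algebraMap_apply ℚ (MvPolynomial (Fin n) ℚ) K₀]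
      exact isAlgebraic_algebraMap _
    | add x y _ _ hx hy => exact hx.add hy
    | inv x _ hx => exact hx.inv
    | mul x y _ _ hx hy => exact hx.mul hy
  exact key

/-- A field that is algebraic over a polynomial ring over `ℚ` embeds into an algebraic closure of
the `p`-adic numbers, with prescribed algebraically independent images of the variables. -/
lemma exists_ringHom_algebraicClosure (p : ℕ) [Fact p.Prime] {n : ℕ}
    (g : MvPolynomial (Fin n) ℚ →ₐ[ℚ] K₀) (hg : Function.Injective g)
    (hg' : ∀ x, ∃ q : Polynomial (MvPolynomial (Fin n) ℚ), q ≠ 0 ∧ q.eval₂ g.toRingHom x = 0)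
    {t : Fin n → ℚ_[p]} (ht : AlgebraicIndependent ℚ t) :
    ∃ ι : K₀ →+* AlgebraicClosure ℚ_[p],
      ∀ f, ι (g f) = algebraMap ℚ_[p] _ (MvPolynomial.aeval t f) := by
  let : Algebra (MvPolynomial (Fin n) ℚ) K₀ := g.toRingHom.toAlgebra
  let θ : MvPolynomial (Fin n) ℚ →+* AlgebraicClosure ℚ_[p] :=
    (algebraMap ℚ_[p] _).comp (MvPolynomial.aeval t).toRingHom
  let : Algebra (MvPolynomial (Fin n) ℚ) (AlgebraicClosure ℚ_[p]) := θ.toAlgebra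
  have : FaithfulSMul (MvPolynomial (Fin n) ℚ) K₀ :=
    (faithfulSMul_iff_algebraMap_injective _ _).mpr hg
  have : FaithfulSMul (MvPolynomial (Fin n) ℚ) (AlgebraicClosure ℚ_[p]) :=
    (faithfulSMul_iff_algebraMap_injective _ _).mpr ((algebraMap ℚ_[p] _).injective.comp ht)
  have : Algebra.IsAlgebraic (MvPolynomial (Fin n) ℚ) K₀ := ⟨fun x ↦ hg' x⟩
  let ι : K₀ →ₐ[MvPolynomial (Fin n) ℚ] AlgebraicClosure ℚ_[p] := IsAlgClosed.lift
  exact ⟨ι.toRingHom, fun f ↦ ι.commutes f⟩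

/-- A finitely generated field of characteristic zero embeds, for almost all primes `p`, into a
finite extension of `ℚ_[p]` in such a way that the image of a given finitely generated subring
consists of integral elements. -/
lemma exists_ringHom_padic (hK₀ : (⊤ : IntermediateField ℚ K₀).FG) {B : Subalgebra ℤ K₀}
    (hB : B.FG) : ∃ S : Finset ℕ, ∀ (p : ℕ) [Fact p.Prime], p ∉ S →
      ∃ (K : Type u) (_ : Field K) (_ : Algebra ℚ_[p] K) (_ : FiniteDimensional ℚ_[p] K)
        (ι : K₀ →+* K), ∀ b ∈ B, ι b ∈ padicRingOfIntegers p K := by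
  obtain ⟨T, hT⟩ := hB
  obtain ⟨n, g, hg, hint, halg⟩ := exists_normalization hK₀ T
  have hint' : ∀ x, ∃ q : Polynomial (MvPolynomial (Fin n) ℚ),
      x ∈ T → q.Monic ∧ q.eval₂ g.toRingHom x = 0 := by
    intro x
    by_cases hx : x ∈ T
    · obtain ⟨q, hq⟩ := hint x hx
      exact ⟨q, fun _ ↦ hq⟩
    · exact ⟨0, fun h ↦ absurd h hx⟩
  choose q hq using hint'
  -- The excluded primes are those dividing a denominator in one of the chosen integral equations.
  -- Elements outside `T` have no prescribed equation and do not enter.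
  refine ⟨T.biUnion fun x ↦ (q x).support.biUnion fun i ↦ ((q x).coeff i).support.biUnion fun m ↦
    (((q x).coeff i).coeff m).den.primeFactors, fun p hp hpS ↦ ?_⟩
  obtain ⟨t, ht⟩ := PadicInt.exists_algebraicIndependent p n
  obtain ⟨ι, hι⟩ := exists_ringHom_algebraicClosure p g hg halg ht
  have hcoeff : ∀ x ∈ T, ∀ i, MvPolynomial.aeval (fun i ↦ (t i : ℚ_[p])) ((q x).coeff i) ∈
      PadicInt.subring p := by
    intro x hx i
    by_cases hi : i ∈ (q x).support
    · refine PadicInt.aeval_mem_subring p t _ fun m hm hdvd ↦ hpS ?_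
      refine Finset.mem_biUnion.mpr ⟨x, hx, Finset.mem_biUnion.mpr ⟨i, hi,
        Finset.mem_biUnion.mpr ⟨m, hm, ?_⟩⟩⟩
      exact Nat.mem_primeFactors.mpr ⟨hp.out, hdvd, Rat.den_ne_zero _⟩
    · rw [Polynomial.notMem_support_iff.mp hi, map_zero]
      exact zero_mem _
  have hT' : ∀ x ∈ T, IsIntegral (PadicInt.subring p) (ι x) := by
    intro x hx
    obtain ⟨hm, h0⟩ := hq x hx
    -- Substituting the `tᵢ` for the variables turns the integral equation of `x` into a monic
    -- equation for `ι x` over the `p`-adic integers.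
    let Q : Polynomial ℚ_[p] := (q x).map (MvPolynomial.aeval fun i ↦ (t i : ℚ_[p])).toRingHom
    have hQ : Q.Monic := hm.map _
    have hQs : (Q.coeffs : Set ℚ_[p]) ⊆ PadicInt.subring p := by
      intro c hc
      obtain ⟨i, -, rfl⟩ := Polynomial.mem_coeffs_iff.mp (Finset.mem_coe.mp hc)
      rw [Polynomial.coeff_map]
      exact hcoeff x hx i
    refine ⟨Q.toSubring _ hQs, (Polynomial.monic_toSubring _ _ _).mpr hQ, ?_⟩
    have h₁ : (Q.toSubring _ hQs).map (PadicInt.subring p).subtype = Q := by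
      ext i
      rw [Polynomial.coeff_map]
      exact Polynomial.coeff_toSubring _ _ _
    have h₂ : algebraMap (PadicInt.subring p) (AlgebraicClosure ℚ_[p]) =
        (algebraMap ℚ_[p] _).comp (PadicInt.subring p).subtype := rfl
    rw [h₂, ← Polynomial.eval₂_map, h₁, Polynomial.eval₂_map]
    have h₃ := congr(ι $h0)
    rw [Polynomial.hom_eval₂, map_zero] at h₃
    rw [← h₃]
    congr 1
    ext f
    · exact (hι _).symm
    · exact (hι _).symm
  obtain ⟨T', hT₀⟩ := id hK₀
  -- The images of finitely many field generators generate a finite extension that contains all of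
  -- `ι(K₀)`.
  let E : IntermediateField ℚ_[p] (AlgebraicClosure ℚ_[p]) :=
    IntermediateField.adjoin ℚ_[p] (ι '' T')
  have : Finite (ι '' (T' : Set K₀)) := (T'.finite_toSet.image ι).to_subtype
  have hE : FiniteDimensional ℚ_[p] E :=
    IntermediateField.finiteDimensional_adjoin fun x _ ↦ Algebra.IsIntegral.isIntegral x
  have hιE : ∀ x, ι x ∈ E := by
    intro x
    have hx : x ∈ IntermediateField.adjoin ℚ (T' : Set K₀) := hT₀ ▸ IntermediateField.mem_top
    induction hx using IntermediateField.adjoin_induction with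
    | mem x hx => exact IntermediateField.subset_adjoin _ _ ⟨x, hx, rfl⟩
    | algebraMap x =>
      rw [eq_ratCast, map_ratCast]
      exact SubfieldClass.ratCast_mem E x
    | add x y _ _ hx hy => rw [map_add]; exact add_mem hx hy
    | inv x _ hx => rw [map_inv₀]; exact inv_mem hx
    | mul x y _ _ hx hy => rw [map_mul]; exact mul_mem hx hy
  let e : E ≃ₐ[ℚ_[p]] ULift.{u} E := ULift.algEquiv.symm
  let ιE : K₀ →+* E := ι.codRestrict E.toSubring hιE
  refine ⟨ULift.{u} E, inferInstance, inferInstance, Module.Finite.equiv e.toLinearEquiv,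
    (e : E →+* ULift.{u} E).comp ιE, fun b hb ↦ ?_⟩
  have hb' : b ∈ Algebra.adjoin ℤ (T : Set K₀) := hT ▸ hb
  have hbE : IsIntegral (PadicInt.subring p) (ιE b) := by
    let v : E →ₐ[PadicInt.subring p] AlgebraicClosure ℚ_[p] := E.val.restrictScalars _
    have hv : Function.Injective v := Subtype.val_injective
    rw [← isIntegral_algHom_iff v hv]
    change IsIntegral (PadicInt.subring p) (ι b)
    clear hb
    induction hb' using Algebra.adjoin_induction with
    | mem x hx => exact hT' x hx
    | algebraMap r =>
      rw [eq_intCast, map_intCast, ← map_intCast (algebraMap (PadicInt.subring p)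
        (AlgebraicClosure ℚ_[p]))]
      exact isIntegral_algebraMap
    | add x y _ _ hx hy => rw [map_add]; exact hx.add hy
    | mul x y _ _ hx hy => rw [map_mul]; exact hx.mul hy
  exact isIntegral_padicInt_map e.toAlgHom hbE

end Embedding

/-! ### Abelian schemes over finitely generated subrings, and the conclusion -/

section BaseChange

lemma nonempty_groupSchemeBaseChange_comp_iso {S T T' : Scheme.{u}} (f : T' ⟶ T) (g : T ⟶ S)
    (G : Grp (Over S)) : Nonempty (groupSchemeBaseChange (f ≫ g) G ≅
      groupSchemeBaseChange f (groupSchemeBaseChange g G)) :=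
  ⟨(Functor.mapGrpNatIso (Over.pullbackComp f g) ≪≫ Functor.mapGrpCompIso).app G⟩

lemma IsAbelianScheme.baseChange {S T : Scheme.{u}} (f : T ⟶ S) {G : Grp (Over S)}
    (hG : IsAbelianScheme G) : IsAbelianScheme (groupSchemeBaseChange f G) where
  smooth :=
    have := hG.smooth
    inferInstanceAs (Smooth (pullback.snd G.X.hom f))
  isProper :=
    have := hG.isProper
    inferInstanceAs (IsProper (pullback.snd G.X.hom f))
  geometricallyConnected :=
    have := hG.geometricallyConnected
    inferInstanceAs (GeometricallyConnected (pullback.snd G.X.hom f))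

/-- An abelian variety over a field of characteristic zero extends to an abelian scheme over a
finitely generated subring. -/
lemma IsAbelianVariety.exists_isAbelianScheme {K : Type u} [Field K] [CharZero K]
    {A : Grp (Over (Spec (.of K)))} (hA : IsAbelianVariety A) :
    ∃ (B : Subalgebra ℤ K) (_ : B.FG) (Y : Grp (Over (Spec (.of B)))), IsAbelianScheme Y ∧
      Nonempty (groupSchemeBaseChange (specVal B) Y ≅ A) := by
  have := hA.isProper
  have := hA.geometricallyIntegral
  have : IsIntegral A.X.left := by
    have h : IsPullback (𝟙 A.X.left) A.X.hom A.X.hom (𝟙 (Spec (.of K))) :=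
      IsPullback.of_horiz_isIso ⟨by simp⟩
    exact GeometricallyIntegral.geometrically_isIntegral (f := A.X.hom) _ _ _ h
  have : Smooth A.X.hom :=
    let : GrpObj (Over.mk A.X.hom) := A.grp
    smooth_of_grpObj A.X.hom
  have : CompactSpace A.X.left := QuasiCompact.compactSpace_of_compactSpace A.X.hom
  have : QuasiSeparatedSpace A.X.left := quasiSeparatedSpace_of_quasiSeparated A.X.hom
  obtain ⟨B₁, hB₁, M₁, _, _⟩ := SpecModel.exists_smooth A.X.hom
  obtain ⟨B₂, hB₂, M₂, a, _⟩ := M₁.exists_isProper hB₁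
  have : Smooth M₂.hom := a.smooth
  obtain ⟨B, hB, M, b, Y, hY, e⟩ := SpecModel.exists_grp A M₂ hB₂
  have hs : Smooth M.hom := b.smooth
  have hp : IsProper M.hom := b.isProper
  have hi : IsIntegral (pullback M.hom (specVal B)) := by
    have : Nonempty (pullback M.hom (specVal B) :) :=
      ⟨M.isPullback.isoPullback.hom (genericPoint A.X.left)⟩
    exact isIntegral_of_isOpenImmersion M.isPullback.isoPullback.inv
  refine ⟨B, hB, Y, ?_, e⟩
  have hs' : Smooth Y.X.hom := by rw [hY]; exact hs
  have hp' : IsProper Y.X.hom := by rw [hY]; exact hp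
  have hi' : IsIntegral (pullback Y.X.hom (specVal B)) := by rw [hY]; exact hi
  exact ⟨hs', hp', geometricallyConnected_of_isIntegral Y⟩

end BaseChange

end

theorem proposition6 {K₀ : Type u} [Field K₀] [CharZero K₀]
    (hK₀ : (⊤ : IntermediateField ℚ K₀).FG)
    (A : Grp (Over (Spec (.of K₀)))) (hA : IsAbelianVariety A) :
    ∃ S : Finset ℕ, ∀ (p : ℕ) [Fact p.Prime], p ∉ S →
      ∃ (K : Type u) (_ : Field K) (_ : Algebra ℚ_[p] K) (_ : FiniteDimensional ℚ_[p] K)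
        (ι : K₀ →+* K),
        HasGoodReduction (padicRingOfIntegers p K)
          (groupSchemeBaseChange (Spec.map (CommRingCat.ofHom ι)) A) := by
  obtain ⟨B, hB, Y, hY, ⟨e⟩⟩ := hA.exists_isAbelianScheme
  obtain ⟨S, hS⟩ := exists_ringHom_padic hK₀ hB
  refine ⟨S, fun p _ hp ↦ ?_⟩
  obtain ⟨K, _, _, _, ι, hι⟩ := hS p hp
  refine ⟨K, inferInstance, inferInstance, inferInstance, ι, ?_⟩
  let ρ : B →+* padicRingOfIntegers p K :=
    (ι.comp B.val.toRingHom).codRestrict (padicRingOfIntegers p K).toSubring fun b ↦ hι b b.2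
  refine ⟨groupSchemeBaseChange (Spec.map (CommRingCat.ofHom ρ)) Y, hY.baseChange _, ?_⟩
  obtain ⟨e₁⟩ := nonempty_groupSchemeBaseChange_comp_iso
    (Spec.map (CommRingCat.ofHom (algebraMap (padicRingOfIntegers p K) K)))
    (Spec.map (CommRingCat.ofHom ρ)) Y
  obtain ⟨e₂⟩ := nonempty_groupSchemeBaseChange_comp_iso
    (Spec.map (CommRingCat.ofHom ι)) (specVal B) Y
  -- Both routes from `B` to `K`, through the ring of integers and through `K₀`, are the same ring
  -- map, so the generic fibre of the pulled-back scheme is `A_K`.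
  have h : Spec.map (CommRingCat.ofHom (algebraMap (padicRingOfIntegers p K) K)) ≫
      Spec.map (CommRingCat.ofHom ρ) = Spec.map (CommRingCat.ofHom ι) ≫ specVal B :=
    (Spec.map_comp _ _).symm.trans
      (Spec.map_comp (CommRingCat.ofHom B.val.toRingHom) (CommRingCat.ofHom ι))
  rw [h] at e₁
  exact ⟨e₁.symm ≪≫ e₂ ≪≫
    (Over.pullback (Spec.map (CommRingCat.ofHom ι))).mapGrp.mapIso e⟩
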